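/- A (Čech) closure space is a set $X$ with a map $c$ on subsets such that $c(\emptyset)=\emptyset$, $S\subseteq c(S)$ and $c(S\cup T)=c(S)\cup c(T)$; a map $f$ is continuous if $f(c(S))\subseteq c(f(S))$ for all $S$. Write $i(S)=X\setminus c(X\setminus S)$; $B$ is a neighborhood of $A$ if $A\subseteq i(B)$, and $A$ is closed if $c(A)=A$. Subsets carry the subspace closure, $\times$ denotes the product closure, and $X/A$ is the set obtained from $X$ by collapsing $A$ to a point, with closure $S\mapsto q(c(q^{-1}(S)))$, where $q:X\to X/A$ is the quotient map. Let $J\in\{I,J_+,J_1\}$, where $I=[0,1]$ is the unit interval, $J_+$ is $\{0,1\}$ with $c(0)=\{0,1\}$, $c(1)=\{1\}$, and $J_1$ is $\{0,1\}$ with the indiscrete closure. Let $H_n$ be one of the following two theories, with integer coefficients. * Simplicial: the homology of the complex of free abelian groups on the continuous maps $\Delta^n_J\to X$ with the alternating sum of faces as boundary. Here $\Delta^n_I$ is the topological $n$-simplex, $\Delta^n_{J_+}=\{0,\dots,n\}$ with $c(i)=\{j: j\ge i\}$, and $\Delta^n_{J_1}=\{0,\dots,n\}$ with the indiscrete closure.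 * $(J,\times)$ cubical: the homology of the complex of free abelian groups on the continuous maps $J^{\times n}\to X$ modulo the degenerate ones (those that do not depend on some coordinate), with $\partial\sigma=\sum_{i=1}^n(-1)^i(\sigma|_{a_i=0}-\sigma|_{a_i=1})$. Let $C_\bullet$ be the chain complex, $H_n(X,A)$ the homology of $C_\bullet(X)/C_\bullet(A)$, and $\tilde H_n$ ($n\ge 0$) the homology of $C_\bullet$ augmented by $C_0\to\mathbb Z$, $\sum n_k\sigma_k\mapsto\sum n_k$. Let $A\subseteq X$. Two continuous maps are $(J,\times)$-homotopic relative to $A$ if they are related by the equivalence relation generated by: $f\sim g$ if there is a continuous $H:X\times J\to Y$ with $H(\cdot,0)=f$, $H(\cdot,1)=g$ and $H(a,t)=f(a)$ for all $a\in A$, $t\in J$. A closure space $B\supseteq A$ $(J,\times)$ deformation retracts onto $A$ if the identity of $B$ is $(J,\times)$-homotopic relative to $A$ to a retraction of $B$ onto $A$ (regarded as a map $B\to B$). The pair $(X,A)$ is a $(J,\times)$-good pair if some neighborhood $B$ of $A$ in $X$ $(J,\times)$ deformation retracts onto $A$. **Theorem.** Let $(X,A)$ be a $(J,\times)$-good pair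 of closure spaces, and, if $J\ne J_1$, suppose that $A$ is closed in $X$. Then, for both theories: 1. The quotient map $q:(X,A)\to(X/A,A/A)$, where $A/A=q(A)$, induces isomorphisms $q_*:H_n(X,A)\to H_n(X/A,A/A)$ for all $n\ge 0$. 2. If $A\neq\emptyset$, the canonical map $\kappa:\tilde H_n(X/A)\to H_n(X/A,A/A)$ is an isomorphism for all $n\ge0$; hence $H_n(X,A)\cong\tilde H_n(X/A)$. 3. If $A\neq\emptyset$, there is a long exact sequence $$\cdots\to\tilde H_n(A)\xrightarrow{i_*}\tilde H_n(X)\xrightarrow{q_*}\tilde H_n(X/A)\xrightarrow{\delta}\tilde H_{n-1}(A)\xrightarrow{i_*}\cdots\to\tilde H_0(X)\xrightarrow{q_*}\tilde H_0(X/A)\to0,$$ where $i:A\to X$ is the inclusion and where $\delta$ is compatible with the connecting homomorphism $\partial:H_n(X,A)\to H_{n-1}(A)$ of the pair: if $q_*x=\kappa y$ in $H_n(X/A,A/A)$ with $x\in H_n(X,A)$, $y\in\tilde H_n(X/A)$, then the image of $\delta y$ in $H_{n-1}(A)$ is $\partial x$. -/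

import Mathlib

open CategoryTheory CategoryTheory.Limits

universe u v w

/-! ## Čech closure spaces -/

/-- A Čech closure space: a set with a closure operation (not assumed idempotent). -/
structure Cl : Type (u + 1) where
  carrier : Type u
  cl : Set carrier → Set carrier
  cl_empty : cl ∅ = ∅
  subset_cl : ∀ S, S ⊆ cl S
  cl_union : ∀ S T, cl (S ∪ T) = cl S ∪ cl T

namespace Cl

instance : CoeSort Cl.{u} (Type u) := ⟨Cl.carrier⟩

/-- The interior operation of a closure space. -/
def int (X : Cl.{u}) (S : Set X) : Set X := (X.cl Sᶜ)ᶜ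

/-- `B` is a neighborhood of `A`. -/
def IsNhd (X : Cl.{u}) (B A : Set X) : Prop := A ⊆ X.int B

/-- `A` is closed. -/
def Closed (X : Cl.{u}) (A : Set X) : Prop := X.cl A = A

lemma cl_mono (X : Cl.{u}) {S T : Set X} (h : S ⊆ T) : X.cl S ⊆ X.cl T := by
  have := X.cl_union S T
  rw [Set.union_eq_self_of_subset_left h] at this
  rw [this]
  exact Set.subset_union_left

lemma int_subset (X : Cl.{u}) (S : Set X) : X.int S ⊆ S := fun x hx => by
  by_contra h
  exact hx (X.subset_cl _ h)

lemma int_univ (X : Cl.{u}) : X.int Set.univ = Set.univ := by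
  simp [int, X.cl_empty]

lemma int_inter (X : Cl.{u}) (S T : Set X) : X.int (S ∩ T) = X.int S ∩ X.int T := by
  simp [int, Set.compl_inter, X.cl_union, Set.compl_union]

lemma inter_nonempty (X : Cl.{u}) {S U : Set X} {x : X} (hx : x ∈ X.cl S) (hU : x ∈ X.int U) :
    (S ∩ U).Nonempty := by
  by_contra h
  rw [Set.not_nonempty_iff_eq_empty] at h
  apply hU
  refine X.cl_mono ?_ hx
  intro y hy hyU
  exact (h ▸ (⟨hy, hyU⟩ : y ∈ S ∩ U) : y ∈ (∅ : Set X))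

/-- Continuous maps of closure spaces. -/
@[ext]
structure Hom (X : Cl.{u}) (Y : Cl.{v}) : Type (max u v) where
  toFun : X → Y
  cont : ∀ S : Set X, toFun '' X.cl S ⊆ Y.cl (toFun '' S)

instance (X : Cl.{u}) (Y : Cl.{v}) : CoeFun (Hom X Y) (fun _ => X → Y) := ⟨Hom.toFun⟩

/-- The identity map. -/
def Hom.id (X : Cl.{u}) : Hom X X := ⟨fun x => x, fun S => by simp⟩

/-- Composition, written in the order of application. -/
def Hom.comp {X : Cl.{u}} {Y : Cl.{v}} {Z : Cl.{w}} (f : Hom X Y) (g : Hom Y Z) : Hom X Z where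
  toFun x := g (f x)
  cont S := by
    rintro _ ⟨x, hx, rfl⟩
    have h1 := f.cont S ⟨x, hx, rfl⟩
    have h2 := g.cont _ ⟨_, h1, rfl⟩
    rwa [Set.image_image] at h2

instance : Category Cl.{u} where
  Hom X Y := Hom X Y
  id := Hom.id
  comp f g := f.comp g

lemma Hom.preimage_nhd {X : Cl.{u}} {Y : Cl.{v}} (f : Hom X Y) {x : X} {V : Set Y}
    (h : f x ∈ Y.int V) : x ∈ X.int (f.toFun ⁻¹' V) := by
  intro hx
  apply h
  refine Y.cl_mono ?_ (f.cont _ ⟨x, hx, rfl⟩)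
  rintro _ ⟨y, hy, rfl⟩
  exact hy

/-- The closure space underlying a topological space. -/
def ofTop (X : Type u) [TopologicalSpace X] : Cl.{u} where
  carrier := X
  cl := closure
  cl_empty := closure_empty
  subset_cl _ := subset_closure
  cl_union _ _ := closure_union

/-- The closure `i ↦ {j | i ≤ j}` on a preorder. -/
def upper (X : Type u) [Preorder X] : Cl.{u} where
  carrier := X
  cl S := {j | ∃ i ∈ S, i ≤ j}
  cl_empty := by simp
  subset_cl _ i hi := ⟨i, hi, le_rfl⟩
  cl_union S T := by
    ext j
    constructor
    · rintro ⟨i, hi | hi, h⟩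
      exacts [Or.inl ⟨i, hi, h⟩, Or.inr ⟨i, hi, h⟩]
    · rintro (⟨i, hi, h⟩ | ⟨i, hi, h⟩)
      exacts [⟨i, Or.inl hi, h⟩, ⟨i, Or.inr hi, h⟩]

/-- The indiscrete closure: the closure of every nonempty set is everything. -/
def indiscrete (X : Type u) : Cl.{u} where
  carrier := X
  cl S := {_j | S.Nonempty}
  cl_empty := by simp
  subset_cl _ i hi := ⟨i, hi⟩
  cl_union S T := by
    ext j
    simp [Set.union_nonempty]

/-- The product closure on a product of a family of closure spaces. -/
def pi {ι : Type v} (X : ι → Cl.{u}) : Cl.{max u v} where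
  carrier := ∀ i, X i
  cl S := {x | ∀ (F : Finset ι) (V : ∀ i, Set (X i)), (∀ i ∈ F, x i ∈ (X i).int (V i)) →
    ∃ y ∈ S, ∀ i ∈ F, y i ∈ V i}
  cl_empty := by
    ext x
    simp only [Set.mem_ofPred_eq, Set.mem_empty_iff_false, iff_false]
    intro h
    obtain ⟨y, hy, -⟩ := h ∅ (fun _ => Set.univ) (by simp)
    exact hy
  subset_cl S x hx F V hV := ⟨x, hx, fun i hi => (X i).int_subset _ (hV i hi)⟩
  cl_union S T := by
    classical
    ext x
    constructor
    · intro h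
      by_contra hn
      simp only [Set.mem_union, Set.mem_ofPred_eq, not_or] at hn
      obtain ⟨h1, h2⟩ := hn
      push Not at h1 h2
      obtain ⟨F1, V1, hV1, h1⟩ := h1
      obtain ⟨F2, V2, hV2, h2⟩ := h2
      obtain ⟨y, hy, hyV⟩ := h (F1 ∪ F2)
        (fun i => {z | i ∈ F1 → z ∈ V1 i} ∩ {z | i ∈ F2 → z ∈ V2 i}) (fun i _ => by
          rw [(X i).int_inter]
          constructor
          · by_cases hi : i ∈ F1
            · simpa [hi] using hV1 i hi
            · simp [hi, (X i).int_univ]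
          · by_cases hi : i ∈ F2
            · simpa [hi] using hV2 i hi
            · simp [hi, (X i).int_univ])
      rcases hy with hy | hy
      · obtain ⟨i, hi, h⟩ := h1 y hy
        exact h ((hyV i (Finset.mem_union_left _ hi)).1 hi)
      · obtain ⟨i, hi, h⟩ := h2 y hy
        exact h ((hyV i (Finset.mem_union_right _ hi)).2 hi)
    · rintro (h | h) F V hV
      · obtain ⟨y, hy, h⟩ := h F V hV
        exact ⟨y, Or.inl hy, h⟩
      · obtain ⟨y, hy, h⟩ := h F V hV
        exact ⟨y, Or.inr hy, h⟩

/-- The product closure on a product of two closure spaces. -/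
def prod (X : Cl.{u}) (Y : Cl.{v}) : Cl.{max u v} where
  carrier := X × Y
  cl S := {x | ∀ (U : Set X) (V : Set Y), x.1 ∈ X.int U → x.2 ∈ Y.int V →
    ∃ y ∈ S, y.1 ∈ U ∧ y.2 ∈ V}
  cl_empty := by
    ext x
    simp only [Set.mem_ofPred_eq, Set.mem_empty_iff_false, iff_false]
    intro h
    obtain ⟨y, hy, -⟩ := h Set.univ Set.univ (by simp [int_univ]) (by simp [int_univ])
    exact hy
  subset_cl S x hx U V hU hV := ⟨x, hx, X.int_subset _ hU, Y.int_subset _ hV⟩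
  cl_union S T := by
    ext x
    constructor
    · intro h
      by_contra hn
      simp only [Set.mem_union, Set.mem_ofPred_eq, not_or] at hn
      obtain ⟨h1, h2⟩ := hn
      push Not at h1 h2
      obtain ⟨U1, V1, hU1, hV1, h1⟩ := h1
      obtain ⟨U2, V2, hU2, hV2, h2⟩ := h2
      obtain ⟨y, hy, hyU, hyV⟩ := h (U1 ∩ U2) (V1 ∩ V2)
        (by rw [int_inter]; exact ⟨hU1, hU2⟩) (by rw [int_inter]; exact ⟨hV1, hV2⟩)
      rcases hy with hy | hy
      · exact h1 y hy hyU.1 hyV.1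
      · exact h2 y hy hyU.2 hyV.2
    · rintro (h | h) U V hU hV
      · obtain ⟨y, hy, h⟩ := h U V hU hV
        exact ⟨y, Or.inl hy, h⟩
      · obtain ⟨y, hy, h⟩ := h U V hU hV
        exact ⟨y, Or.inr hy, h⟩

lemma int_biInter (X : Cl.{u}) {ι : Type v} (F : Finset ι) (U : ι → Set X) (x : X)
    (h : ∀ i ∈ F, x ∈ X.int (U i)) : x ∈ X.int {y | ∀ i ∈ F, y ∈ U i} := by
  classical
  induction F using Finset.induction_on with
  | empty => simp [int_univ]
  | insert a F _ ih =>
    have : {y | ∀ i ∈ insert a F, y ∈ U i} = U a ∩ {y | ∀ i ∈ F, y ∈ U i} := by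
      ext y
      simp
    rw [this, int_inter]
    exact ⟨h a (by simp), ih fun i hi => h i (by simp [hi])⟩

/-- The map into a product with given continuous components. -/
def Hom.piLift {ι : Type v} {X : ι → Cl.{u}} {Y : Cl.{w}} (f : ∀ i, Hom Y (X i)) :
    Hom Y (pi X) where
  toFun y i := f i y
  cont S := by
    rintro _ ⟨y, hy, rfl⟩ F V hV
    obtain ⟨z, hz, hzU⟩ := Y.inter_nonempty hy
      (Y.int_biInter F (fun i => (f i).toFun ⁻¹' V i) y fun i hi => (f i).preimage_nhd (hV i hi))
    exact ⟨_, ⟨z, hz, rfl⟩, hzU⟩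

/-- The coordinate projections of a product. -/
def Hom.proj {ι : Type v} (X : ι → Cl.{u}) (i : ι) : Hom (pi X) (X i) where
  toFun x := x i
  cont S := by
    classical
    rintro _ ⟨x, hx, rfl⟩
    by_contra h
    obtain ⟨y, hy, hyV⟩ := hx {i} (fun j => {z | ∀ e : j = i, (e ▸ z : X i) ∉ (fun x => x i) '' S})
      (by
        intro j hj
        obtain rfl := Finset.mem_singleton.mp hj
        intro hc
        apply h
        convert hc using 2
        ext z
        simp)
    exact hyV i (by simp) rfl ⟨y, hy, rfl⟩

/-- Constant maps. -/
def Hom.const (X : Cl.{u}) {Y : Cl.{v}} (y : Y) : Hom X Y where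
  toFun _ := y
  cont S := by
    rintro _ ⟨x, hx, rfl⟩
    apply Y.subset_cl
    by_cases h : S.Nonempty
    · obtain ⟨z, hz⟩ := h
      exact ⟨z, hz, rfl⟩
    · rw [Set.not_nonempty_iff_eq_empty] at h
      subst h
      simp [X.cl_empty] at hx

/-- A subset with the subspace closure. -/
def sub (X : Cl.{u}) (A : Set X) : Cl.{u} where
  carrier := A
  cl S := {a | (a : X) ∈ X.cl (Subtype.val '' S)}
  cl_empty := by simp [X.cl_empty]
  subset_cl S a ha := X.subset_cl _ ⟨a, ha, rfl⟩
  cl_union S T := by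
    ext a
    simp [Set.image_union, X.cl_union]

/-- The inclusion of a subspace. -/
def incl (X : Cl.{u}) (A : Set X) : X.sub A ⟶ X where
  toFun := Subtype.val
  cont S := by
    rintro _ ⟨a, ha, rfl⟩
    exact ha

lemma Hom.comp_incl_injective {Z : Cl.{v}} {X : Cl.{u}} (A : Set X) :
    Function.Injective fun σ : Hom Z (X.sub A) => σ.comp (X.incl A) := by
  intro σ τ h
  ext x
  exact Subtype.ext (congrArg (fun ρ : Hom Z X => ρ x) h)

/-- The restriction of a map of pairs `(X, A) ⟶ (Y, B)` to the subspaces. -/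
def restr {X Y : Cl.{u}} (f : X ⟶ Y) {A : Set X} {B : Set Y} (h : Set.MapsTo (Hom.toFun f) A B) :
    X.sub A ⟶ Y.sub B where
  toFun a := ⟨Hom.toFun f a.1, h a.2⟩
  cont S := by
    rintro _ ⟨a, ha, rfl⟩
    refine Y.cl_mono ?_ (Hom.cont f _ ⟨_, ha, rfl⟩)
    rintro _ ⟨_, ⟨b, hb, rfl⟩, rfl⟩
    exact ⟨_, ⟨b, hb, rfl⟩, rfl⟩

/-- The relation that collapses `A` to a point. -/
def collapse (X : Cl.{u}) (A : Set X) : Setoid X where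
  r x y := x = y ∨ (x ∈ A ∧ y ∈ A)
  iseqv :=
    { refl := fun _ => Or.inl rfl
      symm := by
        rintro x y (rfl | ⟨hx, hy⟩)
        exacts [Or.inl rfl, Or.inr ⟨hy, hx⟩]
      trans := by
        rintro x y z (rfl | ⟨hx, hy⟩) (rfl | ⟨hy', hz⟩)
        exacts [Or.inl rfl, Or.inr ⟨hy', hz⟩, Or.inr ⟨hx, hy⟩, Or.inr ⟨hx, hz⟩] }

/-- The quotient `X / A` with the quotient closure `S ↦ q (c (q⁻¹ S))`. -/
def quot (X : Cl.{u}) (A : Set X) : Cl.{u} where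
  carrier := Quotient (X.collapse A)
  cl S := Quotient.mk _ '' X.cl (Quotient.mk _ ⁻¹' S)
  cl_empty := by simp [X.cl_empty]
  subset_cl S y hy := by
    obtain ⟨x, rfl⟩ := Quotient.exists_rep y
    exact ⟨x, X.subset_cl _ hy, rfl⟩
  cl_union S T := by
    rw [Set.preimage_union, X.cl_union, Set.image_union]

/-- The quotient map `X ⟶ X / A`. -/
def quotMap (X : Cl.{u}) (A : Set X) : X ⟶ X.quot A where
  toFun := Quotient.mk _
  cont _ := Set.image_mono (X.cl_mono (Set.subset_preimage_image _ _))

/-- The image `A / A` of `A` in `X / A`. -/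
def quotImage (X : Cl.{u}) (A : Set X) : Set (X.quot A) := (X.quotMap A).toFun '' A

end Cl

/-! ## The intervals, simplices and cubes -/

/-- The three choices of interval: `[0,1]`, `J₊` and `J₁`. -/
inductive Intv
  | unit
  | plus
  | one

namespace Intv

/-- The closure space of the interval. -/
noncomputable def space : Intv → Cl.{0}
  | unit => Cl.ofTop unitInterval
  | plus => Cl.upper (Fin 2)
  | one => Cl.indiscrete (Fin 2)

/-- The endpoint `0`. -/
noncomputable def zeroPt : ∀ J : Intv, J.space
  | unit => (0 : unitInterval)
  | plus => (0 : Fin 2)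
  | one => (0 : Fin 2)

/-- The endpoint `1`. -/
noncomputable def onePt : ∀ J : Intv, J.space
  | unit => (1 : unitInterval)
  | plus => (1 : Fin 2)
  | one => (1 : Fin 2)

/-- The `n`-simplex: the topological simplex for `[0,1]`, and `{0, …, n}` with the closure
`i ↦ {j | i ≤ j}` for `J₊`, with the indiscrete closure for `J₁`. -/
noncomputable def simplex : Intv → ℕ → Cl.{0}
  | unit, n => Cl.ofTop (stdSimplex ℝ (Fin (n + 1)))
  | plus, n => Cl.upper (Fin (n + 1))
  | one, n => Cl.indiscrete (Fin (n + 1))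

/-- The map of simplices induced by a monotone map of vertices. -/
noncomputable def simplexMap : ∀ (J : Intv) {m n : ℕ} (_ : Fin (m + 1) →o Fin (n + 1)),
    Cl.Hom (J.simplex m) (J.simplex n)
  | unit, m, n, f => ⟨(stdSimplex.map f : stdSimplex ℝ (Fin (m + 1)) → stdSimplex ℝ (Fin (n + 1))),
      fun _ => image_closure_subset_closure_image
        (X := stdSimplex ℝ (Fin (m + 1))) (Y := stdSimplex ℝ (Fin (n + 1)))
        (stdSimplex.continuous_map f)⟩
  | plus, _, _, f => ⟨f, by
      rintro S _ ⟨j, ⟨i, hi, hij⟩, rfl⟩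
      exact ⟨f i, ⟨i, hi, rfl⟩, f.monotone hij⟩⟩
  | one, _, _, f => ⟨f, by
      rintro S _ ⟨j, ⟨i, hi⟩, rfl⟩
      exact ⟨f i, ⟨i, hi, rfl⟩⟩⟩

lemma simplexMap_id (J : Intv) (n : ℕ) :
    J.simplexMap (OrderHom.id : Fin (n + 1) →o Fin (n + 1)) = Cl.Hom.id _ := by
  cases J
  · ext x
    exact stdSimplex.map_id_apply x
  · rfl
  · rfl

lemma simplexMap_comp (J : Intv) {l m n : ℕ} (f : Fin (l + 1) →o Fin (m + 1))
    (g : Fin (m + 1) →o Fin (n + 1)) :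
    J.simplexMap (g.comp f) = (J.simplexMap f).comp (J.simplexMap g) := by
  cases J
  · ext x
    exact (stdSimplex.map_comp_apply f g x).symm
  · rfl
  · rfl

/-- The `n`-cube: the `n`-fold product, with the product closure. -/
noncomputable def cube (J : Intv) (n : ℕ) : Cl.{0} := Cl.pi fun _ : Fin n => J.space

/-- Insertion of a value `e` at the coordinate `i`. -/
noncomputable def cubeInsert (J : Intv) {n : ℕ} (i : Fin (n + 1)) (e : J.space) :
    Cl.Hom (J.cube n) (J.cube (n + 1)) where
  toFun x := i.insertNth (α := fun _ => J.space) e x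
  cont := by
    have h : ∀ j : Fin (n + 1), ∃ f : Cl.Hom (J.cube n) J.space,
        ∀ x : J.cube n, f x = i.insertNth (α := fun _ => J.space) e x j := fun j => by
      induction j using Fin.succAboveCases i with
      | x => exact ⟨Cl.Hom.const _ e, fun x =>
        (Fin.insertNth_apply_same (α := fun _ => J.space) i e x).symm⟩
      | p k => exact ⟨Cl.Hom.proj _ k, fun x =>
        (Fin.insertNth_apply_succAbove (α := fun _ => J.space) i e x k).symm⟩
    choose f hf using h
    have key : (fun x : J.cube n => (i.insertNth (α := fun _ => J.space) e x : J.cube (n + 1))) =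
        (Cl.Hom.piLift f).toFun := by
      funext x j
      exact (hf j x).symm
    rw [key]
    exact (Cl.Hom.piLift f).cont

end Intv

/-! ## Singular simplicial chains -/

/-- The free abelian group functor. -/
noncomputable def freeZ : Type u ⥤ ModuleCat.{u} ℤ where
  obj S := ModuleCat.of ℤ (S →₀ ℤ)
  map f := ModuleCat.ofHom (Finsupp.lmapDomain ℤ ℤ f)
  map_id S := by
    ext : 1
    exact Finsupp.lmapDomain_id ℤ ℤ
  map_comp f g := by
    ext : 1
    exact Finsupp.lmapDomain_comp ℤ ℤ f g

/-- The `J` nerve of a closure space: its `n`-simplices are the continuous maps from the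
`n`-simplex. -/
noncomputable def clNerve (J : Intv) : Cl.{u} ⥤ SSet.{u} where
  obj X :=
    { obj n := Cl.Hom (J.simplex n.unop.len) X
      map f := TypeCat.ofHom fun σ => (J.simplexMap f.unop.toOrderHom).comp σ
      map_id n := by
        ext σ : 3
        exact congrArg (Cl.Hom.comp · σ) (J.simplexMap_id _)
      map_comp f g := by
        ext σ : 3
        exact congrArg (Cl.Hom.comp · σ) (J.simplexMap_comp _ _) }
  map f := { app n := TypeCat.ofHom fun σ => σ.comp f }

/-- The complex of singular simplicial chains: free abelian groups on the singular simplices, with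
the alternating sum of the faces as boundary. -/
noncomputable def simpChains (J : Intv) : Cl.{u} ⥤ ChainComplex (ModuleCat.{u} ℤ) ℕ :=
  clNerve J ⋙ (SimplicialObject.whiskering _ _).obj freeZ ⋙
    AlgebraicTopology.alternatingFaceMapComplex (ModuleCat.{u} ℤ)

/-! ## Singular cubical chains -/

lemma alternating_sum_comp_eq_zero {M₀ M₁ M₂ : Type u} [AddCommGroup M₀] [AddCommGroup M₁]
    [AddCommGroup M₂] {n : ℕ} (a : Fin (n + 1) → M₁ →ₗ[ℤ] M₀) (b : Fin (n + 2) → M₂ →ₗ[ℤ] M₁)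
    (h : ∀ (i : Fin (n + 1)) (j : Fin (n + 2)) (hij : (j : ℕ) ≤ i),
      a i ∘ₗ b j = a (Fin.castLT j (lt_of_le_of_lt hij i.isLt)) ∘ₗ b i.succ) :
    (∑ i : Fin (n + 1), (-1 : ℤ) ^ (i + 1 : ℕ) • a i) ∘ₗ
      (∑ j : Fin (n + 2), (-1 : ℤ) ^ (j + 1 : ℕ) • b j) = 0 := by
  ext x
  simp only [LinearMap.comp_apply, LinearMap.sum_apply, LinearMap.smul_apply, map_sum, map_smul,
    LinearMap.zero_apply, Finset.smul_sum, smul_smul]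
  rw [← Finset.sum_comm]
  simp only [← Finset.sum_product']
  let P := Fin (n + 1) × Fin (n + 2)
  let S : Finset P := {ij : P | (ij.2 : ℕ) ≤ (ij.1 : ℕ)}
  rw [Finset.univ_product_univ, ← Finset.sum_add_sum_compl S, ← eq_neg_iff_add_eq_zero,
    ← Finset.sum_neg_distrib]
  let φ : ∀ ij : P, ij ∈ S → P := fun ij hij =>
    (Fin.castLT ij.2 (lt_of_le_of_lt (Finset.mem_filter.mp hij).right (Fin.is_lt ij.1)), ij.1.succ)
  apply Finset.sum_bij φ
  · intro ij hij
    simp_rw [S, φ, Finset.compl_filter, Finset.mem_filter_univ, Fin.val_succ,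
      Fin.val_castLT] at hij ⊢
    lia
  · rintro ⟨i, j⟩ hij ⟨i', j'⟩ hij' h
    rw [Prod.mk_inj]
    exact ⟨by simpa [φ] using! congr_arg Prod.snd h,
      by simpa [φ, Fin.castSucc_castLT] using! congr_arg Fin.castSucc (congr_arg Prod.fst h)⟩
  · rintro ⟨i', j'⟩ hij'
    simp_rw [S, Finset.compl_filter, Finset.mem_filter_univ, not_le] at hij'
    refine ⟨(j'.pred <| ?_, Fin.castSucc i'), ?_, ?_⟩
    · rintro rfl
      simp only [Fin.val_zero, not_lt_zero] at hij'
    · simpa [S] using! Nat.le_sub_one_of_lt hij'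
    · simp only [φ, Fin.castLT_castSucc, Fin.succ_pred]
  · rintro ⟨i, j⟩ hij
    have hij' : (j : ℕ) ≤ i := by simpa [S] using hij
    have hx := LinearMap.congr_fun (h i j hij') x
    simp only [LinearMap.comp_apply] at hx
    simp only [φ, hx, ← neg_smul]
    congr 1
    simp only [Fin.val_succ, Fin.val_castLT, pow_add, pow_one]
    ring

lemma insertNth_insertNth {T : Type u} {n : ℕ} (i : Fin (n + 1)) (j : Fin (n + 2))
    (hij : (j : ℕ) ≤ i) (e d : T) (x : Fin n → T) :
    (j.insertNth (α := fun _ => T) d (i.insertNth (α := fun _ => T) e x) : Fin (n + 2) → T) =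
      i.succ.insertNth (α := fun _ => T) e
        (Fin.insertNth (α := fun _ => T) (Fin.castLT j (lt_of_le_of_lt hij i.isLt)) d x) := by
  generalize hj : Fin.castLT j (lt_of_le_of_lt hij i.isLt) = j'
  obtain rfl : j = j'.castSucc := by simp [← hj]
  have hij : (j' : ℕ) ≤ i := hij
  have h1 : j'.castSucc = i.succ.succAbove j' := by
    rw [Fin.succAbove_of_castSucc_lt]
    rw [Fin.lt_def]
    simp only [Fin.val_castSucc, Fin.val_succ]
    omega
  have h2 : j'.castSucc.succAbove i = i.succ := by
    rw [Fin.succAbove_of_le_castSucc]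
    rw [Fin.le_def]
    simpa using hij
  have h3 : ∀ m : Fin n,
      j'.castSucc.succAbove (i.succAbove m) = i.succ.succAbove (j'.succAbove m) := by
    clear h1 h2
    intro m
    ext
    simp only [Fin.succAbove, Fin.lt_def]
    split_ifs <;> simp_all <;> omega
  funext k
  induction k using Fin.succAboveCases j'.castSucc with
  | x =>
    rw [Fin.insertNth_apply_same, h1, Fin.insertNth_apply_succAbove, Fin.insertNth_apply_same]
  | p l =>
    rw [Fin.insertNth_apply_succAbove]
    induction l using Fin.succAboveCases i with
    | x => rw [Fin.insertNth_apply_same, h2, Fin.insertNth_apply_same]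
    | p m =>
      rw [Fin.insertNth_apply_succAbove, h3, Fin.insertNth_apply_succAbove,
        Fin.insertNth_apply_succAbove]

namespace Cube

variable (J : Intv)

/-- The free abelian group on the singular `n`-cubes of `X`. -/
abbrev Q (n : ℕ) (X : Cl.{u}) : Type u := Cl.Hom (J.cube n) X →₀ ℤ

/-- The face of a singular cube on which the `i`-th coordinate equals `e`. -/
noncomputable def face {n : ℕ} {X : Cl.{u}} (i : Fin (n + 1)) (e : J.space)
    (σ : Cl.Hom (J.cube (n + 1)) X) : Cl.Hom (J.cube n) X := (J.cubeInsert i e).comp σ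

lemma face_face {n : ℕ} {X : Cl.{u}} (i : Fin (n + 1)) (j : Fin (n + 2)) (hij : (j : ℕ) ≤ i)
    (e d : J.space) (σ : Cl.Hom (J.cube (n + 2)) X) :
    face J i e (face J j d σ) =
      face J (Fin.castLT j (lt_of_le_of_lt hij i.isLt)) d (face J i.succ e σ) := by
  ext x
  exact congrArg σ.toFun (insertNth_insertNth i j hij e d x)

/-- The difference of the two opposite faces in the direction `i`. -/
noncomputable def faceDiff (n : ℕ) (X : Cl.{u}) (i : Fin (n + 1)) : Q J (n + 1) X →ₗ[ℤ] Q J n X :=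
  Finsupp.lmapDomain ℤ ℤ (face J i J.zeroPt) - Finsupp.lmapDomain ℤ ℤ (face J i J.onePt)

/-- The boundary `∑ (-1)ⁱ (Aᵢ σ - Bᵢ σ)`, where the directions are numbered from `1`. -/
noncomputable def bd (n : ℕ) (X : Cl.{u}) : Q J (n + 1) X →ₗ[ℤ] Q J n X :=
  ∑ i : Fin (n + 1), (-1 : ℤ) ^ (i + 1 : ℕ) • faceDiff J n X i

lemma bd_bd (n : ℕ) (X : Cl.{u}) : bd J n X ∘ₗ bd J (n + 1) X = 0 := by
  refine alternating_sum_comp_eq_zero _ _ fun i j hij => ?_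
  refine Finsupp.lhom_ext fun σ k => ?_
  simp only [faceDiff, LinearMap.comp_apply, LinearMap.sub_apply, map_sub,
    Finsupp.lmapDomain_apply, Finsupp.mapDomain_single, face_face J i j hij]
  abel

/-- A singular cube is degenerate if it does not depend on some coordinate, that is, if it lies in
the image of some degeneracy. -/
def IsDegenerate {n : ℕ} {X : Cl.{u}} (σ : Cl.Hom (J.cube n) X) : Prop :=
  ∃ i : Fin n, ∀ (x : J.cube n) (t : J.space),
    σ (Function.update (β := fun _ => J.space) x i t : Fin n → J.space) = σ x

/-- The subgroup generated by the degenerate cubes. -/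
noncomputable def D (n : ℕ) (X : Cl.{u}) : Submodule ℤ (Q J n X) :=
  Submodule.span ℤ {c | ∃ σ, IsDegenerate J σ ∧ c = Finsupp.single σ 1}

lemma mem_D_iff {n : ℕ} {X : Cl.{u}} (c : Q J n X) :
    c ∈ D J n X ↔ ∀ σ, c σ ≠ 0 → IsDegenerate J σ := by
  have h : D J n X = Finsupp.supported ℤ ℤ {σ | IsDegenerate J σ} := by
    rw [Finsupp.supported_eq_span_single, D]
    congr 1
    ext c
    exact ⟨fun ⟨σ, h, e⟩ => ⟨σ, h, e.symm⟩, fun ⟨σ, h, e⟩ => ⟨σ, h, e.symm⟩⟩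
  rw [h, Finsupp.mem_supported]
  exact ⟨fun h σ hσ => h (Finsupp.mem_support_iff.mpr hσ),
    fun h σ hσ => h σ (Finsupp.mem_support_iff.mp hσ)⟩

lemma bd_D (n : ℕ) (X : Cl.{u}) : D J (n + 1) X ≤ (D J n X).comap (bd J n X) := by
  refine Submodule.span_le.mpr ?_
  rintro _ ⟨σ, ⟨i, hi⟩, rfl⟩
  change bd J n X (Finsupp.single σ 1) ∈ D J n X
  rw [bd, LinearMap.sum_apply]
  refine Submodule.sum_mem _ fun j _ => Submodule.smul_mem _ _ ?_
  simp only [faceDiff, LinearMap.sub_apply, Finsupp.lmapDomain_apply, Finsupp.mapDomain_single]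
  by_cases hij : i = j
  · subst hij
    have : face J i J.zeroPt σ = face J i J.onePt σ := by
      ext x
      exact (hi _ J.onePt).symm.trans (congrArg σ.toFun
        (Fin.update_insertNth (α := fun _ => J.space) i J.zeroPt J.onePt x))
    rw [this, sub_self]
    exact Submodule.zero_mem _
  · obtain ⟨k, rfl⟩ := Fin.exists_succAbove_eq hij
    have h : ∀ e, IsDegenerate J (face J j e σ) := fun e => ⟨k, fun x t =>
      (congrArg σ.toFun (Fin.insertNth_update (α := fun _ => J.space) j e k t x)).trans (hi _ t)⟩
    exact Submodule.sub_mem _ (Submodule.subset_span ⟨_, h _, rfl⟩)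
      (Submodule.subset_span ⟨_, h _, rfl⟩)

/-- The map of cubes induced by a continuous map. -/
noncomputable def push (n : ℕ) {X Y : Cl.{u}} (f : X ⟶ Y) : Q J n X →ₗ[ℤ] Q J n Y :=
  Finsupp.lmapDomain ℤ ℤ fun σ => σ.comp f

lemma push_D (n : ℕ) {X Y : Cl.{u}} (f : X ⟶ Y) : D J n X ≤ (D J n Y).comap (push J n f) := by
  refine Submodule.span_le.mpr ?_
  rintro _ ⟨σ, ⟨i, hi⟩, rfl⟩
  change push J n f (Finsupp.single σ 1) ∈ D J n Y
  rw [push, Finsupp.lmapDomain_apply, Finsupp.mapDomain_single]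
  exact Submodule.subset_span ⟨_, ⟨i, fun x t => congrArg (Cl.Hom.toFun f) (hi x t)⟩, rfl⟩

lemma bd_push (n : ℕ) {X Y : Cl.{u}} (f : X ⟶ Y) :
    bd J n Y ∘ₗ push J (n + 1) f = push J n f ∘ₗ bd J n X := by
  refine Finsupp.lhom_ext fun σ k => ?_
  simp only [bd, push, LinearMap.comp_apply, LinearMap.sum_apply, map_sum, LinearMap.smul_apply,
    map_smul, faceDiff, LinearMap.sub_apply, map_sub, Finsupp.lmapDomain_apply,
    Finsupp.mapDomain_single]
  rfl

/-- The group of singular cubical chains: cubes modulo degenerate cubes. -/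
noncomputable def C (n : ℕ) (X : Cl.{u}) : ModuleCat.{u} ℤ :=
  ModuleCat.of ℤ (Q J n X ⧸ D J n X)

/-- The boundary of singular cubical chains. -/
noncomputable def dC (n : ℕ) (X : Cl.{u}) : C J (n + 1) X ⟶ C J n X :=
  ModuleCat.ofHom (Submodule.mapQ _ _ (bd J n X) (bd_D J n X))

/-- The map of singular cubical chains induced by a continuous map. -/
noncomputable def mapC (n : ℕ) {X Y : Cl.{u}} (f : X ⟶ Y) : C J n X ⟶ C J n Y :=
  ModuleCat.ofHom (Submodule.mapQ _ _ (push J n f) (push_D J n f))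

end Cube

/-- The complex of singular cubical chains: free abelian groups on the singular cubes modulo the
degenerate cubes. -/
noncomputable def cubeChains (J : Intv) : Cl.{u} ⥤ ChainComplex (ModuleCat.{u} ℤ) ℕ where
  obj X := ChainComplex.of (fun n => Cube.C J n X) (fun n => Cube.dC J n X) (fun n => by
    ext : 1
    refine Submodule.linearMap_qext _ (LinearMap.ext fun c => ?_)
    exact congrArg (Submodule.mkQ _) (LinearMap.congr_fun (Cube.bd_bd J n X) c))
  map {X Y} f :=
    { f n := Cube.mapC J n f
      comm' := by
        rintro _ n rfl
        dsimp only
        rw [ChainComplex.of_d, ChainComplex.of_d]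
        ext : 1
        refine Submodule.linearMap_qext _ (LinearMap.ext fun c => ?_)
        exact congrArg (Submodule.mkQ _) (LinearMap.congr_fun (Cube.bd_push J n f) c) }
  map_id X := by
    ext n : 2
    refine Submodule.linearMap_qext _ (Finsupp.lhom_ext fun σ k => ?_)
    exact congrArg (Submodule.mkQ _) Finsupp.mapDomain_single
  map_comp f g := by
    ext n : 2
    refine Submodule.linearMap_qext _ (Finsupp.lhom_ext fun σ k => ?_)
    refine congrArg (Submodule.mkQ _) ?_
    simp only [Cube.push, Finsupp.lmapDomain_apply, Finsupp.mapDomain_single]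
    rfl

lemma cubeChains_d (J : Intv) (X : Cl.{u}) (n : ℕ) :
    ((cubeChains J).obj X).d (n + 1) n = Cube.dC J n X :=
  ChainComplex.of_d (fun n => Cube.C J n X) (fun n => Cube.dC J n X) n

/-! ## Augmentations -/

/-- The homomorphism `∑ nᵢ σᵢ ↦ ∑ nᵢ`. -/
noncomputable def augZ (S : Type u) : (S →₀ ℤ) →ₗ[ℤ] ULift.{u} ℤ :=
  Finsupp.linearCombination ℤ fun _ => ULift.up 1

lemma augZ_lmapDomain {S T : Type u} (f : S → T) (c : S →₀ ℤ) :
    augZ T (Finsupp.lmapDomain ℤ ℤ f c) = augZ S c := by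
  rw [augZ, Finsupp.lmapDomain_apply, Finsupp.linearCombination_mapDomain]
  rfl

lemma simpAug_aux (J : Intv) (X : Cl.{u}) :
    ((simpChains J).obj X).d 1 0 ≫ ModuleCat.ofHom (augZ (Cl.Hom (J.simplex 0) X)) = 0 := by
  ext : 1
  refine LinearMap.ext fun c => ?_
  have hd : ((simpChains J).obj X).d 1 0 =
      freeZ.map (((clNerve J).obj X).δ (n := 0) 0) -
        freeZ.map (((clNerve J).obj X).δ (n := 0) 1) := by
    refine (AlgebraicTopology.AlternatingFaceMapComplex.obj_d_eq _ 0).trans ?_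
    rw [Fin.sum_univ_two, sub_eq_add_neg]
    exact congrArg₂ (· + ·) (one_smul ℤ _) (neg_one_smul ℤ _)
  have h : (freeZ.map (((clNerve J).obj X).δ (n := 0) 0) -
      freeZ.map (((clNerve J).obj X).δ (n := 0) 1)).hom c =
      (freeZ.map (((clNerve J).obj X).δ (n := 0) 0)).hom c -
      (freeZ.map (((clNerve J).obj X).δ (n := 0) 1)).hom c := rfl
  rw [hd]
  refine (congrArg (augZ _) h).trans ((map_sub _ _ _).trans ?_)
  exact sub_eq_zero.mpr ((augZ_lmapDomain _ _).trans (augZ_lmapDomain _ _).symm)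

/-- The augmentation of the simplicial chains, as a map to `ℤ` placed in degree `0`. -/
noncomputable def simpAug (J : Intv) (X : Cl.{u}) :
    (simpChains J).obj X ⟶ (ChainComplex.single₀ (ModuleCat.{u} ℤ)).obj (.of ℤ (ULift.{u} ℤ)) :=
  (ChainComplex.toSingle₀Equiv _ _).symm ⟨ModuleCat.ofHom (augZ _), simpAug_aux J X⟩

/-- The augmentation of the cubical chains of degree `0`. -/
noncomputable def Cube.aug (J : Intv) (X : Cl.{u}) : Cube.C J 0 X ⟶ .of ℤ (ULift.{u} ℤ) :=
  ModuleCat.ofHom (Submodule.liftQ (Cube.D J 0 X) (augZ _) (Submodule.span_le.mpr (by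
    rintro _ ⟨_, ⟨i, _⟩, _⟩
    exact i.elim0)))

lemma cubeAug_aux (J : Intv) (X : Cl.{u}) :
    ((cubeChains J).obj X).d 1 0 ≫ Cube.aug J X = 0 := by
  ext : 1
  refine Submodule.linearMap_qext _ (LinearMap.ext fun c => ?_)
  rw [cubeChains_d]
  change augZ _ (Cube.bd J 0 X c) = 0
  simp [Cube.bd, Cube.faceDiff, augZ_lmapDomain, -Finsupp.lmapDomain_apply]

/-- The augmentation of the cubical chains, as a map to `ℤ` placed in degree `0`. -/
noncomputable def cubeAug (J : Intv) (X : Cl.{u}) :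
    (cubeChains J).obj X ⟶ (ChainComplex.single₀ (ModuleCat.{u} ℤ)).obj (.of ℤ (ULift.{u} ℤ)) :=
  (ChainComplex.toSingle₀Equiv _ _).symm ⟨Cube.aug J X, cubeAug_aux J X⟩

/-! ## Homology of pairs and reduced homology -/

/-- The two singular theories. -/
inductive Theory
  | simplicial
  | cubical

namespace Theory

variable (T : Theory) (J : Intv)

/-- The complex of singular chains. -/
noncomputable def chains : Theory → Intv → Cl.{u} ⥤ ChainComplex (ModuleCat.{u} ℤ) ℕ
  | simplicial, J => simpChains J
  | cubical, J => cubeChains J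

/-- The augmentation, as a map to the complex with `ℤ` in degree `0`. -/
noncomputable def aug : ∀ (T : Theory) (J : Intv) (X : Cl.{u}), (T.chains J).obj X ⟶
    (ChainComplex.single₀ (ModuleCat.{u} ℤ)).obj (.of ℤ (ULift.{u} ℤ))
  | simplicial, J, X => simpAug J X
  | cubical, J, X => cubeAug J X

lemma map_aug {X Y : Cl.{u}} (f : X ⟶ Y) : (T.chains J).map f ≫ T.aug J Y = T.aug J X := by
  cases T
  · refine (ChainComplex.toSingle₀Equiv _ _).injective (Subtype.ext ?_)
    ext : 1
    refine LinearMap.ext fun c => ?_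
    have h := fun X => ChainComplex.toSingle₀Equiv_symm_apply_f_zero (C := (simpChains J).obj X)
      (ModuleCat.ofHom (augZ _)) (simpAug_aux J X)
    change (((simpChains J).map f).f 0 ≫ (simpAug J Y).f 0) c = (simpAug J X).f 0 c
    rw [simpAug, simpAug, h, h]
    exact augZ_lmapDomain _ _
  · refine (ChainComplex.toSingle₀Equiv _ _).injective (Subtype.ext ?_)
    ext : 1
    refine Submodule.linearMap_qext _ (LinearMap.ext fun c => ?_)
    have h := fun X => ChainComplex.toSingle₀Equiv_symm_apply_f_zero (C := (cubeChains J).obj X)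
      _ (cubeAug_aux J X)
    change (((cubeChains J).map f).f 0 ≫ (cubeAug J Y).f 0) (Submodule.mkQ _ c) =
      (cubeAug J X).f 0 (Submodule.mkQ _ c)
    rw [cubeAug, cubeAug, h, h]
    exact augZ_lmapDomain _ _

/-- The reduced chain complex: the chains with the degree `0` part replaced by the kernel of the
augmentation `∑ nᵢ σᵢ ↦ ∑ nᵢ`. In degrees `n ≥ 0` its homology is the homology of the augmented
complex `⋯ → C₁ → C₀ → ℤ`. -/
noncomputable def redChains (X : Cl.{u}) : ChainComplex (ModuleCat.{u} ℤ) ℕ :=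
  kernel (T.aug J X)

/-- The inclusion of the reduced chains into the chains. -/
noncomputable def redIncl (X : Cl.{u}) : T.redChains J X ⟶ (T.chains J).obj X :=
  kernel.ι (T.aug J X)

/-- The map of reduced chains induced by a continuous map. -/
noncomputable def redMap {X Y : Cl.{u}} (f : X ⟶ Y) : T.redChains J X ⟶ T.redChains J Y :=
  kernel.lift _ (T.redIncl J X ≫ (T.chains J).map f) (by
    rw [Category.assoc, map_aug]
    exact kernel.condition _)

/-- The relative chain complex `C(X) / C(A)`. -/
noncomputable def relChains (X : Cl.{u}) (A : Set X) : ChainComplex (ModuleCat.{u} ℤ) ℕ :=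
  cokernel ((T.chains J).map (X.incl A))

/-- The projection `C(X) → C(X) / C(A)`. -/
noncomputable def relProj (X : Cl.{u}) (A : Set X) : (T.chains J).obj X ⟶ T.relChains J X A :=
  cokernel.π ((T.chains J).map (X.incl A))

/-- The map of relative chains induced by a map of pairs. -/
noncomputable def relMap {X Y : Cl.{u}} (f : X ⟶ Y) {A : Set X} {B : Set Y}
    (h : Set.MapsTo (Cl.Hom.toFun f) A B) : T.relChains J X A ⟶ T.relChains J Y B :=
  cokernel.map _ _ ((T.chains J).map (Cl.restr f h)) ((T.chains J).map f) (by
    rw [← Functor.map_comp, ← Functor.map_comp]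
    rfl)

/-- The composite of the inclusion of the reduced chains and the projection to the relative
chains. -/
noncomputable def redToRel (X : Cl.{u}) (A : Set X) : T.redChains J X ⟶ T.relChains J X A :=
  T.redIncl J X ≫ T.relProj J X A

lemma mono_map_incl (X : Cl.{u}) (A : Set X) : Mono ((T.chains J).map (X.incl A)) := by
  refine HomologicalComplex.mono_of_mono_f _ fun n => (ModuleCat.mono_iff_injective _).mpr ?_
  cases T
  · exact Finsupp.mapDomain_injective (Cl.Hom.comp_incl_injective _)
  · refine (injective_iff_map_eq_zero _).mpr fun c hc => ?_
    obtain ⟨c, rfl⟩ := Submodule.mkQ_surjective _ c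
    have hc' : Cube.push J n (X.incl A) c ∈ Cube.D J n X := (Submodule.Quotient.mk_eq_zero _).mp hc
    refine (Submodule.Quotient.mk_eq_zero _).mpr ?_
    rw [Cube.mem_D_iff] at hc' ⊢
    intro σ hσ
    obtain ⟨i, hi⟩ := hc' (σ.comp (X.incl A)) (by
      rw [Cube.push, Finsupp.lmapDomain_apply,
        Finsupp.mapDomain_apply (Cl.Hom.comp_incl_injective A)]
      exact hσ)
    exact ⟨i, fun x t => Subtype.ext (hi x t)⟩

/-- The short exact sequence `C(A) → C(X) → C(X, A)`. -/
noncomputable def pairSeq (X : Cl.{u}) (A : Set X) :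
    ShortComplex (ChainComplex (ModuleCat.{u} ℤ) ℕ) :=
  ShortComplex.mk ((T.chains J).map (X.incl A)) (T.relProj J X A) (cokernel.condition _)

lemma pairSeq_shortExact (X : Cl.{u}) (A : Set X) : (T.pairSeq J X A).ShortExact where
  exact := ShortComplex.exact_cokernel _
  mono_f := T.mono_map_incl J X A
  epi_g := coequalizer.π_epi

/-- The connecting homomorphism `H_{n+1}(X, A) → H_n(A)` of a pair. -/
noncomputable def connecting (X : Cl.{u}) (A : Set X) (n : ℕ) :
    (T.relChains J X A).homology (n + 1) ⟶ ((T.chains J).obj (X.sub A)).homology n :=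
  (T.pairSeq_shortExact J X A).δ (n + 1) n rfl

end Theory

/-! ## Deformation retractions and good pairs -/

/-- One-step `(J, ×)`-homotopies relative to `A`. -/
def OneStepHomotopicRel (J : Intv) {X Y : Cl.{u}} (A : Set X) (f g : X ⟶ Y) : Prop :=
  ∃ H : Cl.Hom (X.prod J.space) Y,
    (∀ x : X, H (x, J.zeroPt) = Cl.Hom.toFun f x) ∧ (∀ x : X, H (x, J.onePt) = Cl.Hom.toFun g x) ∧
    ∀ a ∈ A, ∀ t : J.space, H (a, t) = Cl.Hom.toFun f a

/-- `(J, ×)`-homotopy relative to `A`: the equivalence relation generated by one-step homotopies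
relative to `A`. -/
def HomotopicRel (J : Intv) {X Y : Cl.{u}} (A : Set X) (f g : X ⟶ Y) : Prop :=
  Relation.EqvGen (OneStepHomotopicRel J A) f g

/-- `Y` deformation retracts onto its subset `A`: the identity is homotopic, relative to `A`, to a
retraction of `Y` onto `A`. -/
def DeformationRetracts (J : Intv) (Y : Cl.{u}) (A : Set Y) : Prop :=
  ∃ r : Y ⟶ Y, (∀ y, Cl.Hom.toFun r y ∈ A) ∧ (∀ a ∈ A, Cl.Hom.toFun r a = a) ∧
    HomotopicRel J A (𝟙 Y) r

/-- `(X, A)` is a `(J, ×)`-good pair: some neighborhood `B` of `A` deformation retracts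
onto `A`. -/
def IsGoodPair (J : Intv) (X : Cl.{u}) (A : Set X) : Prop :=
  ∃ B : Set X, X.IsNhd B A ∧ DeformationRetracts J (X.sub B) (Subtype.val ⁻¹' A)

/-! ## Homological algebra -/

/-! Collapsing `A` changes nothing away from `A`, and relative homology can be moved away from `A`.
Let `B` be a neighborhood that deformation retracts onto `A`, and let `q` be the quotient map. Since
`A → B` is a quasi-isomorphism, `(X, A)` may be replaced by `(X, B)`. The retraction descends to `B
/ A`, which is the subspace `q(B)` of `X / A`, so `(X/A, A/A)` may be replaced by `(X/A, q(B))`.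
Excising `A` on one side and the collapsed point on the other leaves `(X ∖ A, B ∖ A)` and its image,
and between these `q` is an isomorphism of pairs of closure spaces. Two commuting squares in
`quasiIso_relMap_quotMap` combine these facts.

Excision (`isExcisive_of_isNhd`) has a different reason for each interval. For `[0,1]`, closedness
of `A` makes the interiors of `B` and `Aᶜ` cover `X`; a Lebesgue number and iterated subdivision
then make chains small. The subdivision is barycentric for simplices, and for cubes it is bisection
of every coordinate. For `J₊` the models have a point in the closure of every other point, and for
`J₁` all points are in each other's closure; every generator then already lies in `B` or in `Aᶜ`,
without subdivision.

Descent of the retraction (`OneStepHomotopicRel.quot`) is not formal, because a product with `J` has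
to be compared with a quotient closure. At the collapsed point the homotopy is constant in time, and
compactness of `J` supplies a tube lemma. Elsewhere the fibre of `q` is a single point.

For nonempty `A`, the reduced chains of `A` and of `X` and the relative chains form a short exact
sequence (`redSeq_shortExact`). Applied to `(X/A, A/A)`, whose subspace is a point, it identifies
reduced homology of `X / A` with relative homology. Applied to `(X, A)`, it gives a long exact
sequence whose third term is replaced by the reduced homology of `X / A`. Both theories are treated
together as free groups on maps from a model, modulo degenerate generators. -/

lemma ChainComplex.exactAt_iff_elements (K : ChainComplex (ModuleCat.{u} ℤ) ℕ) (n : ℕ) :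
    K.ExactAt n ↔ ∀ x : K.X n, (∀ m, K.d n m x = 0) → ∃ y : K.X (n + 1), K.d (n + 1) n y = x := by
  rw [K.exactAt_iff' (n + 1) n ((ComplexShape.down ℕ).next n) (ChainComplex.prev ℕ n) rfl,
    ShortComplex.moduleCat_exact_iff]
  refine ⟨fun h x hx => h x (hx _), fun h x hx => h x fun m => ?_⟩
  -- Differentials to any other degree vanish. Asking for all `m` thus covers degree `0`, where
  -- nothing follows, without a case distinction.
  by_cases hm : (ComplexShape.down ℕ).Rel n m
  · rw [← (ComplexShape.down ℕ).next_eq' hm]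
    exact hx
  · rw [K.shape _ _ hm]
    rfl

/-- In the long exact sequence both neighbours of the map induced by `S.f` are homology groups of
the acyclic third term. -/
lemma CategoryTheory.ShortComplex.ShortExact.quasiIso_f
    {S : ShortComplex (ChainComplex (ModuleCat.{u} ℤ) ℕ)} (hS : S.ShortExact)
    (h : S.X₃.Acyclic) : _root_.QuasiIso S.f := by
  rw [_root_.quasiIso_iff]
  intro n
  rw [_root_.quasiIsoAt_iff_isIso_homologyMap]
  have hz := fun i => (S.X₃.exactAt_iff_isZero_homology i).mp (h i)
  have h1 : Mono (HomologicalComplex.homologyMap S.f n) :=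
    (hS.homology_exact₁ (n + 1) n rfl).mono_g ((hz (n + 1)).eq_of_src _ _)
  have h2 : Epi (HomologicalComplex.homologyMap S.f n) :=
    (hS.homology_exact₂ n).epi_f ((hz n).eq_of_tgt _ _)
  exact isIso_of_mono_of_epi _

section

variable {S : ShortComplex (ChainComplex (ModuleCat.{u} ℤ) ℕ)}

lemma CategoryTheory.ShortComplex.Exact.degreewise (hS : S.Exact) {n : ℕ}
    {x : S.X₂.X n} (hx : S.g.f n x = 0) : ∃ y, S.f.f n y = x :=
  (ShortComplex.moduleCat_exact_iff _).mp
    ((HomologicalComplex.exact_iff_degreewise_exact S).mp hS n) x hx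

end

lemma ChainComplex.surjective_of_epi {K L : ChainComplex (ModuleCat.{u} ℤ) ℕ} (φ : K ⟶ L)
    [Epi φ] (n : ℕ) : Function.Surjective (φ.f n) :=
  (ModuleCat.epi_iff_surjective _).mp inferInstance

lemma ChainComplex.injective_of_mono {K L : ChainComplex (ModuleCat.{u} ℤ) ℕ} (φ : K ⟶ L)
    [Mono φ] (n : ℕ) : Function.Injective (φ.f n) :=
  (ModuleCat.mono_iff_injective _).mp inferInstance

lemma ChainComplex.map_d {K L : ChainComplex (ModuleCat.{u} ℤ) ℕ} (φ : K ⟶ L) (m n : ℕ)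
    (x : K.X m) : φ.f n (K.d m n x) = L.d m n (φ.f m x) :=
  (ConcreteCategory.congr_hom (φ.comm m n) x).symm

/-- An injective chain map is a quasi-isomorphism if every chain with boundary in the image can be
moved into the image by adding a boundary. -/
lemma ChainComplex.quasiIso_of_injective {K L : ChainComplex (ModuleCat.{u} ℤ) ℕ} (φ : K ⟶ L)
    (hinj : ∀ n, Function.Injective (φ.f n))
    (h : ∀ (n : ℕ) (x : L.X n), (∀ m, ∃ k, φ.f m k = L.d n m x) →
      ∃ (y : L.X (n + 1)) (k : K.X n), φ.f n k + L.d (n + 1) n y = x) : QuasiIso φ := by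
  have : Mono φ := HomologicalComplex.mono_of_mono_f _ fun n =>
    (ModuleCat.mono_iff_injective _).mpr (hinj n)
  have hS : (ShortComplex.mk φ (cokernel.π φ) (cokernel.condition φ)).ShortExact :=
    { exact := ShortComplex.exact_cokernel _ }
  -- The hypothesis `h` is acyclicity of the cokernel, written in terms of representatives.
  refine hS.quasiIso_f fun n => ?_
  rw [ChainComplex.exactAt_iff_elements]
  intro x hx
  obtain ⟨x, rfl⟩ := ChainComplex.surjective_of_epi (cokernel.π φ) n x
  obtain ⟨y, k, rfl⟩ := h n x fun m => hS.exact.degreewise (by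
    refine (ChainComplex.map_d _ _ _ _).trans (hx m))
  refine ⟨(cokernel.π φ).f _ y, ?_⟩
  rw [map_add, ← ChainComplex.map_d]
  refine (zero_add _).symm.trans (congrArg (· + _) ?_)
  exact (ConcreteCategory.congr_hom
    (HomologicalComplex.congr_hom (cokernel.condition φ) n) k).symm

namespace Theory

variable (T : Theory) (J : Intv)

/-! ### Maps of pairs -/

/-- The map of short exact sequences of pairs induced by a map of pairs. -/
noncomputable def pairSeqMap {X Y : Cl.{u}} (f : X ⟶ Y) {A : Set X} {B : Set Y}
    (h : Set.MapsTo (Cl.Hom.toFun f) A B) : T.pairSeq J X A ⟶ T.pairSeq J Y B where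
  τ₁ := (T.chains J).map (Cl.restr f h)
  τ₂ := (T.chains J).map f
  τ₃ := T.relMap J f h
  comm₁₂ := by
    refine ((T.chains J).map_comp _ _).symm.trans (Eq.trans ?_ ((T.chains J).map_comp _ _))
    rfl
  comm₂₃ := (cokernel.π_desc _ _ _).symm

lemma relProj_relMap {X Y : Cl.{u}} (f : X ⟶ Y) {A : Set X} {B : Set Y}
    (h : Set.MapsTo (Cl.Hom.toFun f) A B) :
    T.relProj J X A ≫ T.relMap J f h = (T.chains J).map f ≫ T.relProj J Y B :=
  cokernel.π_desc _ _ _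

instance (X : Cl.{u}) (A : Set X) : Epi (T.relProj J X A) :=
  inferInstanceAs (Epi (cokernel.π _))

/-- Five lemma for the long exact sequences of the two pairs. -/
lemma quasiIso_relMap {X Y : Cl.{u}} (f : X ⟶ Y) {A : Set X} {B : Set Y}
    (h : Set.MapsTo (Cl.Hom.toFun f) A B) (h₁ : QuasiIso ((T.chains J).map (Cl.restr f h)))
    (h₂ : QuasiIso ((T.chains J).map f)) : QuasiIso (T.relMap J f h) :=
  HomologicalComplex.HomologySequence.quasiIso_τ₃ (T.pairSeqMap J f h)
    (T.pairSeq_shortExact J X A) (T.pairSeq_shortExact J Y B) h₁ h₂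

/-- The condition on the composite is a separate argument so that two factorizations of the same
map, equal by definition, can be compared. -/
lemma relMap_comp {X Y Z : Cl.{u}} (f : X ⟶ Y) (g : Y ⟶ Z) {A : Set X} {B : Set Y} {C : Set Z}
    (hf : Set.MapsTo (Cl.Hom.toFun f) A B) (hg : Set.MapsTo (Cl.Hom.toFun g) B C)
    (hfg : Set.MapsTo (Cl.Hom.toFun (f ≫ g)) A C) :
    T.relMap J f hf ≫ T.relMap J g hg = T.relMap J (f ≫ g) hfg := by
  rw [← cancel_epi (T.relProj J X A), ← Category.assoc, relProj_relMap, Category.assoc,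
    relProj_relMap, relProj_relMap, Functor.map_comp, Category.assoc]

/-! ### Reduced chains -/

instance (X : Cl.{u}) : Mono (T.redIncl J X) := inferInstanceAs (Mono (kernel.ι _))

lemma redMap_redIncl {X Y : Cl.{u}} (f : X ⟶ Y) :
    T.redMap J f ≫ T.redIncl J Y = T.redIncl J X ≫ (T.chains J).map f :=
  kernel.lift_ι _ _ _

lemma exists_redIncl_eq (X : Cl.{u}) {n : ℕ} (c : ((T.chains J).obj X).X n)
    (hc : (T.aug J X).f n c = 0) : ∃ a, (T.redIncl J X).f n a = c :=
  (ShortComplex.exact_kernel (T.aug J X)).degreewise hc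

lemma aug_redIncl (X : Cl.{u}) {n : ℕ} (a : (T.redChains J X).X n) :
    (T.aug J X).f n ((T.redIncl J X).f n a) = 0 :=
  ConcreteCategory.congr_hom (HomologicalComplex.congr_hom (kernel.condition (T.aug J X)) n) a

lemma relProj_eq_zero (X : Cl.{u}) (A : Set X) {n : ℕ} (c : ((T.chains J).obj X).X n) :
    (T.relProj J X A).f n c = 0 ↔ ∃ a, ((T.chains J).map (X.incl A)).f n a = c := by
  refine ⟨fun h => (T.pairSeq_shortExact J X A).exact.degreewise h, ?_⟩
  rintro ⟨a, rfl⟩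
  exact ConcreteCategory.congr_hom (HomologicalComplex.congr_hom (T.pairSeq J X A).zero n) a

lemma augZ_single {S : Type u} (s : S) (m : ULift.{u} ℤ) :
    augZ S (Finsupp.single s m.down) = m :=
  (Finsupp.linearCombination_single ℤ _ _).trans (ULift.ext _ _ (mul_one _))

/-- The augmentation of a nonempty space is surjective in each degree. -/
lemma surjective_aug (X : Cl.{u}) (x : X) (n : ℕ) : Function.Surjective ((T.aug J X).f n) := by
  cases n with
  | zero =>
    intro z
    cases T
    · refine ⟨Finsupp.single (Cl.Hom.const _ x) (ULift.down (α := ℤ) z), ?_⟩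
      change (simpAug J X).f 0 _ = z
      rw [simpAug, ChainComplex.toSingle₀Equiv_symm_apply_f_zero (C := (simpChains J).obj X)
        (ModuleCat.ofHom (augZ _)) (simpAug_aux J X)]
      exact augZ_single _ z
    · refine ⟨Submodule.mkQ _ (Finsupp.single (Cl.Hom.const _ x) (ULift.down (α := ℤ) z)), ?_⟩
      change (cubeAug J X).f 0 _ = z
      rw [cubeAug, ChainComplex.toSingle₀Equiv_symm_apply_f_zero (C := (cubeChains J).obj X)
        _ (cubeAug_aux J X)]
      exact augZ_single _ z
  -- The target complex is concentrated in degree `0`.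
  | succ n =>
    intro z
    refine ⟨0, ?_⟩
    have := ModuleCat.subsingleton_of_isZero
      (HomologicalComplex.isZero_single_obj_X (ComplexShape.down ℕ) 0
        (ModuleCat.of ℤ (ULift.{u} ℤ)) (n + 1) (by simp))
    exact @Subsingleton.elim _ this _ _

/-- The sequence of reduced chains of `A`, reduced chains of `X` and relative chains. -/
noncomputable def redSeq (X : Cl.{u}) (A : Set X) :
    ShortComplex (ChainComplex (ModuleCat.{u} ℤ) ℕ) :=
  ShortComplex.mk (T.redMap J (X.incl A)) (T.redToRel J X A) (by
    rw [redToRel, ← Category.assoc, redMap_redIncl, Category.assoc]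
    have : (T.chains J).map (X.incl A) ≫ T.relProj J X A = 0 := cokernel.condition _
    rw [this, comp_zero])

/-- Passing to reduced chains removes the same copy of `ℤ` from the chains of `A` and of `X`, so the
quotient is unchanged. Nonemptiness of `A` is what makes its augmentation surjective. -/
lemma redSeq_shortExact (X : Cl.{u}) (A : Set X) (hA : A.Nonempty) :
    (T.redSeq J X A).ShortExact where
  mono_f := by
    have := T.mono_map_incl J X A
    have h : Mono (T.redMap J (X.incl A) ≫ T.redIncl J X) := by
      rw [redMap_redIncl]
      exact mono_comp _ _
    exact mono_of_mono (T.redMap J (X.incl A)) (T.redIncl J X)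
  epi_g := by
    refine HomologicalComplex.epi_of_epi_f _ fun n => (ModuleCat.epi_iff_surjective _).mpr ?_
    intro z
    obtain ⟨c, rfl⟩ := ChainComplex.surjective_of_epi (T.relProj J X A) n z
    obtain ⟨a, ha⟩ := hA
    -- Subtracting a chain of `A` with the same augmentation makes `c` reduced without changing its
    -- relative class.
    obtain ⟨b, hb⟩ := T.surjective_aug J (X.sub A) ⟨a, ha⟩ n ((T.aug J X).f n c)
    obtain ⟨e, he⟩ := T.exists_redIncl_eq J X (c - ((T.chains J).map (X.incl A)).f n b) (by
      rw [map_sub, sub_eq_zero, ← hb]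
      exact (ConcreteCategory.congr_hom
        (HomologicalComplex.congr_hom (T.map_aug J (X.incl A)) n) b).symm)
    refine ⟨e, ?_⟩
    change (T.relProj J X A).f n ((T.redIncl J X).f n e) = _
    rw [he, map_sub, (T.relProj_eq_zero J X A _).mpr ⟨b, rfl⟩, sub_zero]
  exact := by
    refine HomologicalComplex.exact_of_degreewise_exact _ fun n =>
      (ShortComplex.moduleCat_exact_iff _).mpr fun x hx => ?_
    change (T.relProj J X A).f n ((T.redIncl J X).f n x) = 0 at hx
    obtain ⟨a, ha⟩ := (T.relProj_eq_zero J X A _).mp hx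
    obtain ⟨e, he⟩ := T.exists_redIncl_eq J (X.sub A) a (by
      rw [← map_aug T J (X.incl A)]
      change (T.aug J X).f n (((T.chains J).map (X.incl A)).f n a) = 0
      rw [ha]
      exact T.aug_redIncl J X x)
    refine ⟨e, ChainComplex.injective_of_mono (T.redIncl J X) n ?_⟩
    refine (ConcreteCategory.congr_hom
      (HomologicalComplex.congr_hom (T.redMap_redIncl J (X.incl A)) n) e).trans ?_
    change ((T.chains J).map (X.incl A)).f n ((T.redIncl J _).f n e) = _
    rw [he, ha]

/-- The map from the reduced sequence of a pair to the sequence of the pair. -/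
noncomputable def redSeqToPairSeq (X : Cl.{u}) (A : Set X) :
    T.redSeq J X A ⟶ T.pairSeq J X A where
  τ₁ := T.redIncl J (X.sub A)
  τ₂ := T.redIncl J X
  τ₃ := 𝟙 _
  comm₁₂ := (T.redMap_redIncl J _).symm
  comm₂₃ := (Category.comp_id _).symm

end Theory

/-! ## Generators of the chain groups -/

namespace Cl

/-- The factorization of a continuous map through a subspace containing its values. -/
def Hom.codRestrict {Z : Cl.{v}} {X : Cl.{u}} (σ : Hom Z X) (A : Set X) (h : ∀ z, σ z ∈ A) :
    Hom Z (X.sub A) where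
  toFun z := ⟨σ z, h z⟩
  cont S := by
    rintro _ ⟨z, hz, rfl⟩
    have := σ.cont S ⟨z, hz, rfl⟩
    refine X.cl_mono ?_ this
    rintro _ ⟨y, hy, rfl⟩
    exact ⟨_, ⟨y, hy, rfl⟩, rfl⟩

end Cl

namespace Theory

/-- The space whose maps into `X` generate the chains of degree `n`. -/
noncomputable def model : Theory → Intv → ℕ → Cl.{0}
  | simplicial, J, n => J.simplex n
  | cubical, J, n => J.cube n

/-- The generators that are zero in the chain groups. -/
def IsDeg : ∀ (T : Theory) (J : Intv) {n : ℕ} {X : Cl.{u}}, Cl.Hom (T.model J n) X → Prop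
  | simplicial, _, _, _, _ => False
  | cubical, J, _, _, σ => Cube.IsDegenerate J σ

/-- The projection from the free group on the generators to the chains. -/
noncomputable def mk : ∀ (T : Theory) (J : Intv) (n : ℕ) (X : Cl.{u}),
    (Cl.Hom (T.model J n) X →₀ ℤ) →ₗ[ℤ] ((T.chains J).obj X).X n
  | simplicial, _, _, _ => LinearMap.id
  | cubical, J, n, X => Submodule.mkQ (Cube.D J n X)

variable (T : Theory) (J : Intv)

lemma mk_surjective (n : ℕ) (X : Cl.{u}) : Function.Surjective (T.mk J n X) := by
  cases T
  · exact Function.surjective_id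
  · exact Submodule.mkQ_surjective _

/-- The relations are spanned by generators, so the chain groups are free on the nondegenerate ones
and vanishing is tested coefficient by coefficient. Both theories are handled through this
criterion. -/
lemma mk_eq_zero_iff {n : ℕ} {X : Cl.{u}} (c : Cl.Hom (T.model J n) X →₀ ℤ) :
    T.mk J n X c = 0 ↔ ∀ σ, c σ ≠ 0 → T.IsDeg J σ := by
  cases T
  · refine ⟨fun h σ hσ => hσ ?_, fun h => ?_⟩
    · change c = 0 at h
      rw [h]
      rfl
    · exact Finsupp.ext fun σ => not_not.mp (h σ)
  · exact (Submodule.Quotient.mk_eq_zero _).trans (Cube.mem_D_iff J c)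

lemma map_mk {n : ℕ} {X Y : Cl.{u}} (f : X ⟶ Y) (c : Cl.Hom (T.model J n) X →₀ ℤ) :
    ((T.chains J).map f).f n (T.mk J n X c) =
      T.mk J n Y (Finsupp.mapDomain (fun σ => Cl.Hom.comp σ f) c) := by
  cases T <;> rfl

lemma isDeg_of_comp_incl {n : ℕ} {X : Cl.{u}} {A : Set X}
    (σ : Cl.Hom (T.model J n) (X.sub A)) (h : T.IsDeg J (σ.comp (X.incl A))) : T.IsDeg J σ := by
  cases T
  · exact h
  · obtain ⟨i, hi⟩ := h
    exact ⟨i, fun x t => Subtype.ext (hi x t)⟩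

/-- The chains of `X` that come from chains of `A`. -/
noncomputable def chainsIn (X : Cl.{u}) (A : Set X) (n : ℕ) :
    Submodule ℤ (((T.chains J).obj X).X n) :=
  LinearMap.range (((T.chains J).map (X.incl A)).f n).hom

lemma mem_chainsIn {X : Cl.{u}} {A : Set X} {n : ℕ} {c : ((T.chains J).obj X).X n} :
    c ∈ T.chainsIn J X A n ↔ ∃ a, ((T.chains J).map (X.incl A)).f n a = c := Iff.rfl

/-- A subspace contributes a subset of the basis of nondegenerate generators. Degenerate generators
must be admitted even outside `A`, since they represent zero. -/
lemma mk_mem_chainsIn_iff {X : Cl.{u}} {A : Set X} {n : ℕ} (c : Cl.Hom (T.model J n) X →₀ ℤ) :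
    T.mk J n X c ∈ T.chainsIn J X A n ↔ ∀ σ, c σ ≠ 0 → T.IsDeg J σ ∨ ∀ x, σ x ∈ A := by
  classical
  rw [mem_chainsIn]
  constructor
  · rintro ⟨a, ha⟩ σ hσ
    obtain ⟨a, rfl⟩ := T.mk_surjective J n _ a
    rw [map_mk, ← sub_eq_zero, ← map_sub, mk_eq_zero_iff] at ha
    by_cases h : ∀ x, σ x ∈ A
    · exact Or.inr h
    -- No generator of `A` maps to `σ`, so its coefficient in the difference is `-c σ`.
    · refine Or.inl (ha σ ?_)
      rw [Finsupp.sub_apply, Finsupp.mapDomain_of_notMem_range, zero_sub]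
      · exact neg_ne_zero.mpr hσ
      · rintro ⟨τ, rfl⟩
        exact h fun x => (τ x).2
  · intro h
    have hinj := Cl.Hom.comp_incl_injective (Z := T.model J n) A
    -- The discarded part of `c` is degenerate, so `c'` represents the same chain.
    let c' := c.filter fun σ => ∀ x, σ x ∈ A
    refine ⟨T.mk J n _ (c'.comapDomain _ hinj.injOn), ?_⟩
    rw [map_mk]
    refine (congrArg _ (Finsupp.mapDomain_comapDomain _ hinj c' ?_)).trans ?_
    · intro σ hσ
      have hσ' : ∀ x, σ x ∈ A := by
        by_contra hn
        exact Finsupp.mem_support_iff.mp hσ (Finsupp.filter_apply_neg _ _ hn)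
      exact ⟨σ.codRestrict A hσ', rfl⟩
    · rw [← sub_eq_zero, ← map_sub, mk_eq_zero_iff]
      intro σ hσ
      by_cases hA : ∀ x, σ x ∈ A
      · rw [Finsupp.sub_apply, Finsupp.filter_apply_pos _ _ hA, sub_self] at hσ
        exact absurd rfl hσ
      · rw [Finsupp.sub_apply, Finsupp.filter_apply_neg _ _ hA, zero_sub] at hσ
        exact (h σ (neg_ne_zero.mp hσ)).resolve_right hA

lemma mk_single_mem_chainsIn {X : Cl.{u}} {A : Set X} {n : ℕ} (σ : Cl.Hom (T.model J n) X)
    (h : ∀ x, σ x ∈ A) (k : ℤ) : T.mk J n X (Finsupp.single σ k) ∈ T.chainsIn J X A n := by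
  classical
  rw [mk_mem_chainsIn_iff]
  intro τ hτ
  rw [Finsupp.single_apply_ne_zero] at hτ
  exact Or.inr (hτ.1 ▸ h)

/-- A linear condition on chains may be checked on generators. -/
lemma mem_of_generators {X : Cl.{u}} {n : ℕ} (P : Submodule ℤ (((T.chains J).obj X).X n))
    (h : ∀ σ, T.mk J n X (Finsupp.single σ 1) ∈ P) (c : ((T.chains J).obj X).X n) : c ∈ P := by
  obtain ⟨c, rfl⟩ := T.mk_surjective J n X c
  induction c using Finsupp.induction_linear with
  | zero => rw [map_zero]; exact P.zero_mem
  | add f g hf hg => rw [map_add]; exact P.add_mem hf hg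
  | single σ k =>
    have e : Finsupp.single σ k = k • Finsupp.single σ (1 : ℤ) := by
      rw [Finsupp.smul_single, smul_eq_mul, mul_one]
    rw [e, LinearMap.map_smul]
    exact P.smul_mem k (h σ)

/-! ### Excision -/

/-- `U` and `V` form an excisive couple: every chain whose boundary is a sum of chains of `U` and
chains of `V` is, up to a boundary, itself such a sum. -/
def IsExcisive (X : Cl.{u}) (U V : Set X) : Prop :=
  ∀ (n : ℕ) (c : ((T.chains J).obj X).X n),
    (∀ m, ((T.chains J).obj X).d n m c ∈ T.chainsIn J X U m ⊔ T.chainsIn J X V m) →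
    ∃ y : ((T.chains J).obj X).X (n + 1),
      c - ((T.chains J).obj X).d (n + 1) n y ∈ T.chainsIn J X U n ⊔ T.chainsIn J X V n

lemma relProj_surjective (X : Cl.{u}) (A : Set X) (n : ℕ) :
    Function.Surjective ((T.relProj J X A).f n) :=
  ChainComplex.surjective_of_epi _ n

lemma relMap_relProj {X Y : Cl.{u}} (f : X ⟶ Y) {A : Set X} {B : Set Y}
    (h : Set.MapsTo (Cl.Hom.toFun f) A B) (n : ℕ) (c : ((T.chains J).obj X).X n) :
    (T.relMap J f h).f n ((T.relProj J X A).f n c) =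
      (T.relProj J Y B).f n (((T.chains J).map f).f n c) :=
  ConcreteCategory.congr_hom (HomologicalComplex.congr_hom (T.relProj_relMap J f h) n) c

/-- The map is `C(V)/C(U ∩ V) → C(X)/C(U)`. Its image is `(C(U) + C(V))/C(U)`, and excisiveness says
that the remaining quotient `C(X)/(C(U) + C(V))` is acyclic. -/
lemma IsExcisive.quasiIso_relMap {X : Cl.{u}} {U V : Set X} (h : T.IsExcisive J X U V)
    (hm : Set.MapsTo (Cl.Hom.toFun (X.incl V)) (Subtype.val ⁻¹' U) U) :
    QuasiIso (T.relMap J (X.incl V) hm) := by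
  refine ChainComplex.quasiIso_of_injective _ (fun n => ?_) fun n x hx => ?_
  -- Injectivity: a nondegenerate generator of `V` with values in `U` is a generator of `U ∩ V`.
  · refine (injective_iff_map_eq_zero _).mpr fun x hx => ?_
    obtain ⟨c, rfl⟩ := T.relProj_surjective J _ _ n x
    obtain ⟨c, rfl⟩ := T.mk_surjective J n _ c
    rw [relMap_relProj] at hx
    have hx' := (T.mem_chainsIn J).mpr ((T.relProj_eq_zero J _ _ _).mp hx)
    rw [map_mk, mk_mem_chainsIn_iff] at hx'
    refine (T.relProj_eq_zero J _ _ _).mpr ((T.mem_chainsIn J).mp ?_)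
    rw [mk_mem_chainsIn_iff]
    intro σ hσ
    refine (hx' (σ.comp (X.incl V)) ?_).imp (T.isDeg_of_comp_incl J σ) id
    rw [Finsupp.mapDomain_apply (Cl.Hom.comp_incl_injective V)]
    exact hσ
  · obtain ⟨c, rfl⟩ := T.relProj_surjective J _ _ n x
    obtain ⟨y, hy⟩ := h n c fun m => by
      obtain ⟨k, hk⟩ := hx m
      obtain ⟨b, rfl⟩ := T.relProj_surjective J _ _ m k
      rw [relMap_relProj, ← ChainComplex.map_d, ← sub_eq_zero, ← map_sub, relProj_eq_zero,
        ← mem_chainsIn] at hk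
      -- Modulo `C(U)` the boundary of `c` is the image of `b`; this splits it into a chain of `U`
      -- and a chain of `V`.
      rw [← neg_mem_iff, ← sub_add_cancel (-_) (-((T.chains J).map (X.incl V)).f m b)]
      refine add_mem (Submodule.mem_sup_left ?_) (Submodule.mem_sup_right (neg_mem ⟨b, rfl⟩))
      rw [sub_neg_eq_add, neg_add_eq_sub]
      exact hk
    obtain ⟨a, ha, _, ⟨b, rfl⟩, hab⟩ := Submodule.mem_sup.mp hy
    refine ⟨(T.relProj J X U).f _ y, (T.relProj J _ _).f n b, ?_⟩
    rw [relMap_relProj, ← ChainComplex.map_d, ← map_add, ← sub_eq_zero, ← map_sub,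
      relProj_eq_zero, ← mem_chainsIn, ← neg_mem_iff]
    convert ha using 1
    rw [neg_sub, ← sub_sub, sub_right_comm, ← hab]
    exact add_sub_cancel_right _ _

end Theory

/-! ## Homotopy invariance -/

/-- Chain homotopic maps induce equal maps in homology. -/
lemma ChainComplex.homologyMap_eq_of_homotopy {K L : ChainComplex (ModuleCat.{u} ℤ) ℕ}
    (φ ψ : K ⟶ L) (h : ∀ n, K.X n ⟶ L.X (n + 1))
    (h0 : φ.f 0 = h 0 ≫ L.d 1 0 + ψ.f 0)
    (hs : ∀ n, φ.f (n + 1) = K.d (n + 1) n ≫ h n + h (n + 1) ≫ L.d (n + 2) (n + 1) +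
      ψ.f (n + 1)) (n : ℕ) :
    HomologicalComplex.homologyMap φ n = HomologicalComplex.homologyMap ψ n := by
  refine Homotopy.homologyMap_eq
    { hom := fun i j => if e : i + 1 = j then h i ≫ eqToHom (by rw [e]) else 0
      zero := fun i j hij => dif_neg hij
      comm := fun n => ?_ } n
  cases n with
  | zero =>
    rw [prevD_eq (j' := 1) (w := by simp), dNext_eq_zero _ _ (by simp), zero_add]
    simp [h0]
  | succ n =>
    rw [dNext_eq (i' := n) (w := by simp), prevD_eq (j' := n + 2) (w := by simp)]
    simp [hs]

namespace Cl

/-- The map into a product of two spaces with given components. -/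
def Hom.prodLift {Z : Cl.{w}} {X : Cl.{u}} {Y : Cl.{v}} (f : Hom Z X) (g : Hom Z Y) :
    Hom Z (X.prod Y) where
  toFun z := (f z, g z)
  cont S := by
    rintro _ ⟨z, hz, rfl⟩ U V hU hV
    obtain ⟨y, hy, hyU⟩ := Z.inter_nonempty hz (U := f.toFun ⁻¹' U ∩ g.toFun ⁻¹' V) (by
      rw [int_inter]
      exact ⟨f.preimage_nhd hU, g.preimage_nhd hV⟩)
    exact ⟨_, ⟨y, hy, rfl⟩, hyU⟩

end Cl

/-! ### Cubical chains -/

namespace Cube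

variable (J : Intv)

/-- The projection of a cube that forgets the first coordinate. -/
noncomputable def tail (n : ℕ) : Cl.Hom (J.cube (n + 1)) (J.cube n) :=
  Cl.Hom.piLift fun i => Cl.Hom.proj _ i.succ

/-- The first coordinate of a cube. -/
noncomputable def head (n : ℕ) : Cl.Hom (J.cube (n + 1)) J.space := Cl.Hom.proj _ 0

/-- The cube of dimension `n + 1` swept out by a cube of dimension `n` under a homotopy. -/
noncomputable def sweep {X Y : Cl.{u}} (H : Cl.Hom (X.prod J.space) Y) {n : ℕ}
    (σ : Cl.Hom (J.cube n) X) : Cl.Hom (J.cube (n + 1)) Y :=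
  (Cl.Hom.prodLift ((tail J n).comp σ) (head J n)).comp H

/-- The homotopy parameter is the first coordinate: faces in direction `0` are the ends of the
homotopy, and all other faces are swept out by faces of `σ`. -/
lemma face_zero_sweep {X Y : Cl.{u}} (H : Cl.Hom (X.prod J.space) Y) {n : ℕ}
    (σ : Cl.Hom (J.cube n) X) (e : J.space) (f : X ⟶ Y) (hf : ∀ x, H (x, e) = Cl.Hom.toFun f x) :
    face J 0 e (sweep J H σ) = σ.comp f := by
  ext x
  exact hf (σ x)

lemma face_succ_sweep {X Y : Cl.{u}} (H : Cl.Hom (X.prod J.space) Y) {n : ℕ}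
    (σ : Cl.Hom (J.cube (n + 1)) X) (i : Fin (n + 1)) (e : J.space) :
    face J i.succ e (sweep J H σ) = sweep J H (face J i e σ) := by
  ext x
  change H (σ _, _) = H (σ _, _)
  refine congrArg H.toFun (Prod.ext (congrArg σ.toFun (funext fun k => ?_)) ?_)
  · induction k using Fin.succAboveCases i with
    | x =>
      exact (Fin.insertNth_apply_same (α := fun _ => J.space) _ _ _).trans
        (Fin.insertNth_apply_same (α := fun _ => J.space) _ _ _).symm
    | p k =>
      have h1 := Fin.insertNth_apply_succAbove (α := fun _ => J.space) i.succ e x k.succ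
      rw [Fin.succ_succAbove_succ] at h1
      exact h1.trans (Fin.insertNth_apply_succAbove (α := fun _ => J.space) i e (tail J n x) k).symm
  · have h1 := Fin.insertNth_apply_succAbove (α := fun _ => J.space) i.succ e x 0
    rw [Fin.succ_succAbove_zero] at h1
    exact h1

lemma isDegenerate_sweep {X Y : Cl.{u}} (H : Cl.Hom (X.prod J.space) Y) {n : ℕ}
    {σ : Cl.Hom (J.cube n) X} (h : IsDegenerate J σ) : IsDegenerate J (sweep J H σ) := by
  obtain ⟨i, hi⟩ := h
  refine ⟨i.succ, fun x t => ?_⟩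
  refine congrArg H.toFun (Prod.ext ?_ ?_)
  · refine Eq.trans (congrArg σ.toFun (funext fun k => ?_)) (hi _ t)
    by_cases hk : k = i
    · subst hk
      exact (Function.update_self (β := fun _ => J.space) _ _ _).trans
        (Function.update_self (β := fun _ => J.space) _ _ _).symm
    · exact (Function.update_of_ne (β := fun _ => J.space)
        (fun h => hk (Fin.succ_injective _ h)) _ _).trans
        (Function.update_of_ne (β := fun _ => J.space) hk t (tail J n x)).symm
  · exact Function.update_of_ne (β := fun _ => J.space) (Fin.succ_ne_zero i).symm t x

/-- The chain homotopy of cubical chains induced by a homotopy. -/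
noncomputable def sweepC {X Y : Cl.{u}} (H : Cl.Hom (X.prod J.space) Y) (n : ℕ) :
    C J n X ⟶ C J (n + 1) Y :=
  -- Directions are numbered from `1`, so the boundary of a sweep contains `g - f`; the minus sign
  -- turns this into `f - g`.
  ModuleCat.ofHom (-Submodule.mapQ (D J n X) (D J (n + 1) Y)
    (Finsupp.lmapDomain ℤ ℤ (sweep J H)) (Submodule.span_le.mpr (by
      rintro _ ⟨σ, h, rfl⟩
      change Finsupp.mapDomain _ _ ∈ D J (n + 1) Y
      rw [Finsupp.mapDomain_single]
      exact Submodule.subset_span ⟨_, isDegenerate_sweep J H h, rfl⟩)))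

lemma bd_single (n : ℕ) {X : Cl.{u}} (σ : Cl.Hom (J.cube (n + 1)) X) (k : ℤ) :
    bd J n X (Finsupp.single σ k) = ∑ i : Fin (n + 1), (-1 : ℤ) ^ (i + 1 : ℕ) •
      (Finsupp.single (face J i J.zeroPt σ) k - Finsupp.single (face J i J.onePt σ) k) := by
  simp only [bd, LinearMap.sum_apply, LinearMap.smul_apply, faceDiff, LinearMap.sub_apply,
    Finsupp.lmapDomain_apply, Finsupp.mapDomain_single]

/-- Direction `0` gives the two ends. The directions of `σ` move up by one, which reverses their
signs. -/
lemma bd_sweep {X Y : Cl.{u}} (H : Cl.Hom (X.prod J.space) Y) (f g : X ⟶ Y)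
    (hf : ∀ x, H (x, J.zeroPt) = Cl.Hom.toFun f x) (hg : ∀ x, H (x, J.onePt) = Cl.Hom.toFun g x)
    {n : ℕ} (σ : Cl.Hom (J.cube n) X) (k : ℤ) :
    bd J n Y (Finsupp.single (sweep J H σ) k) =
      Finsupp.single (σ.comp g) k - Finsupp.single (σ.comp f) k -
      ∑ i : Fin n, (-1 : ℤ) ^ (i + 1 : ℕ) •
        (Finsupp.single (face J i.succ J.zeroPt (sweep J H σ)) k -
          Finsupp.single (face J i.succ J.onePt (sweep J H σ)) k) := by
  rw [bd_single, Fin.sum_univ_succ, face_zero_sweep J H σ _ f hf, face_zero_sweep J H σ _ g hg,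
    sub_eq_add_neg (_ - _) (Finset.sum _ _), ← Finset.sum_neg_distrib]
  refine congrArg₂ (· + ·) (by simp) (Finset.sum_congr rfl fun i _ => ?_)
  rw [Fin.val_succ, pow_succ, mul_neg_one, neg_smul]

lemma homologyMap_eq {X Y : Cl.{u}} (H : Cl.Hom (X.prod J.space) Y) (f g : X ⟶ Y)
    (hf : ∀ x, H (x, J.zeroPt) = Cl.Hom.toFun f x) (hg : ∀ x, H (x, J.onePt) = Cl.Hom.toFun g x)
    (n : ℕ) : HomologicalComplex.homologyMap ((cubeChains J).map f) n =
      HomologicalComplex.homologyMap ((cubeChains J).map g) n := by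
  refine ChainComplex.homologyMap_eq_of_homotopy _ _ (fun n => sweepC J H n) ?_ (fun n => ?_) n
  · rw [cubeChains_d]
    ext : 1
    refine Submodule.linearMap_qext _ (Finsupp.lhom_ext fun σ k => ?_)
    change Submodule.mkQ _ (push J 0 f _) =
      Submodule.mkQ _ (bd J 0 Y (-(Finsupp.mapDomain _ _)) + push J 0 g _)
    congr 1
    rw [map_neg, Finsupp.mapDomain_single, bd_sweep J H f g hf hg]
    simp [push]
  · rw [cubeChains_d, cubeChains_d]
    ext : 1
    refine Submodule.linearMap_qext _ (Finsupp.lhom_ext fun σ k => ?_)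
    change Submodule.mkQ _ (push J (n + 1) f _) =
      Submodule.mkQ _ (-(Finsupp.mapDomain _ (bd J n X (Finsupp.single σ k))) +
        bd J (n + 1) Y (-(Finsupp.mapDomain _ _)) + push J (n + 1) g _)
    congr 1
    rw [map_neg, Finsupp.mapDomain_single, bd_sweep J H f g hf hg, bd_single,
      ← Finsupp.lmapDomain_apply ℤ ℤ]
    simp only [map_sum, map_smul, map_sub, Finsupp.lmapDomain_apply, Finsupp.mapDomain_single,
      face_succ_sweep, push]
    abel

end Cube

/-! ### Simplicial chains -/

namespace Intv

/-- The canonical map from the `1`-simplex to the interval. -/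
noncomputable def simplexOne : ∀ J : Intv, Cl.Hom (J.simplex 1) J.space
  | unit => ⟨(stdSimplexHomeomorphUnitInterval : stdSimplex ℝ (Fin 2) → unitInterval), fun _ =>
      image_closure_subset_closure_image (X := stdSimplex ℝ (Fin 2)) (Y := unitInterval)
        stdSimplexHomeomorphUnitInterval.continuous⟩
  | plus => Cl.Hom.id _
  | one => Cl.Hom.id _

lemma stdSimplex_map_const {n m : ℕ} (j : Fin (m + 1)) (x : stdSimplex ℝ (Fin (n + 1))) :
    stdSimplex.map (fun _ => j) x = stdSimplex.vertex j := by
  ext k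
  rw [stdSimplex.map_coe, FunOnFinite.linearMap_apply_apply, stdSimplex.vertex_coe]
  by_cases h : j = k
  · subst h
    simp
  · simp [h, Ne.symm h]

/-- This and `simplexOne_one` identify the ends of the simplicial homotopy: a constant map to a
vertex of `Δ[1]` corresponds to an endpoint of `J`. -/
lemma simplexOne_zero (J : Intv) {n : ℕ} (f : Fin (n + 1) →o Fin 2) (hf : ∀ i, f i = 0)
    (x : J.simplex n) : J.simplexOne (J.simplexMap (n := 1) f x) = J.zeroPt := by
  have hf' : (f : Fin (n + 1) → Fin 2) = fun _ => 0 := funext hf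
  cases J
  · change stdSimplexHomeomorphUnitInterval (stdSimplex.map f x) = _
    rw [hf']
    exact (congrArg _ (stdSimplex_map_const 0 x)).trans stdSimplexHomeomorphUnitInterval_zero
  · exact hf x
  · exact hf x

lemma simplexOne_one (J : Intv) {n : ℕ} (f : Fin (n + 1) →o Fin 2) (hf : ∀ i, f i = 1)
    (x : J.simplex n) : J.simplexOne (J.simplexMap (n := 1) f x) = J.onePt := by
  have hf' : (f : Fin (n + 1) → Fin 2) = fun _ => 1 := funext hf
  cases J
  · change stdSimplexHomeomorphUnitInterval (stdSimplex.map f x) = _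
    rw [hf']
    exact (congrArg _ (stdSimplex_map_const 1 x)).trans stdSimplexHomeomorphUnitInterval_one
  · exact hf x
  · exact hf x

end Intv

open MonoidalCategory Simplicial in
/-- The homotopy of nerves induced by a homotopy. -/
noncomputable def clNerveHomotopy (J : Intv) {X Y : Cl.{u}} (H : Cl.Hom (X.prod J.space) Y)
    (f g : X ⟶ Y) (hf : ∀ x, H (x, J.zeroPt) = Cl.Hom.toFun f x)
    (hg : ∀ x, H (x, J.onePt) = Cl.Hom.toFun g x) :
    SSet.Homotopy ((clNerve J).map f) ((clNerve J).map g) where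
  -- A simplex of `Δ[1]` is a monotone map of vertices, hence a map from the `n`-simplex to `J`.
  -- Paired with a singular simplex of `X` it can be fed into `H`.
  h :=
    { app n := TypeCat.ofHom fun p : Cl.Hom (J.simplex n.unop.len) X × Δ[1].obj n =>
        (Cl.Hom.prodLift p.1
          ((J.simplexMap (SSet.stdSimplex.objEquiv p.2).toOrderHom).comp J.simplexOne)).comp H
      naturality m n φ := by
        ext p : 3
        refine Cl.Hom.ext (funext fun x => ?_)
        refine congrArg H.toFun (Prod.ext rfl ?_)
        exact congrArg J.simplexOne.toFun (congrArg (fun ρ => ρ.toFun x)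
          (J.simplexMap_comp φ.unop.toOrderHom (SSet.stdSimplex.objEquiv p.2).toOrderHom)) }
  h₀ := by
    ext n σ : 4
    refine Cl.Hom.ext (funext fun x => Eq.trans ?_ (hf _))
    exact congrArg H.toFun (Prod.ext rfl (J.simplexOne_zero _ (fun _ => rfl) x))
  h₁ := by
    ext n σ : 4
    refine Cl.Hom.ext (funext fun x => Eq.trans ?_ (hg _))
    exact congrArg H.toFun (Prod.ext rfl (J.simplexOne_one _ (fun _ => rfl) x))
  -- The subcomplex on which the homotopy has to be constant is empty.
  rel := by
    ext _ ⟨⟨_, ⟨⟩⟩, _⟩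

namespace Theory

variable (T : Theory) (J : Intv)

lemma homologyMap_eq_of_oneStep {X Y : Cl.{u}} {A : Set X} {f g : X ⟶ Y}
    (h : OneStepHomotopicRel J A f g) (n : ℕ) :
    HomologicalComplex.homologyMap ((T.chains J).map f) n =
      HomologicalComplex.homologyMap ((T.chains J).map g) n := by
  obtain ⟨H, hf, hg, -⟩ := h
  cases T
  · exact ((clNerveHomotopy J H f g hf hg).toSimplicialObjectHomotopy.whiskerRight
      freeZ).toChainHomotopy.homologyMap_eq n
  · exact Cube.homologyMap_eq J H f g hf hg n

/-- One-step homotopies need not form an equivalence relation, but equality of induced maps does. -/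
lemma homologyMap_eq_of_homotopicRel {X Y : Cl.{u}} {A : Set X} {f g : X ⟶ Y}
    (h : HomotopicRel J A f g) (n : ℕ) :
    HomologicalComplex.homologyMap ((T.chains J).map f) n =
      HomologicalComplex.homologyMap ((T.chains J).map g) n := by
  induction h with
  | rel f g h => exact T.homologyMap_eq_of_oneStep J h n
  | refl f => rfl
  | symm f g _ ih => exact ih.symm
  | trans f g k _ _ ih₁ ih₂ => exact ih₁.trans ih₂

/-- The inclusion of a deformation retract is a quasi-isomorphism. -/
lemma quasiIso_of_deformationRetracts {Y : Cl.{u}} {A : Set Y} (h : DeformationRetracts J Y A) :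
    QuasiIso ((T.chains J).map (Y.incl A)) := by
  obtain ⟨r, hr, hrA, hh⟩ := h
  let r' : Y ⟶ Y.sub A := Cl.Hom.codRestrict r A hr
  have h1 : r' ≫ Y.incl A = r := rfl
  have h2 : Y.incl A ≫ r' = 𝟙 _ := Cl.Hom.ext (funext fun a => Subtype.ext (hrA a.1 a.2))
  rw [quasiIso_iff]
  intro n
  rw [quasiIsoAt_iff_isIso_homologyMap]
  refine ⟨HomologicalComplex.homologyMap ((T.chains J).map r') n, ?_, ?_⟩
  · rw [← HomologicalComplex.homologyMap_comp, ← Functor.map_comp, h2, CategoryTheory.Functor.map_id,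
      HomologicalComplex.homologyMap_id]
  · rw [← HomologicalComplex.homologyMap_comp, ← Functor.map_comp, h1,
      ← T.homologyMap_eq_of_homotopicRel J hh n, CategoryTheory.Functor.map_id,
      HomologicalComplex.homologyMap_id]

end Theory

/-! ## Small chains -/

namespace Theory

variable (T : Theory) (J : Intv)

/-- The sums of chains of `U` and chains of `V`. -/
noncomputable abbrev smallChains (X : Cl.{u}) (U V : Set X) (n : ℕ) :
    Submodule ℤ (((T.chains J).obj X).X n) :=
  T.chainsIn J X U n ⊔ T.chainsIn J X V n

lemma d_mem_chainsIn {X : Cl.{u}} {A : Set X} {m n : ℕ} {c : ((T.chains J).obj X).X m}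
    (hc : c ∈ T.chainsIn J X A m) :
    ((T.chains J).obj X).d m n c ∈ T.chainsIn J X A n := by
  obtain ⟨a, rfl⟩ := hc
  exact ⟨((T.chains J).obj (X.sub A)).d m n a, ChainComplex.map_d _ _ _ _⟩

lemma d_mem_smallChains {X : Cl.{u}} {U V : Set X} {m n : ℕ} {c : ((T.chains J).obj X).X m}
    (hc : c ∈ T.smallChains J X U V m) :
    ((T.chains J).obj X).d m n c ∈ T.smallChains J X U V n := by
  obtain ⟨a, ha, b, hb, rfl⟩ := Submodule.mem_sup.mp hc
  rw [map_add]
  exact add_mem (Submodule.mem_sup_left (T.d_mem_chainsIn J ha))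
    (Submodule.mem_sup_right (T.d_mem_chainsIn J hb))

/-- All chains are small already. This is the situation for `J₊` and `J₁`. -/
lemma isExcisive_of_forall_generator {X : Cl.{u}} {U V : Set X}
    (h : ∀ (n : ℕ) (σ : Cl.Hom (T.model J n) X), (∀ x, σ x ∈ U) ∨ ∀ x, σ x ∈ V) :
    T.IsExcisive J X U V := by
  refine fun n c _ => ⟨0, ?_⟩
  rw [map_zero, sub_zero]
  refine T.mem_of_generators J _ (fun σ => ?_) c
  rcases h n σ with h | h
  exacts [Submodule.mem_sup_left (T.mk_single_mem_chainsIn J σ h 1),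
    Submodule.mem_sup_right (T.mk_single_mem_chainsIn J σ h 1)]

/-- A subdivision operator that is chain homotopic to the identity, preserves small chains, and
makes every generator small after finitely many steps shows excision. -/
lemma isExcisive_of_subdivision {X : Cl.{u}} {U V : Set X}
    (s : ∀ n, ((T.chains J).obj X).X n →ₗ[ℤ] ((T.chains J).obj X).X n)
    (h : ∀ n, ((T.chains J).obj X).X n →ₗ[ℤ] ((T.chains J).obj X).X (n + 1))
    (h0 : ∀ c, c - s 0 c = ((T.chains J).obj X).d 1 0 (h 0 c))
    (hs : ∀ n c, c - s (n + 1) c = ((T.chains J).obj X).d (n + 2) (n + 1) (h (n + 1) c) +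
      h n (((T.chains J).obj X).d (n + 1) n c))
    (sS : ∀ n c, c ∈ T.smallChains J X U V n → s n c ∈ T.smallChains J X U V n)
    (hS : ∀ n c, c ∈ T.smallChains J X U V n → h n c ∈ T.smallChains J X U V (n + 1))
    (small : ∀ n (σ : Cl.Hom (T.model J n) X),
      ∃ N : ℕ, (s n)^[N] (T.mk J n X (Finsupp.single σ 1)) ∈ T.smallChains J X U V n) :
    T.IsExcisive J X U V := by
  have step : ∀ n c, (∀ m, ((T.chains J).obj X).d n m c ∈ T.smallChains J X U V m) →
      c - s n c - ((T.chains J).obj X).d (n + 1) n (h n c) ∈ T.smallChains J X U V n := by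
    intro n c hc
    cases n with
    | zero =>
      rw [h0, sub_self]
      exact zero_mem _
    | succ n =>
      rw [hs, add_sub_cancel_left]
      exact hS n _ (hc n)
  have iter : ∀ n N c, (s n)^[N] c ∈ T.smallChains J X U V n →
      (s n)^[N + 1] c ∈ T.smallChains J X U V n := fun n N c hc => by
    rw [Function.iterate_succ_apply']
    exact sS n _ hc
  have iter' : ∀ n N M c, (s n)^[N] c ∈ T.smallChains J X U V n →
      (s n)^[N + M] c ∈ T.smallChains J X U V n := fun n N M c hc => by
    induction M with
    | zero => exact hc
    | succ M ih => exact iter n _ c ih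
  -- The number of subdivisions depends on the chain. For a sum the two numbers are added, since
  -- further subdivision keeps chains small.
  have hsmall : ∀ n c, ∃ N : ℕ, (s n)^[N] c ∈ T.smallChains J X U V n := fun n c => by
    have hpow : ∀ N c, (s n)^[N] c = (s n ^ N) c := fun N c => (Module.End.pow_apply _ _ _).symm
    let P : Submodule ℤ (((T.chains J).obj X).X n) :=
      { carrier := {c | ∃ N : ℕ, (s n)^[N] c ∈ T.smallChains J X U V n}
        zero_mem' := ⟨0, zero_mem _⟩
        add_mem' := by
          rintro a b ⟨N, hN⟩ ⟨M, hM⟩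
          refine ⟨N + M, ?_⟩
          have h1 := iter' n N M a hN
          have h2 := iter' n M N b hM
          rw [add_comm M N] at h2
          rw [hpow] at h1 h2 ⊢
          rw [map_add]
          exact add_mem h1 h2
        smul_mem' := by
          rintro k a ⟨N, hN⟩
          refine ⟨N, ?_⟩
          rw [hpow] at hN ⊢
          rw [LinearMap.map_smul]
          exact Submodule.smul_mem _ k hN }
    exact T.mem_of_generators J P (small n) c
  intro n c hc
  obtain ⟨N, hN⟩ := hsmall n c
  induction N generalizing c with
  | zero => exact ⟨0, by rwa [map_zero, sub_zero]⟩
  | succ N ih =>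
    -- Up to a boundary and a small chain, `c` may be replaced by `s c`, which needs one subdivision
    -- fewer. The boundary of `s c` is small because it differs from `d c` by a small chain.
    have h1 := step n c hc
    obtain ⟨y, hy⟩ := ih (s n c) (fun m => by
      have h2 := T.d_mem_smallChains J (n := m) h1
      rw [map_sub, map_sub] at h2
      have h3 : ((T.chains J).obj X).d n m (((T.chains J).obj X).d (n + 1) n (h n c)) = 0 :=
        ConcreteCategory.congr_hom (((T.chains J).obj X).d_comp_d (n + 1) n m) _
      rw [h3, sub_zero] at h2
      have h4 := sub_mem (hc m) h2
      rwa [sub_sub_cancel] at h4) hN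
    refine ⟨h n c + y, ?_⟩
    rw [map_add]
    convert add_mem h1 hy using 1
    abel

end Theory

/-! ### Covers -/

namespace Cl

lemma int_ofTop {Z : Type u} [TopologicalSpace Z] (S : Set Z) : (ofTop Z).int S = interior S := by
  change (closure Sᶜ)ᶜ = _
  rw [closure_compl, compl_compl]

lemma mem_cl_singleton_of_continuous {Z : Cl.{v}} {X : Cl.{u}} (σ : Hom Z X) {z t : Z}
    (h : t ∈ Z.cl {z}) : σ t ∈ X.cl {σ z} := by
  have := σ.cont _ ⟨t, h, rfl⟩
  rwa [Set.image_singleton] at this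

lemma mem_of_mem_int {X : Cl.{u}} {x y : X} {B : Set X} (hx : x ∈ X.int B)
    (h : x ∈ X.cl {y}) : y ∈ B := by
  obtain ⟨z, rfl, hz⟩ := X.inter_nonempty h hx
  exact hz

/-- In both structures the neighborhoods are generated by finite boxes. This makes metric
compactness of the topological cube available for singular cubes. -/
lemma mem_nhds_of_mem_int_pi {ι : Type v} {Z : ι → Type u} [∀ i, TopologicalSpace (Z i)]
    {x : ∀ i, Z i} {W : Set (∀ i, Z i)} (h : x ∈ (pi fun i => ofTop (Z i)).int W) :
    W ∈ nhds x := by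
  by_contra hW
  refine h fun F (V : ∀ i, Set (Z i)) hV => ?_
  by_contra hn
  have hV' : ∀ i ∈ F, V i ∈ nhds (x i) := fun i hi => by
    rw [← mem_interior_iff_mem_nhds, ← int_ofTop]
    exact hV i hi
  refine hW (Filter.mem_of_superset (set_pi_mem_nhds F.finite_toSet hV') fun y hy => ?_)
  by_contra hyW
  exact hn ⟨y, hyW, fun i hi => hy i hi⟩

end Cl

/-- The Lebesgue number of a cover pulled back from a closure space. -/
lemma exists_lebesgue_number {Z : Type v} [PseudoMetricSpace Z] [CompactSpace Z] {X : Cl.{u}}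
    (f : Z → X) (hf : ∀ z U, f z ∈ X.int U → f ⁻¹' U ∈ nhds z) {U V : Set X}
    (hUV : ∀ x, x ∈ X.int U ∨ x ∈ X.int V) :
    ∃ δ > 0, ∀ z, (∀ y, dist y z < δ → f y ∈ U) ∨ ∀ y, dist y z < δ → f y ∈ V := by
  -- Interiors in a closure space need not be open, so the open cover consists of topological
  -- interiors of preimages in `Z`.
  obtain ⟨δ, hδ, h⟩ := lebesgue_number_lemma_of_metric (s := (Set.univ : Set Z))
    (c := fun b : Bool => interior (f ⁻¹' (if b then U else V))) isCompact_univ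
    (fun _ => isOpen_interior) (fun z _ => by
      rw [Set.mem_iUnion]
      rcases hUV (f z) with h | h
      · exact ⟨true, mem_interior_iff_mem_nhds.mpr (hf z U h)⟩
      · exact ⟨false, mem_interior_iff_mem_nhds.mpr (hf z V h)⟩)
  refine ⟨δ, hδ, fun z => ?_⟩
  obtain ⟨b, hb⟩ := h z trivial
  cases b
  · exact Or.inr fun y hy => (interior_subset (hb hy) : y ∈ f ⁻¹' V)
  · exact Or.inl fun y hy => (interior_subset (hb hy) : y ∈ f ⁻¹' U)

namespace Theory

variable (T : Theory)

/-- The point is the last vertex of the simplex, respectively the corner of the cube with all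
coordinates `1`. -/
lemma model_plus (n : ℕ) : ∃ t : T.model Intv.plus n, ∀ x, t ∈ (T.model Intv.plus n).cl {x} := by
  cases T
  · exact ⟨Fin.last n, fun x => ⟨x, rfl, Fin.le_last _⟩⟩
  · refine ⟨fun _ => (1 : Fin 2), fun x F V hV => ⟨x, rfl, fun i hi => ?_⟩⟩
    by_contra h
    exact hV i hi ⟨x i, h, Fin.le_last (n := 1) _⟩

lemma model_one (n : ℕ) (t x : T.model Intv.one n) : t ∈ (T.model Intv.one n).cl {x} := by
  cases T
  · exact ⟨x, rfl⟩
  · refine fun F V hV => ⟨x, rfl, fun i hi => ?_⟩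
    by_contra h
    exact hV i hi ⟨x i, h⟩

/-- The top point `t` decides, because `σ t` is in the closure of every `σ x`. If `σ t` is in `A`,
its neighborhood `B` contains all `σ x`; if not, closedness of `A` excludes every `σ x` from `A`. -/
lemma isExcisive_plus {X : Cl.{u}} {A B : Set X} (hAB : X.IsNhd B A) (hA : X.Closed A) :
    T.IsExcisive Intv.plus X B Aᶜ := by
  refine T.isExcisive_of_forall_generator _ fun n σ => ?_
  obtain ⟨t, ht⟩ := T.model_plus n
  by_cases h : σ t ∈ A
  · exact Or.inl fun x => Cl.mem_of_mem_int (hAB h) (Cl.mem_cl_singleton_of_continuous σ (ht x))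
  · refine Or.inr fun x hx => h ?_
    rw [← hA]
    exact X.cl_mono (Set.singleton_subset_iff.mpr hx)
      (Cl.mem_cl_singleton_of_continuous σ (ht x))

/-- Here every point of the model can play the part of `t`, so a generator meeting `A` at all lies
in `B`. Closedness of `A` is not needed. -/
lemma isExcisive_one {X : Cl.{u}} {A B : Set X} (hAB : X.IsNhd B A) :
    T.IsExcisive Intv.one X B Aᶜ := by
  refine T.isExcisive_of_forall_generator _ fun n σ => ?_
  by_cases h : ∃ t, σ t ∈ A
  · obtain ⟨t, h⟩ := h
    exact Or.inl fun x => Cl.mem_of_mem_int (hAB h)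
      (Cl.mem_cl_singleton_of_continuous σ (T.model_one n t x))
  · exact Or.inr fun x hx => h ⟨x, hx⟩

end Theory

/-- A natural operator commutes with the inclusions of `U` and of `V`, hence maps the chains of each
into itself. -/
lemma Theory.map_mem_smallChains (T : Theory) (J : Intv) {m n : ℕ}
    (s : ∀ Y : Cl.{u}, ((T.chains J).obj Y).X m →ₗ[ℤ] ((T.chains J).obj Y).X n)
    (hs : ∀ {Y Z : Cl.{u}} (f : Y ⟶ Z) c,
      s Z (((T.chains J).map f).f m c) = ((T.chains J).map f).f n (s Y c))
    {X : Cl.{u}} {U V : Set X} {c : ((T.chains J).obj X).X m}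
    (hc : c ∈ T.smallChains J X U V m) : s X c ∈ T.smallChains J X U V n := by
  obtain ⟨_, ⟨a, rfl⟩, _, ⟨b, rfl⟩, rfl⟩ := Submodule.mem_sup.mp hc
  rw [map_add]
  exact add_mem (Submodule.mem_sup_left ⟨s _ a, (hs _ a).symm⟩)
    (Submodule.mem_sup_right ⟨s _ b, (hs _ b).symm⟩)

namespace Cl

/-- A continuous function of two variables on topological spaces. -/
def Hom.ofContinuous₂ {Z : Type u} {W : Type v} {Y : Type w} [TopologicalSpace Z]
    [TopologicalSpace W] [TopologicalSpace Y] (f : Z × W → Y) (hf : Continuous f) :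
    Hom ((ofTop Z).prod (ofTop W)) (ofTop Y) where
  toFun := f
  cont S := by
    rintro _ ⟨(p : Z × W), hp, rfl⟩
    refine (mem_closure_iff_nhds (s := f '' S)).mpr fun N hN => ?_
    obtain ⟨U, hU, V, hV, hUV⟩ := mem_nhds_prod_iff.mp (hf.continuousAt hN)
    obtain ⟨y, hy, hyU, hyV⟩ := hp U V
      ((int_ofTop U).symm ▸ (mem_interior_iff_mem_nhds.mpr hU : p.1 ∈ interior U))
      ((int_ofTop V).symm ▸ (mem_interior_iff_mem_nhds.mpr hV : p.2 ∈ interior V))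
    exact ⟨f y, hUV ⟨hyU, hyV⟩, y, hy, rfl⟩

end Cl

/-! ## Subdivision of cubes -/

namespace Cube

/-- For `b = false` and `b = true`, the parametrizations by `x` of the two intervals into which
`[0,1]` is divided by `(1 + t) / 2`. -/
noncomputable def bisect (b : Bool) (t x : unitInterval) : unitInterval :=
  match b with
  | false => ⟨x * ((1 + t) / 2), by
      have := x.2.1; have := x.2.2; have := t.2.1; have := t.2.2
      constructor <;> nlinarith⟩
  | true => ⟨(1 + t) / 2 + x * ((1 - t) / 2), by
      have := x.2.1; have := x.2.2; have := t.2.1; have := t.2.2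
      constructor <;> nlinarith⟩

lemma continuous_bisect (b : Bool) :
    Continuous fun p : unitInterval × unitInterval => bisect b p.1 p.2 := by
  cases b <;> exact Continuous.subtype_mk (by fun_prop) _

/-- At parameter `0` the two pieces are the halves of `[0,1]`. As the parameter grows, the cut moves
to the right, until at `1` the first piece is all of `[0,1]` and the second is the point `1`. The
pieces meet at the cut throughout. -/
lemma bisect_false_zero (t : unitInterval) : bisect false t 0 = 0 :=
  Subtype.ext (by simp [bisect])

lemma bisect_true_one (t : unitInterval) : bisect true t 1 = 1 :=
  Subtype.ext (by simp only [bisect, Set.Icc.coe_one]; ring)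

lemma bisect_false_one (t : unitInterval) : bisect false t 1 = bisect true t 0 :=
  Subtype.ext (by simp [bisect])

lemma bisect_one_false (x : unitInterval) : bisect false 1 x = x :=
  Subtype.ext (by simp only [bisect, Set.Icc.coe_one]; ring)

lemma bisect_one_true (x : unitInterval) : bisect true 1 x = 1 :=
  Subtype.ext (by simp only [bisect, Set.Icc.coe_one]; ring)

lemma dist_bisect_zero (b : Bool) (x y : unitInterval) :
    dist (bisect b 0 x) (bisect b 0 y) = (1 / 2) * dist x y := by
  rw [Subtype.dist_eq, Subtype.dist_eq, Real.dist_eq, Real.dist_eq]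
  have h : ((bisect b 0 x : ℝ) - bisect b 0 y) = (1 / 2) * ((x : ℝ) - y) := by
    cases b <;> simp only [bisect, Set.Icc.coe_zero] <;> ring
  rw [h, abs_mul, abs_of_pos (by norm_num : (0 : ℝ) < 1 / 2)]

/-- The map of cubes that deforms the subcube with index `e` onto the whole cube or a face. The
deformation parameter is the first coordinate. -/
noncomputable def bisectFun {n : ℕ} (e : Fin n → Bool) (y : Fin (n + 1) → unitInterval) :
    Fin n → unitInterval := fun i => bisect (e i) (y 0) (y i.succ)

lemma bisectFun_insertNth {n : ℕ} (e : Fin (n + 1) → Bool) (i : Fin (n + 1)) (a : unitInterval)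
    (y : Fin (n + 1) → unitInterval) :
    bisectFun e (i.succ.insertNth (α := fun _ => unitInterval) a y : Fin (n + 2) → unitInterval) =
      i.insertNth (α := fun _ => unitInterval)
        (bisect (e i) (y 0) a) (bisectFun (fun k => e (i.succAbove k)) y) := by
  have h0 : (i.succ.insertNth (α := fun _ => unitInterval) a y : Fin (n + 2) → unitInterval) 0 =
      y 0 := by
    have h1 := Fin.insertNth_apply_succAbove (α := fun _ => unitInterval) i.succ a y 0
    rwa [Fin.succ_succAbove_zero] at h1
  funext k
  rw [bisectFun, h0]
  induction k using Fin.succAboveCases i with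
  | x => rw [Fin.insertNth_apply_same, Fin.insertNth_apply_same]
  | p k =>
    rw [Fin.insertNth_apply_succAbove, bisectFun]
    have h1 := Fin.insertNth_apply_succAbove (α := fun _ => unitInterval) i.succ a y k.succ
    rw [Fin.succ_succAbove_succ] at h1
    rw [h1]

lemma bisectFun_update {n : ℕ} (e : Fin n → Bool) (i : Fin n) (a : unitInterval)
    (y : Fin (n + 1) → unitInterval) :
    bisectFun e (Function.update y i.succ a) =
      Function.update (bisectFun e y) i (bisect (e i) (y 0) a) := by
  funext k
  rw [bisectFun, Function.update_of_ne (Fin.succ_ne_zero i).symm]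
  by_cases hk : k = i
  · subst hk
    rw [Function.update_self, Function.update_self]
  · rw [Function.update_of_ne (fun h => hk (Fin.succ_injective _ h)), Function.update_of_ne hk]
    rfl

/-- The map `bisectFun` as a map of closure spaces. -/
noncomputable def bisectCube {n : ℕ} (e : Fin n → Bool) :
    Cl.Hom (Intv.unit.cube (n + 1)) (Intv.unit.cube n) :=
  Cl.Hom.piLift fun i => (Cl.Hom.prodLift
    (Cl.Hom.proj (fun _ : Fin (n + 1) => Cl.ofTop unitInterval) 0)
    (Cl.Hom.proj (fun _ : Fin (n + 1) => Cl.ofTop unitInterval) i.succ)).comp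
      (Cl.Hom.ofContinuous₂ _ (continuous_bisect (e i)))

/-- The coordinates of the subcube with index `e`. -/
noncomputable def subcubeFun {n : ℕ} (e : Fin n → Bool) (x : Fin n → unitInterval) :
    Fin n → unitInterval := fun i => bisect (e i) 0 (x i)

lemma subcubeFun_update {n : ℕ} (e : Fin n → Bool) (i : Fin n) (a : unitInterval)
    (x : Fin n → unitInterval) : subcubeFun e (Function.update x i a) =
      Function.update (subcubeFun e x) i (bisect (e i) 0 a) := by
  funext k
  rw [subcubeFun]
  by_cases hk : k = i
  · subst hk
    rw [Function.update_self, Function.update_self]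
  · rw [Function.update_of_ne hk, Function.update_of_ne hk]
    rfl

/-- The subcube with index `e`. -/
noncomputable def subcube {n : ℕ} (e : Fin n → Bool) :
    Cl.Hom (Intv.unit.cube n) (Intv.unit.cube n) :=
  face Intv.unit 0 Intv.unit.zeroPt (bisectCube e)

variable {X : Cl.{u}}

lemma face_zero_bisectCube {n : ℕ} (e : Fin n → Bool) (σ : Cl.Hom (Intv.unit.cube n) X) :
    face Intv.unit 0 Intv.unit.zeroPt ((bisectCube e).comp σ) = (subcube e).comp σ := rfl

lemma face_zero_one_bisectCube {n : ℕ} (σ : Cl.Hom (Intv.unit.cube n) X) :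
    face Intv.unit 0 Intv.unit.onePt ((bisectCube fun _ => false).comp σ) = σ := by
  ext x
  exact congrArg σ.toFun (funext fun i => bisect_one_false _)

/-- At parameter `1` the second piece has shrunk to a point, so coordinate `i` no longer matters. -/
lemma isDegenerate_face_bisectCube {n : ℕ} (σ : Cl.Hom (Intv.unit.cube n) X) (e : Fin n → Bool)
    (i : Fin n) (hi : e i = true) :
    IsDegenerate Intv.unit (face Intv.unit 0 Intv.unit.onePt ((bisectCube e).comp σ)) := by
  refine ⟨i, fun (x : Fin n → unitInterval) (t : unitInterval) =>
    congrArg σ.toFun (funext fun k => ?_)⟩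
  change bisect (e k) 1 (Function.update x i t k) = bisect (e k) 1 (x k)
  by_cases hk : k = i
  · subst hk
    rw [hi, bisect_one_true, bisect_one_true]
  · rw [Function.update_of_ne hk]

lemma isDegenerate_bisectCube {n : ℕ} {σ : Cl.Hom (Intv.unit.cube n) X}
    (h : IsDegenerate Intv.unit σ) (e : Fin n → Bool) :
    IsDegenerate Intv.unit ((bisectCube e).comp σ) := by
  obtain ⟨i, hi⟩ := h
  exact ⟨i.succ, fun x t => (congrArg σ.toFun (bisectFun_update e i t x)).trans (hi _ _)⟩

lemma isDegenerate_subcube {n : ℕ} {σ : Cl.Hom (Intv.unit.cube n) X}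
    (h : IsDegenerate Intv.unit σ) (e : Fin n → Bool) :
    IsDegenerate Intv.unit ((subcube e).comp σ) := by
  obtain ⟨i, hi⟩ := h
  exact ⟨i, fun x t => (congrArg σ.toFun (subcubeFun_update e i t x)).trans (hi _ _)⟩

/-- The outer faces in direction `i` come from the faces of `σ`; the two pieces adjacent across the
cut share their inner face. -/
lemma face_succ_bisectCube {n : ℕ} (σ : Cl.Hom (Intv.unit.cube (n + 1)) X)
    (e : Fin n → Bool) (i : Fin (n + 1)) :
    face Intv.unit i.succ Intv.unit.zeroPt
        ((bisectCube (i.insertNth (α := fun _ => Bool) false e)).comp σ) =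
      (bisectCube e).comp (face Intv.unit i Intv.unit.zeroPt σ) ∧
    face Intv.unit i.succ Intv.unit.onePt
        ((bisectCube (i.insertNth (α := fun _ => Bool) true e)).comp σ) =
      (bisectCube e).comp (face Intv.unit i Intv.unit.onePt σ) ∧
    face Intv.unit i.succ Intv.unit.onePt
        ((bisectCube (i.insertNth (α := fun _ => Bool) false e)).comp σ) =
      face Intv.unit i.succ Intv.unit.zeroPt
        ((bisectCube (i.insertNth (α := fun _ => Bool) true e)).comp σ) := by
  have h := fun (b : Bool) (a : unitInterval) (y : Fin (n + 1) → unitInterval) =>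
    bisectFun_insertNth (i.insertNth (α := fun _ => Bool) b e) i a y
  simp only [Fin.insertNth_apply_same, Fin.insertNth_apply_succAbove] at h
  refine ⟨?_, ?_, ?_⟩ <;> refine Cl.Hom.ext (funext fun (y : Fin (n + 1) → unitInterval) =>
    congrArg σ.toFun ?_)
  · refine (h false 0 y).trans ?_
    rw [bisect_false_zero]
    rfl
  · refine (h true 1 y).trans ?_
    rw [bisect_true_one]
    rfl
  · refine (h false 1 y).trans (Eq.trans ?_ (h true 0 y).symm)
    rw [bisect_false_one]

/-- Inner faces occur twice with opposite signs and cancel. This leaves the deformation of the faces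
of `σ`. -/
lemma sum_face_succ_bisectCube {n : ℕ} (σ : Cl.Hom (Intv.unit.cube (n + 1)) X) (k : ℤ)
    (i : Fin (n + 1)) :
    ∑ e : Fin (n + 1) → Bool,
      (Finsupp.single (face Intv.unit i.succ Intv.unit.zeroPt ((bisectCube e).comp σ)) k -
        Finsupp.single (face Intv.unit i.succ Intv.unit.onePt ((bisectCube e).comp σ)) k) =
    ∑ e : Fin n → Bool,
      (Finsupp.single ((bisectCube e).comp (face Intv.unit i Intv.unit.zeroPt σ)) k -
        Finsupp.single ((bisectCube e).comp (face Intv.unit i Intv.unit.onePt σ)) k) := by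
  -- An index is split into its `i`-th entry, which selects one of two adjacent pieces, and the
  -- remaining entries.
  rw [← (Fin.insertNthEquiv (fun _ => Bool) i).sum_comp, Fintype.sum_prod_type_right]
  refine Finset.sum_congr rfl fun e _ => ?_
  obtain ⟨h0, h1, h2⟩ := face_succ_bisectCube σ e i
  rw [Fintype.sum_bool]
  change Finsupp.single (face _ _ _ ((bisectCube (i.insertNth (α := fun _ => Bool) true e)).comp σ))
    k - Finsupp.single (face _ _ _ ((bisectCube (i.insertNth (α := fun _ => Bool) true e)).comp σ))
    k + (Finsupp.single (face _ _ _ ((bisectCube (i.insertNth (α := fun _ => Bool) false e)).comp σ))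
    k - Finsupp.single (face _ _ _ ((bisectCube (i.insertNth (α := fun _ => Bool) false e)).comp σ))
    k) = _
  rw [h0, h1, h2]
  abel

/-- The subdivision of cubical chains, before passing to the quotient by degenerate cubes. -/
noncomputable def sdQ (n : ℕ) (X : Cl.{u}) : Q Intv.unit n X →ₗ[ℤ] Q Intv.unit n X :=
  ∑ e : Fin n → Bool, Finsupp.lmapDomain ℤ ℤ fun σ => (subcube e).comp σ

/-- The homotopy between the identity and the subdivision of cubical chains. -/
noncomputable def sdHomotopyQ (n : ℕ) (X : Cl.{u}) :
    Q Intv.unit n X →ₗ[ℤ] Q Intv.unit (n + 1) X :=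
  ∑ e : Fin n → Bool, Finsupp.lmapDomain ℤ ℤ fun σ => (bisectCube e).comp σ

lemma sdQ_single {n : ℕ} (σ : Cl.Hom (Intv.unit.cube n) X) (k : ℤ) :
    sdQ n X (Finsupp.single σ k) = ∑ e, Finsupp.single ((subcube e).comp σ) k := by
  simp only [sdQ, LinearMap.sum_apply, Finsupp.lmapDomain_apply, Finsupp.mapDomain_single]

lemma sdHomotopyQ_single {n : ℕ} (σ : Cl.Hom (Intv.unit.cube n) X) (k : ℤ) :
    sdHomotopyQ n X (Finsupp.single σ k) = ∑ e, Finsupp.single ((bisectCube e).comp σ) k := by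
  simp only [sdHomotopyQ, LinearMap.sum_apply, Finsupp.lmapDomain_apply, Finsupp.mapDomain_single]

lemma single_mem_D (J : Intv) {n : ℕ} {σ : Cl.Hom (J.cube n) X} (h : IsDegenerate J σ) (k : ℤ) :
    Finsupp.single σ k ∈ D J n X := by
  classical
  rw [mem_D_iff]
  intro τ hτ
  rw [Finsupp.single_apply_ne_zero] at hτ
  exact hτ.1 ▸ h

lemma sdQ_D (n : ℕ) (X : Cl.{u}) :
    D Intv.unit n X ≤ (D Intv.unit n X).comap (sdQ n X) := by
  refine Submodule.span_le.mpr ?_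
  rintro _ ⟨σ, h, rfl⟩
  change sdQ n X _ ∈ D Intv.unit n X
  rw [sdQ_single]
  exact Submodule.sum_mem _ fun e _ => single_mem_D _ (isDegenerate_subcube h e) 1

lemma sdHomotopyQ_D (n : ℕ) (X : Cl.{u}) :
    D Intv.unit n X ≤ (D Intv.unit (n + 1) X).comap (sdHomotopyQ n X) := by
  refine Submodule.span_le.mpr ?_
  rintro _ ⟨σ, h, rfl⟩
  change sdHomotopyQ n X _ ∈ D Intv.unit (n + 1) X
  rw [sdHomotopyQ_single]
  exact Submodule.sum_mem _ fun e _ => single_mem_D _ (isDegenerate_bisectCube h e) 1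

/-- At parameter `1` the piece with all entries `false` is `σ` itself, and every other piece is
degenerate. -/
lemma sum_face_zero_bisectCube {n : ℕ} (σ : Cl.Hom (Intv.unit.cube n) X) (k : ℤ) :
    ∑ e : Fin n → Bool,
      Finsupp.single (face Intv.unit 0 Intv.unit.onePt ((bisectCube e).comp σ)) k -
        Finsupp.single σ k ∈ D Intv.unit n X := by
  rw [← Finset.add_sum_erase _ _ (Finset.mem_univ fun _ => false), face_zero_one_bisectCube,
    add_sub_cancel_left]
  refine Submodule.sum_mem _ fun e he => ?_
  obtain ⟨i, hi⟩ := Function.ne_iff.mp (Finset.ne_of_mem_erase he)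
  exact single_mem_D _ (isDegenerate_face_bisectCube σ e i (by simpa using hi)) k

/-- The boundary is separated into the deformation direction, whose end at parameter `0` is the
subdivision, and the directions of `σ`. -/
lemma bd_sdHomotopyQ_single {n : ℕ} (σ : Cl.Hom (Intv.unit.cube n) X) (k : ℤ) :
    bd Intv.unit n X (sdHomotopyQ n X (Finsupp.single σ k)) =
      (∑ e : Fin n → Bool,
        Finsupp.single (face Intv.unit 0 Intv.unit.onePt ((bisectCube e).comp σ)) k) -
      sdQ n X (Finsupp.single σ k) -
      ∑ i : Fin n, (-1 : ℤ) ^ (i + 1 : ℕ) • ∑ e : Fin n → Bool,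
        (Finsupp.single (face Intv.unit i.succ Intv.unit.zeroPt ((bisectCube e).comp σ)) k -
          Finsupp.single (face Intv.unit i.succ Intv.unit.onePt ((bisectCube e).comp σ)) k) := by
  rw [sdHomotopyQ_single, map_sum, sdQ_single]
  simp only [bd_single]
  rw [Finset.sum_comm, Fin.sum_univ_succ, sub_eq_add_neg (_ - _) (Finset.sum _ _),
    ← Finset.sum_neg_distrib]
  refine congrArg₂ (· + ·) ?_ (Finset.sum_congr rfl fun i _ => ?_)
  · simp only [face_zero_bisectCube, Fin.val_zero, zero_add, pow_one, neg_smul, one_smul, neg_sub,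
      Finset.sum_sub_distrib]
  · rw [← Finset.smul_sum, Fin.val_succ, pow_succ, mul_neg_one, neg_smul]

lemma sdHomotopyQ_zero (c : Q Intv.unit 0 X) :
    c - sdQ 0 X c - bd Intv.unit 0 X (sdHomotopyQ 0 X c) ∈ D Intv.unit 0 X := by
  induction c using Finsupp.induction_linear with
  | zero => simp only [map_zero, sub_zero]; exact zero_mem _
  | add f g hf hg =>
    convert add_mem hf hg using 1
    simp only [map_add]
    abel
  | single σ k =>
    rw [bd_sdHomotopyQ_single]
    convert neg_mem (sum_face_zero_bisectCube σ k) using 1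
    simp only [Finset.univ_eq_empty, Finset.sum_empty]
    abel

/-- The formula for a chain homotopy holds only modulo degenerate cubes: the end at parameter `1` is
the identity plus collapsed pieces. -/
lemma sdHomotopyQ_succ (n : ℕ) (c : Q Intv.unit (n + 1) X) :
    c - sdQ (n + 1) X c - (bd Intv.unit (n + 1) X (sdHomotopyQ (n + 1) X c) +
      sdHomotopyQ n X (bd Intv.unit n X c)) ∈ D Intv.unit (n + 1) X := by
  induction c using Finsupp.induction_linear with
  | zero => simp only [map_zero, sub_zero, add_zero]; exact zero_mem _
  | add f g hf hg =>
    convert add_mem hf hg using 1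
    simp only [map_add]
    abel
  | single σ k =>
    rw [bd_sdHomotopyQ_single]
    convert neg_mem (sum_face_zero_bisectCube σ k) using 1
    simp only [sum_face_succ_bisectCube]
    rw [bd_single]
    simp only [map_sum, map_smul, map_sub, sdHomotopyQ_single, Finset.sum_sub_distrib]
    abel

/-- The projection of a combination of cubes to the cubical chains. -/
noncomputable def mk (J : Intv) (n : ℕ) (X : Cl.{u}) :
    Q J n X →ₗ[ℤ] ((Theory.cubical.chains J).obj X).X n := Submodule.mkQ (D J n X)

lemma mk_surjective (J : Intv) (n : ℕ) (X : Cl.{u}) : Function.Surjective (mk J n X) :=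
  Submodule.mkQ_surjective _

lemma mk_eq_zero (J : Intv) {n : ℕ} {X : Cl.{u}} {c : Q J n X}
    (hc : c ∈ D J n X) : mk J n X c = 0 :=
  (Submodule.Quotient.mk_eq_zero _).mpr hc

lemma d_mk (J : Intv) (n : ℕ) {X : Cl.{u}} (c : Q J (n + 1) X) :
    ((Theory.cubical.chains J).obj X).d (n + 1) n (mk J (n + 1) X c) = mk J n X (bd J n X c) :=
  ConcreteCategory.congr_hom (cubeChains_d J X n) _

/-- The subdivision of cubical chains. -/
noncomputable def sd (n : ℕ) (X : Cl.{u}) : ((Theory.cubical.chains Intv.unit).obj X).X n →ₗ[ℤ]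
    ((Theory.cubical.chains Intv.unit).obj X).X n :=
  Submodule.mapQ (D Intv.unit n X) (D Intv.unit n X) (sdQ n X) (sdQ_D n X)

/-- The chain homotopy between the identity and the subdivision of cubical chains. -/
noncomputable def sdHomotopy (n : ℕ) (X : Cl.{u}) :
    ((Theory.cubical.chains Intv.unit).obj X).X n →ₗ[ℤ]
      ((Theory.cubical.chains Intv.unit).obj X).X (n + 1) :=
  Submodule.mapQ (D Intv.unit n X) (D Intv.unit (n + 1) X) (sdHomotopyQ n X) (sdHomotopyQ_D n X)

lemma sd_mk (n : ℕ) (c : Q Intv.unit n X) : sd n X (mk Intv.unit n X c) =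
    mk Intv.unit n X (sdQ n X c) := rfl

lemma sdHomotopy_mk (n : ℕ) (c : Q Intv.unit n X) :
    sdHomotopy n X (mk Intv.unit n X c) =
      mk Intv.unit (n + 1) X (sdHomotopyQ n X c) := rfl

lemma sd_map {Y Z : Cl.{u}} (f : Y ⟶ Z) (n : ℕ) (c : ((Theory.cubical.chains Intv.unit).obj Y).X n) :
    sd n Z (((Theory.cubical.chains Intv.unit).map f).f n c) =
      ((Theory.cubical.chains Intv.unit).map f).f n (sd n Y c) := by
  obtain ⟨c, rfl⟩ := mk_surjective Intv.unit n Y c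
  refine congrArg (mk Intv.unit n Z) (LinearMap.congr_fun
    (?_ : sdQ n Z ∘ₗ push Intv.unit n f = push Intv.unit n f ∘ₗ sdQ n Y) c)
  refine Finsupp.lhom_ext fun σ k => ?_
  simp only [push, LinearMap.comp_apply, Finsupp.lmapDomain_apply, Finsupp.mapDomain_single,
    sdQ_single, Finsupp.mapDomain_finsetSum]
  rfl

lemma sdHomotopy_map {Y Z : Cl.{u}} (f : Y ⟶ Z) (n : ℕ)
    (c : ((Theory.cubical.chains Intv.unit).obj Y).X n) :
    sdHomotopy n Z (((Theory.cubical.chains Intv.unit).map f).f n c) =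
      ((Theory.cubical.chains Intv.unit).map f).f (n + 1) (sdHomotopy n Y c) := by
  obtain ⟨c, rfl⟩ := mk_surjective Intv.unit n Y c
  refine congrArg (mk Intv.unit (n + 1) Z) (LinearMap.congr_fun
    (?_ : sdHomotopyQ n Z ∘ₗ push Intv.unit n f =
      push Intv.unit (n + 1) f ∘ₗ sdHomotopyQ n Y) c)
  refine Finsupp.lhom_ext fun σ k => ?_
  simp only [push, LinearMap.comp_apply, Finsupp.lmapDomain_apply, Finsupp.mapDomain_single,
    sdHomotopyQ_single, Finsupp.mapDomain_finsetSum]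
  rfl

/-- A map of cubes that contracts every coordinate by the factor `r`. -/
def Contracts {n : ℕ} (r : ℝ) (B : (Fin n → unitInterval) → Fin n → unitInterval) : Prop :=
  ∀ x y i, dist (B x i) (B y i) ≤ r * dist (x i) (y i)

/-- The span of the cubes that arise from `σ` by maps of cubes that contract every coordinate by
the factor `r`. -/
noncomputable def contracted {n : ℕ} (σ : Cl.Hom (Intv.unit.cube n) X) (r : ℝ) :
    Submodule ℤ (((Theory.cubical.chains Intv.unit).obj X).X n) :=
  Submodule.span ℤ {c | ∃ B : Cl.Hom (Intv.unit.cube n) (Intv.unit.cube n),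
    Contracts r B.toFun ∧ c = mk Intv.unit n X (Finsupp.single (B.comp σ) 1)}

lemma sd_mem_contracted {n : ℕ} (σ : Cl.Hom (Intv.unit.cube n) X) (r : ℝ)
    (c : ((Theory.cubical.chains Intv.unit).obj X).X n) (hc : c ∈ contracted σ r) :
    sd n X c ∈ contracted σ (r * (1 / 2)) := by
  induction hc using Submodule.span_induction with
  | zero => rw [map_zero]; exact zero_mem _
  | add a b _ _ ha hb => rw [map_add]; exact add_mem ha hb
  | smul k a _ ha => rw [LinearMap.map_smul]; exact Submodule.smul_mem _ k ha
  | mem c hc =>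
    obtain ⟨B, hB, rfl⟩ := hc
    rw [sd_mk, sdQ_single, map_sum]
    refine Submodule.sum_mem _ fun e _ => Submodule.subset_span ⟨(subcube e).comp B, ?_, rfl⟩
    intro x y i
    refine (hB (subcubeFun e x) (subcubeFun e y) i).trans ?_
    rw [subcubeFun, subcubeFun, dist_bisect_zero, mul_assoc]

lemma iterate_sd_mem_contracted {n : ℕ} (σ : Cl.Hom (Intv.unit.cube n) X) (N : ℕ) :
    (sd n X)^[N] (mk Intv.unit n X (Finsupp.single σ 1)) ∈
      contracted σ ((1 / 2) ^ N) := by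
  induction N with
  | zero =>
    refine Submodule.subset_span ⟨Cl.Hom.id _, fun x y i => ?_, rfl⟩
    rw [pow_zero, one_mul]
    rfl
  | succ N ih =>
    rw [Function.iterate_succ_apply', pow_succ]
    exact sd_mem_contracted σ _ _ ih

lemma Contracts.dist_lt {n : ℕ} {r δ : ℝ} {B : (Fin n → unitInterval) → Fin n → unitInterval}
    (hB : Contracts r B) (hr : 0 ≤ r) (hδ : r < δ) (x y : Fin n → unitInterval) :
    dist (B x) (B y) < δ := by
  refine lt_of_le_of_lt ((dist_pi_le_iff hr).mpr fun i =>
    (hB x y i).trans (mul_le_of_le_one_right hr ?_)) hδ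
  rw [Subtype.dist_eq]
  exact Real.dist_le_of_mem_Icc_01 (Subtype.prop _) (Subtype.prop _)

end Cube

/-- The two sets form an excisive couple if their interiors cover the space. -/
lemma Theory.isExcisive_cubical_unit {X : Cl.{u}} {U V : Set X}
    (hUV : ∀ x, x ∈ X.int U ∨ x ∈ X.int V) :
    Theory.cubical.IsExcisive Intv.unit X U V := by
  refine isExcisive_of_subdivision _ _ (fun n => Cube.sd n X) (fun n => Cube.sdHomotopy n X)
    (fun c => ?_) (fun n c => ?_) (fun n c hc => ?_) (fun n c hc => ?_) (fun n σ => ?_)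
  · obtain ⟨c, rfl⟩ := Cube.mk_surjective _ _ _ c
    rw [Cube.sdHomotopy_mk, Cube.sd_mk, Cube.d_mk, ← sub_eq_zero, ← map_sub, ← map_sub]
    exact Cube.mk_eq_zero _ (Cube.sdHomotopyQ_zero c)
  · obtain ⟨c, rfl⟩ := Cube.mk_surjective _ _ _ c
    rw [Cube.sdHomotopy_mk, Cube.sd_mk, Cube.d_mk, Cube.d_mk, Cube.sdHomotopy_mk,
      ← sub_eq_zero, ← map_sub, ← map_add, ← map_sub]
    exact Cube.mk_eq_zero _ (Cube.sdHomotopyQ_succ n c)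
  · exact Theory.cubical.map_mem_smallChains Intv.unit (fun Y => Cube.sd n Y)
      (fun f c => Cube.sd_map f n c) hc
  · exact Theory.cubical.map_mem_smallChains Intv.unit (fun Y => Cube.sdHomotopy n Y)
      (fun f c => Cube.sdHomotopy_map f n c) hc
  · obtain ⟨δ, hδ, h⟩ := exists_lebesgue_number (Z := Fin n → unitInterval) σ.toFun
      (fun z W hW => Cl.mem_nhds_of_mem_int_pi (Z := fun _ : Fin n => unitInterval)
        (Cl.Hom.preimage_nhd σ hW)) hUV
    -- After `N` bisections every piece lies within the Lebesgue number of the image of the origin,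
    -- since coordinate distances in the cube are at most `1`.
    obtain ⟨N, hN⟩ := exists_pow_lt_of_lt_one hδ (by norm_num : (1 / 2 : ℝ) < 1)
    refine ⟨N, ?_⟩
    refine Submodule.span_le.mpr ?_ (Cube.iterate_sd_mem_contracted σ N)
    rintro _ ⟨B, hB, rfl⟩
    have hB' := fun x => hB.dist_lt (by positivity) hN x fun _ => 0
    rcases h (B.toFun fun _ => (0 : unitInterval)) with h | h
    · exact Submodule.mem_sup_left (mk_single_mem_chainsIn Theory.cubical Intv.unit
        (Cl.Hom.comp B σ) (fun x => h _ (hB' x)) 1)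
    · exact Submodule.mem_sup_right (mk_single_mem_chainsIn Theory.cubical Intv.unit
        (Cl.Hom.comp B σ) (fun x => h _ (hB' x)) 1)

/-! ## Barycentric subdivision -/

/-- The topological simplex with its sup metric. -/
abbrev TopSimplex (n : ℕ) : Type := stdSimplex ℝ (Fin (n + 1))

namespace TopSimplex

variable {l m n : ℕ}

/-- The affine map of simplices with given values on the vertices. -/
noncomputable def aff (v : Fin (m + 1) → TopSimplex n) (x : TopSimplex m) : TopSimplex n :=
  ⟨∑ i, x.1 i • (v i).1, (convex_stdSimplex ℝ _).sum_mem (fun i _ => x.2.1 i) x.2.2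
    fun i _ => (v i).2⟩

lemma continuous_aff (v : Fin (m + 1) → TopSimplex n) : Continuous (aff v) :=
  Continuous.subtype_mk (continuous_finsetSum _ fun i _ =>
    ((continuous_apply i).comp continuous_subtype_val).smul continuous_const) _

lemma aff_aff (v : Fin (m + 1) → TopSimplex n) (w : Fin (l + 1) → TopSimplex m)
    (x : TopSimplex l) : aff v (aff w x) = aff (fun i => aff v (w i)) x := by
  refine Subtype.ext ?_
  simp only [aff, Finset.sum_apply, Pi.smul_apply, smul_eq_mul, Finset.sum_smul, Finset.smul_sum,
    smul_smul]
  exact Finset.sum_comm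

lemma aff_vertex (v : Fin (m + 1) → TopSimplex n) (i : Fin (m + 1)) :
    aff v (stdSimplex.vertex i) = v i := by
  refine Subtype.ext ?_
  simp only [aff]
  rw [Finset.sum_eq_single i (fun j _ hj => by simp [hj]) (by simp)]
  simp

lemma aff_vertices (x : TopSimplex n) : aff (fun i => stdSimplex.vertex i) x = x := by
  refine Subtype.ext (funext fun k => ?_)
  simp [aff, Pi.single_apply]

lemma map_eq_aff (f : Fin (m + 1) → Fin (n + 1)) (x : TopSimplex m) :
    stdSimplex.map f x = aff (fun i => stdSimplex.vertex (f i)) x := by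
  refine stdSimplex.ext (funext fun k => ?_)
  rw [stdSimplex.map_coe, FunOnFinite.linearMap_apply_apply]
  change _ = (∑ i, x.1 i • (stdSimplex.vertex (S := ℝ) (f i)).1) k
  rw [Finset.sum_filter, Finset.sum_apply]
  refine Finset.sum_congr rfl fun i _ => ?_
  by_cases h : f i = k
  · subst h
    simp
    rfl
  · simp [h, Ne.symm h]

/-- Closed balls are convex. -/
lemma dist_aff_le {p : TopSimplex n} {v : Fin (m + 1) → TopSimplex n} {r : ℝ}
    (h : ∀ i, dist p (v i) ≤ r) (x : TopSimplex m) : dist p (aff v x) ≤ r := by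
  rw [dist_comm]
  exact (convex_closedBall p.1 r).sum_mem (fun i _ => x.2.1 i) x.2.2 fun i _ => by
    rw [Metric.mem_closedBall, dist_comm]
    exact h i

/-- The barycenter of the vertices of an affine simplex. -/
noncomputable def center (v : Fin (m + 1) → TopSimplex n) : TopSimplex n :=
  aff v stdSimplex.barycenter

/-- The vector from `v i` to the center is the mean of the `m + 1` vectors `v j - v i`. The one with
`j = i` vanishes, which leaves the factor `m / (m + 1)`. -/
lemma dist_center_le {v : Fin (m + 1) → TopSimplex n} {r : ℝ}
    (h : ∀ i j, dist (v i) (v j) ≤ r) (i : Fin (m + 1)) :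
    dist (center v) (v i) ≤ m / (m + 1) * r := by
  have hb : ((center v).1 - (v i).1) = ((m : ℝ) + 1)⁻¹ • ∑ j, ((v j).1 - (v i).1) := by
    simp only [center, aff, stdSimplex.barycenter_apply, Fintype.card_fin, Finset.sum_sub_distrib,
      ← Finset.smul_sum, Finset.sum_const, Finset.card_univ, smul_sub, Nat.cast_add, Nat.cast_one]
    congr 1
    rw [← Nat.cast_smul_eq_nsmul ℝ, smul_smul, Nat.cast_add, Nat.cast_one, inv_mul_cancel₀
      (by positivity), one_smul]
  rw [Subtype.dist_eq, dist_eq_norm, hb, norm_smul, Real.norm_of_nonneg (by positivity),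
    Fin.sum_univ_succAbove _ i, sub_self, zero_add, div_eq_inv_mul, mul_assoc]
  refine mul_le_mul_of_nonneg_left ?_ (by positivity)
  refine (norm_sum_le _ _).trans ((Finset.sum_le_card_nsmul _ _ r fun j _ => ?_).trans ?_)
  · rw [← dist_eq_norm, ← Subtype.dist_eq]
    exact h _ _
  · simp

/-- The affine map as a map of closure spaces. -/
noncomputable def affHom (v : Fin (m + 1) → TopSimplex n) :
    Cl.Hom (Intv.unit.simplex m) (Intv.unit.simplex n) where
  toFun := aff v
  cont _ := image_closure_subset_closure_image (X := TopSimplex m) (Y := TopSimplex n)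
    (continuous_aff v)

lemma affHom_comp (v : Fin (m + 1) → TopSimplex n) (w : Fin (l + 1) → TopSimplex m) :
    (affHom w).comp (affHom v) = affHom fun i => aff v (w i) :=
  Cl.Hom.ext (funext fun x => aff_aff v w x)

lemma affHom_vertices : affHom (fun i : Fin (n + 1) => stdSimplex.vertex i) = Cl.Hom.id _ :=
  Cl.Hom.ext (funext fun x => aff_vertices x)

lemma simplexMap_comp_affHom (f : Fin (l + 1) →o Fin (m + 1)) (v : Fin (m + 1) → TopSimplex n) :
    (Intv.unit.simplexMap f).comp (affHom v) = affHom (v ∘ f) := by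
  refine Cl.Hom.ext (funext fun (x : TopSimplex l) => ?_)
  change aff v (stdSimplex.map f x) = aff (v ∘ f) x
  rw [map_eq_aff, aff_aff]
  simp only [aff_vertex]
  rfl

end TopSimplex

/-- The group of affine chains: combinations of sequences of `k` points of a simplex. -/
abbrev AffChains (n k : ℕ) : Type := (Fin k → TopSimplex n) →₀ ℤ

/-! ### Cones, subdivision and mesh of affine chains -/

namespace AffChains

open TopSimplex

variable {m n : ℕ}

/-- The boundary of affine chains. -/
noncomputable def bd (n k : ℕ) : AffChains n (k + 1) →ₗ[ℤ] AffChains n k :=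
  ∑ i : Fin (k + 1), (-1 : ℤ) ^ (i : ℕ) • Finsupp.lmapDomain ℤ ℤ fun v => v ∘ i.succAbove

lemma bd_single (k : ℕ) (v : Fin (k + 1) → TopSimplex n) (z : ℤ) :
    bd n k (Finsupp.single v z) =
      ∑ i : Fin (k + 1), (-1 : ℤ) ^ (i : ℕ) • Finsupp.single (v ∘ i.succAbove) z := by
  simp only [bd, LinearMap.sum_apply, LinearMap.smul_apply, Finsupp.lmapDomain_apply,
    Finsupp.mapDomain_single]

lemma bd_bd (k : ℕ) (c : AffChains n (k + 2)) : bd n k (bd n (k + 1) c) = 0 := by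
  have h := alternating_sum_comp_eq_zero
    (fun i : Fin (k + 1) => Finsupp.lmapDomain ℤ ℤ fun v : Fin (k + 1) → TopSimplex n =>
      v ∘ i.succAbove)
    (fun i : Fin (k + 2) => Finsupp.lmapDomain ℤ ℤ fun v : Fin (k + 2) → TopSimplex n =>
      v ∘ i.succAbove) (fun i j hij => by
      refine Finsupp.lhom_ext fun v z => ?_
      simp only [LinearMap.comp_apply, Finsupp.lmapDomain_apply, Finsupp.mapDomain_single]
      congr 1
      funext a
      simp only [Function.comp_apply]
      congr 1
      ext
      simp only [Fin.succAbove, Fin.lt_def, Fin.val_succ, Fin.val_castSucc, Fin.val_castLT]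
      split_ifs <;> simp_all <;> omega)
  -- The general lemma numbers the faces from `1`; the two resulting signs cancel in the composite.
  simp only [pow_succ, mul_neg_one, neg_smul, Finset.sum_neg_distrib] at h
  have h2 := LinearMap.congr_fun h c
  rw [LinearMap.neg_comp, LinearMap.comp_neg, neg_neg] at h2
  exact h2

/-- The cone over an affine chain. -/
noncomputable def cone (k : ℕ) (b : TopSimplex n) : AffChains n k →ₗ[ℤ] AffChains n (k + 1) :=
  Finsupp.lmapDomain ℤ ℤ fun v => Fin.cons (α := fun _ => TopSimplex n) b v

lemma cone_single (k : ℕ) (b : TopSimplex n) (v : Fin k → TopSimplex n) (z : ℤ) :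
    cone k b (Finsupp.single v z) =
      Finsupp.single (Fin.cons (α := fun _ => TopSimplex n) b v) z := by
  rw [cone, Finsupp.lmapDomain_apply, Finsupp.mapDomain_single]

/-- Deleting the apex gives back `c`, and deleting another vertex gives the cone over a face.
Degrees count points, so the empty sequence plays the part of the augmentation and dimension `0`
needs no exception. -/
lemma bd_cone_succ (k : ℕ) (b : TopSimplex n) (c : AffChains n (k + 1)) :
    bd n (k + 1) (cone (k + 1) b c) = c - cone k b (bd n k c) := by
  refine LinearMap.congr_fun
    (?_ : bd n (k + 1) ∘ₗ cone (k + 1) b = LinearMap.id - cone k b ∘ₗ bd n k) c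
  refine Finsupp.lhom_ext fun v z => ?_
  simp only [LinearMap.comp_apply, LinearMap.sub_apply, cone_single, bd_single,
    Fin.sum_univ_succ (n := k + 1), LinearMap.id_apply, map_sum, map_smul]
  rw [sub_eq_add_neg, ← Finset.sum_neg_distrib]
  refine congrArg₂ (· + ·) ?_ (Finset.sum_congr rfl fun i _ => ?_)
  · rw [Fin.val_zero, pow_zero, one_smul]
    rfl
  · rw [Fin.val_succ, pow_succ, mul_neg_one, neg_smul]
    congr 3
    funext a
    refine Fin.cases ?_ (fun a => ?_) a
    · simp
    · simp [Fin.succ_succAbove_succ]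

/-- The barycentric subdivision of affine chains. -/
noncomputable def sd (n : ℕ) : ∀ k, AffChains n k →ₗ[ℤ] AffChains n k
  | 0 => LinearMap.id
  | k + 1 => Finsupp.linearCombination ℤ fun v =>
      cone k (center v) (sd n k (bd n k (Finsupp.single v 1)))

/-- The homotopy between the identity and the barycentric subdivision. -/
noncomputable def sdHomotopy (n : ℕ) : ∀ k, AffChains n k →ₗ[ℤ] AffChains n (k + 1)
  | 0 => 0
  | k + 1 => Finsupp.linearCombination ℤ fun v =>
      cone (k + 1) (center v) (Finsupp.single v 1 - sdHomotopy n k (bd n k (Finsupp.single v 1)))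

lemma sd_single (k : ℕ) (v : Fin (k + 1) → TopSimplex n) :
    sd n (k + 1) (Finsupp.single v 1) =
      cone k (center v) (sd n k (bd n k (Finsupp.single v 1))) := by
  rw [sd, Finsupp.linearCombination_single, one_smul]

lemma sdHomotopy_single (k : ℕ) (v : Fin (k + 1) → TopSimplex n) :
    sdHomotopy n (k + 1) (Finsupp.single v 1) = cone (k + 1) (center v)
      (Finsupp.single v 1 - sdHomotopy n k (bd n k (Finsupp.single v 1))) := by
  rw [sdHomotopy, Finsupp.linearCombination_single, one_smul]

lemma linearMap_ext {S : Type v} {M : Type w} [AddCommGroup M] [Module ℤ M] {f g : (S →₀ ℤ) →ₗ[ℤ] M}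
    (h : ∀ s, f (Finsupp.single s 1) = g (Finsupp.single s 1)) : f = g :=
  Finsupp.lhom_ext' fun s => LinearMap.ext_ring (h s)

/-- Let `T` be the homotopy, so `T v` is the cone over `v - T ∂v`. The cone formula gives `∂T v = v
- T ∂v - cone (∂v - ∂T ∂v)`. By induction and `∂∂ = 0`, the chain `∂v - ∂T ∂v` is the subdivision of
`∂v`, and the cone over it is the subdivision of `v`. -/
lemma bd_sdHomotopy (k : ℕ) (c : AffChains n (k + 1)) :
    bd n (k + 1) (sdHomotopy n (k + 1) c) = c - sd n (k + 1) c - sdHomotopy n k (bd n k c) := by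
  refine LinearMap.congr_fun (?_ : bd n (k + 1) ∘ₗ sdHomotopy n (k + 1) =
    LinearMap.id - sd n (k + 1) - sdHomotopy n k ∘ₗ bd n k) c
  induction k with
  | zero =>
    refine linearMap_ext fun v => ?_
    simp only [LinearMap.comp_apply, LinearMap.sub_apply, LinearMap.id_apply]
    rw [sdHomotopy_single, bd_cone_succ, sd_single]
    simp only [sdHomotopy, LinearMap.zero_apply, sub_zero, sd, LinearMap.id_apply]
  | succ k ih =>
    refine linearMap_ext fun v => ?_
    simp only [LinearMap.comp_apply, LinearMap.sub_apply, LinearMap.id_apply]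
    have h := LinearMap.congr_fun (ih (bd n (k + 1) (Finsupp.single v 1)))
      (bd n (k + 1) (Finsupp.single v 1))
    simp only [LinearMap.comp_apply, LinearMap.sub_apply, LinearMap.id_apply, bd_bd, map_zero,
      sub_zero] at h
    rw [sdHomotopy_single, bd_cone_succ, sd_single, map_sub (bd n (k + 1)), h, sub_sub_cancel]
    abel

/-- The map of affine chains induced by an affine map. -/
noncomputable def push (w : Fin (m + 1) → TopSimplex n) (k : ℕ) :
    AffChains m k →ₗ[ℤ] AffChains n k :=
  Finsupp.lmapDomain ℤ ℤ fun v i => aff w (v i)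

lemma push_single (w : Fin (m + 1) → TopSimplex n) (k : ℕ) (v : Fin k → TopSimplex m) (z : ℤ) :
    push w k (Finsupp.single v z) = Finsupp.single (fun i => aff w (v i)) z := by
  rw [push, Finsupp.lmapDomain_apply, Finsupp.mapDomain_single]

lemma push_bd (w : Fin (m + 1) → TopSimplex n) (k : ℕ) (c : AffChains m (k + 1)) :
    push w k (bd m k c) = bd n k (push w (k + 1) c) := by
  refine LinearMap.congr_fun (?_ : push w k ∘ₗ bd m k = bd n k ∘ₗ push w (k + 1)) c
  refine linearMap_ext fun v => ?_
  simp only [LinearMap.comp_apply, bd_single, push_single, map_sum, map_smul]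
  rfl

lemma push_cone (w : Fin (m + 1) → TopSimplex n) (k : ℕ) (b : TopSimplex m) (c : AffChains m k) :
    push w (k + 1) (cone k b c) = cone k (aff w b) (push w k c) := by
  refine LinearMap.congr_fun
    (?_ : push w (k + 1) ∘ₗ cone k b = cone k (aff w b) ∘ₗ push w k) c
  refine linearMap_ext fun v => ?_
  simp only [LinearMap.comp_apply, cone_single, push_single]
  congr 1
  funext i
  refine Fin.cases ?_ (fun i => ?_) i <;> simp

lemma aff_center (w : Fin (m + 1) → TopSimplex n) {k : ℕ} (v : Fin (k + 1) → TopSimplex m) :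
    aff w (center v) = center fun i => aff w (v i) := aff_aff _ _ _

/-- Affine maps preserve faces, cones and barycenters, hence the recursion. This naturality extends
the subdivision from the identity simplex to all singular simplices. -/
lemma push_sd (w : Fin (m + 1) → TopSimplex n) (k : ℕ) (c : AffChains m k) :
    push w k (sd m k c) = sd n k (push w k c) := by
  refine LinearMap.congr_fun (?_ : push w k ∘ₗ sd m k = sd n k ∘ₗ push w k) c
  induction k with
  | zero => rfl
  | succ k ih =>
    refine linearMap_ext fun v => ?_
    rw [LinearMap.comp_apply, LinearMap.comp_apply, push_single, sd_single, sd_single, push_cone,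
      aff_center]
    have h := LinearMap.congr_fun (ih (bd m k (Finsupp.single v 1))) (bd m k (Finsupp.single v 1))
    rw [LinearMap.comp_apply, LinearMap.comp_apply] at h
    rw [h, push_bd, push_single]

lemma push_sdHomotopy (w : Fin (m + 1) → TopSimplex n) (k : ℕ) (c : AffChains m k) :
    push w (k + 1) (sdHomotopy m k c) = sdHomotopy n k (push w k c) := by
  refine LinearMap.congr_fun
    (?_ : push w (k + 1) ∘ₗ sdHomotopy m k = sdHomotopy n k ∘ₗ push w k) c
  induction k with
  | zero => exact LinearMap.ext fun _ => (push w 1).map_zero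
  | succ k ih =>
    refine linearMap_ext fun v => ?_
    rw [LinearMap.comp_apply, LinearMap.comp_apply, push_single, sdHomotopy_single,
      sdHomotopy_single, push_cone, aff_center, map_sub, push_single]
    have h := LinearMap.congr_fun (ih (bd m k (Finsupp.single v 1))) (bd m k (Finsupp.single v 1))
    rw [LinearMap.comp_apply, LinearMap.comp_apply] at h
    rw [h, push_bd, push_single]

/-- The points of `w` lie in every ball that contains the points of `v`. -/
def InHull {k l : ℕ} (v : Fin k → TopSimplex n) (w : Fin l → TopSimplex n) : Prop :=
  ∀ p r, (∀ i, dist p (v i) ≤ r) → ∀ j, dist p (w j) ≤ r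

/-- The points of `v` have pairwise distance at most `r`. -/
def Mesh {k : ℕ} (r : ℝ) (v : Fin k → TopSimplex n) : Prop := ∀ i j, dist (v i) (v j) ≤ r

/-- Edges of the subdivision either lie in the subdivision of a face, where induction applies, or
issue from the center. The latter are bounded by the distance from the center to the vertices of
`v`, because the new points lie in the hull. Describing the hull by balls suffices for this. -/
lemma sd_single_mem_span (q : ℝ) (k : ℕ) (hk : ∀ j : ℕ, j < k → (j : ℝ) / (j + 1) ≤ q)
    (v : Fin k → TopSimplex n) : sd n k (Finsupp.single v 1) ∈
      Submodule.span ℤ {c | ∃ w : Fin k → TopSimplex n, InHull v w ∧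
        (∀ r, 0 ≤ r → Mesh r v → Mesh (q * r) w) ∧ c = Finsupp.single w 1} := by
  induction k with
  | zero =>
    exact Submodule.subset_span ⟨v, fun p r _ j => j.elim0, fun _ _ _ j => j.elim0, rfl⟩
  | succ k ih =>
    rw [sd_single, bd_single]
    simp only [map_sum, map_smul]
    refine Submodule.sum_mem _ fun i _ => Submodule.smul_mem _ _ ?_
    refine Submodule.span_induction (p := fun c _ => cone k (center v) c ∈ _) ?_ ?_ ?_ ?_
      (ih (fun j hj => hk j (by omega)) (v ∘ i.succAbove))
    · rintro _ ⟨w, hw, hm, rfl⟩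
      rw [cone_single]
      have hw' : InHull v w := fun p r h => hw p r fun j => h _
      refine Submodule.subset_span ⟨_, ?_, ?_, rfl⟩
      · intro p r h j
        refine Fin.cases ?_ (fun j => ?_) j
        · exact dist_aff_le h _
        · exact hw' p r h j
      · intro r hr hv
        -- The hull condition is applied to the ball of radius `q * r` about the center.
        have hc : ∀ j, dist (center v) (w j) ≤ q * r := hw' _ _ fun j =>
          (dist_center_le hv j).trans (mul_le_mul_of_nonneg_right (hk k (by omega)) hr)
        have hq0 : 0 ≤ q * r := mul_nonneg (le_trans (by positivity) (hk k (by omega))) hr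
        intro a b
        refine Fin.cases ?_ (fun a => ?_) a <;> refine Fin.cases ?_ (fun b => ?_) b
        · simpa using hq0
        · simpa using hc b
        · simpa [dist_comm] using hc a
        · exact hm r hr (fun _ _ => hv _ _) a b
    · rw [map_zero]; exact zero_mem _
    · intro a b _ _ ha hb
      rw [map_add]
      exact add_mem ha hb
    · intro z a _ ha
      rw [map_smul]
      exact Submodule.smul_mem _ z ha

/-- The affine chains that are combinations of sequences of mesh at most `r`. -/
noncomputable def meshSpan (n k : ℕ) (r : ℝ) : Submodule ℤ (AffChains n k) :=
  Submodule.span ℤ {c | ∃ w : Fin k → TopSimplex n, Mesh r w ∧ c = Finsupp.single w 1}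

lemma sd_mem_meshSpan {q : ℝ} {k : ℕ} (hk : ∀ j : ℕ, j < k → (j : ℝ) / (j + 1) ≤ q)
    {r : ℝ} (hr : 0 ≤ r) {c : AffChains n k} (hc : c ∈ meshSpan n k r) :
    sd n k c ∈ meshSpan n k (q * r) := by
  induction hc using Submodule.span_induction with
  | zero => rw [map_zero]; exact zero_mem _
  | add a b _ _ ha hb => rw [map_add]; exact add_mem ha hb
  | smul z a _ ha => rw [map_smul]; exact Submodule.smul_mem _ z ha
  | mem c hc =>
    obtain ⟨v, hv, rfl⟩ := hc
    refine Submodule.span_mono ?_ (sd_single_mem_span q k hk v)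
    rintro _ ⟨w, -, hw, rfl⟩
    exact ⟨w, hw r hr hv, rfl⟩

end AffChains

/-! ## Subdivision of singular simplices -/

namespace Simp

open TopSimplex

/-- The group of singular simplicial chains. -/
noncomputable abbrev C (J : Intv) (n : ℕ) (X : Cl.{u}) : ModuleCat.{u} ℤ :=
  ((Theory.simplicial.chains J).obj X).X n

/-- The identification of combinations of singular simplices with chains. -/
noncomputable def mk (J : Intv) (n : ℕ) (X : Cl.{u}) :
    (Cl.Hom (J.simplex n) X →₀ ℤ) →ₗ[ℤ] C J n X := LinearMap.id

/-- The face of a singular simplex opposite to the vertex `i`. -/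
noncomputable def face (J : Intv) {n : ℕ} {X : Cl.{u}} (i : Fin (n + 2))
    (σ : Cl.Hom (J.simplex (n + 1)) X) : Cl.Hom (J.simplex n) X :=
  (J.simplexMap i.succAboveOrderEmb.toOrderHom).comp σ

lemma d_mk (J : Intv) (n : ℕ) {X : Cl.{u}} (c : Cl.Hom (J.simplex (n + 1)) X →₀ ℤ) :
    ((Theory.simplicial.chains J).obj X).d (n + 1) n (mk J (n + 1) X c) =
      ∑ i : Fin (n + 2), (-1 : ℤ) ^ (i : ℕ) • mk J n X (Finsupp.mapDomain (face J i) c) := by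
  have h : ((Theory.simplicial.chains J).obj X).d (n + 1) n =
      ∑ i : Fin (n + 2), (-1 : ℤ) ^ (i : ℕ) • freeZ.map (((clNerve J).obj X).δ i) :=
    AlgebraicTopology.AlternatingFaceMapComplex.obj_d_eq _ n
  refine (ConcreteCategory.congr_hom h _).trans ?_
  exact (LinearMap.congr_fun (ModuleCat.hom_sum (fun i : Fin (n + 2) =>
    (-1 : ℤ) ^ (i : ℕ) • freeZ.map (((clNerve J).obj X).δ i)) Finset.univ) c).trans
    (LinearMap.sum_apply _ _ _)

lemma d_mk_single (J : Intv) (n : ℕ) {X : Cl.{u}} (σ : Cl.Hom (J.simplex (n + 1)) X) (z : ℤ) :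
    ((Theory.simplicial.chains J).obj X).d (n + 1) n (mk J (n + 1) X (Finsupp.single σ z)) =
      ∑ i : Fin (n + 2), (-1 : ℤ) ^ (i : ℕ) • mk J n X (Finsupp.single (face J i σ) z) := by
  rw [d_mk]
  simp only [Finsupp.mapDomain_single]

lemma map_mk_single (J : Intv) (n : ℕ) {X Y : Cl.{u}} (f : X ⟶ Y) (σ : Cl.Hom (J.simplex n) X)
    (z : ℤ) : ((Theory.simplicial.chains J).map f).f n (mk J n X (Finsupp.single σ z)) =
      mk J n Y (Finsupp.single (σ.comp f) z) :=
  Finsupp.mapDomain_single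

variable {X : Cl.{u}} {m n : ℕ}

/-- The singular chain in `X` obtained from an affine chain in a simplex and a singular simplex. -/
noncomputable def real (σ : Cl.Hom (Intv.unit.simplex n) X) (k : ℕ) :
    AffChains n (k + 1) →ₗ[ℤ] C Intv.unit k X :=
  mk Intv.unit k X ∘ₗ Finsupp.lmapDomain ℤ ℤ fun v => (affHom v).comp σ

lemma real_single (σ : Cl.Hom (Intv.unit.simplex n) X) (k : ℕ) (v : Fin (k + 1) → TopSimplex n)
    (z : ℤ) : real σ k (Finsupp.single v z) =
      mk Intv.unit k X (Finsupp.single ((affHom v).comp σ) z) := by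
  rw [real, LinearMap.comp_apply, Finsupp.lmapDomain_apply, Finsupp.mapDomain_single]

lemma d_real (σ : Cl.Hom (Intv.unit.simplex n) X) (k : ℕ) (c : AffChains n (k + 2)) :
    ((Theory.simplicial.chains Intv.unit).obj X).d (k + 1) k (real σ (k + 1) c) =
      real σ k (AffChains.bd n (k + 1) c) := by
  refine LinearMap.congr_fun
    (?_ : (((Theory.simplicial.chains Intv.unit).obj X).d (k + 1) k).hom ∘ₗ real σ (k + 1) =
      real σ k ∘ₗ AffChains.bd n (k + 1)) c
  refine AffChains.linearMap_ext fun v => ?_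
  rw [LinearMap.comp_apply, LinearMap.comp_apply, real_single, AffChains.bd_single, map_sum]
  refine (d_mk_single _ _ _ _).trans (Finset.sum_congr rfl fun i _ => ?_)
  rw [map_zsmul, real_single, face]
  congr 3
  exact congrArg (Cl.Hom.comp · σ) (simplexMap_comp_affHom _ v)

lemma real_push (σ : Cl.Hom (Intv.unit.simplex n) X) (w : Fin (m + 1) → TopSimplex n) (k : ℕ)
    (c : AffChains m (k + 1)) :
    real σ k (AffChains.push w (k + 1) c) = real ((affHom w).comp σ) k c := by
  refine LinearMap.congr_fun
    (?_ : real σ k ∘ₗ AffChains.push w (k + 1) = real ((affHom w).comp σ) k) c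
  refine AffChains.linearMap_ext fun v => ?_
  rw [LinearMap.comp_apply, AffChains.push_single, real_single, real_single]
  congr 2
  exact congrArg (Cl.Hom.comp · σ) (affHom_comp w v).symm

lemma map_real {Y : Cl.{u}} (f : X ⟶ Y) (σ : Cl.Hom (Intv.unit.simplex n) X) (k : ℕ)
    (c : AffChains n (k + 1)) :
    ((Theory.simplicial.chains Intv.unit).map f).f k (real σ k c) = real (σ.comp f) k c := by
  refine LinearMap.congr_fun
    (?_ : (((Theory.simplicial.chains Intv.unit).map f).f k).hom ∘ₗ real σ k =
      real (σ.comp f) k) c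
  refine AffChains.linearMap_ext fun v => ?_
  rw [LinearMap.comp_apply, real_single, real_single]
  exact map_mk_single _ _ _ _ _

/-- The identity simplex as an affine chain. -/
noncomputable def iota (n : ℕ) : AffChains n (n + 1) :=
  Finsupp.single (fun i => stdSimplex.vertex i) 1

lemma push_iota (w : Fin (m + 1) → TopSimplex n) :
    AffChains.push w (m + 1) (iota m) = Finsupp.single w 1 := by
  rw [iota, AffChains.push_single]
  simp only [aff_vertex]

lemma real_iota (σ : Cl.Hom (Intv.unit.simplex n) X) :
    real σ n (iota n) = mk Intv.unit n X (Finsupp.single σ 1) := by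
  rw [iota, real_single, affHom_vertices]
  rfl

/-- The extension of a function on singular simplices to chains. -/
noncomputable def lift {J : Intv} {M : Type u} [AddCommGroup M] [Module ℤ M]
    (f : Cl.Hom (J.simplex n) X → M) : C J n X →ₗ[ℤ] M :=
  Finsupp.linearCombination ℤ f

lemma lift_mk_single {J : Intv} {M : Type u} [AddCommGroup M] [Module ℤ M]
    (f : Cl.Hom (J.simplex n) X → M) (σ : Cl.Hom (J.simplex n) X) :
    lift f (mk J n X (Finsupp.single σ 1)) = f σ :=
  (Finsupp.linearCombination_single ℤ _ _).trans (‹Module ℤ M›.one_smul (f σ))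

lemma linearMap_ext {J : Intv} {M : Type v} [AddCommGroup M] [Module ℤ M] {f g : C J n X →ₗ[ℤ] M}
    (h : ∀ σ, f (mk J n X (Finsupp.single σ 1)) = g (mk J n X (Finsupp.single σ 1))) : f = g :=
  AffChains.linearMap_ext h

/-- The barycentric subdivision of singular chains. -/
noncomputable def sd (n : ℕ) (X : Cl.{u}) : C Intv.unit n X →ₗ[ℤ] C Intv.unit n X :=
  lift fun σ => real σ n (AffChains.sd n (n + 1) (iota n))

/-- The chain homotopy between the identity and the barycentric subdivision. -/
noncomputable def sdHomotopy (n : ℕ) (X : Cl.{u}) : C Intv.unit n X →ₗ[ℤ] C Intv.unit (n + 1) X :=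
  lift fun σ => real σ (n + 1) (AffChains.sdHomotopy n (n + 1) (iota n))

/-- The singular operator is defined through the identity simplex alone; naturality makes it agree
with affine subdivision on all affine chains. Iterates can therefore be computed inside one simplex.
-/
lemma sd_real (σ : Cl.Hom (Intv.unit.simplex n) X) (k : ℕ) (c : AffChains n (k + 1)) :
    sd k X (real σ k c) = real σ k (AffChains.sd n (k + 1) c) := by
  refine LinearMap.congr_fun
    (?_ : sd k X ∘ₗ real σ k = real σ k ∘ₗ AffChains.sd n (k + 1)) c
  refine AffChains.linearMap_ext fun v => ?_
  rw [LinearMap.comp_apply, LinearMap.comp_apply, real_single, sd, lift_mk_single, ← real_push,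
    AffChains.push_sd, push_iota]

lemma sdHomotopy_real (σ : Cl.Hom (Intv.unit.simplex n) X) (k : ℕ) (c : AffChains n (k + 1)) :
    sdHomotopy k X (real σ k c) = real σ (k + 1) (AffChains.sdHomotopy n (k + 1) c) := by
  refine LinearMap.congr_fun
    (?_ : sdHomotopy k X ∘ₗ real σ k = real σ (k + 1) ∘ₗ AffChains.sdHomotopy n (k + 1)) c
  refine AffChains.linearMap_ext fun v => ?_
  rw [LinearMap.comp_apply, LinearMap.comp_apply, real_single, sdHomotopy, lift_mk_single,
    ← real_push, AffChains.push_sdHomotopy, push_iota]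

lemma sub_sd_zero (c : C Intv.unit 0 X) :
    c - sd 0 X c = ((Theory.simplicial.chains Intv.unit).obj X).d 1 0 (sdHomotopy 0 X c) := by
  refine LinearMap.congr_fun (?_ : LinearMap.id - sd 0 X =
    (((Theory.simplicial.chains Intv.unit).obj X).d 1 0).hom ∘ₗ sdHomotopy 0 X) c
  refine linearMap_ext fun σ => ?_
  rw [← real_iota, LinearMap.sub_apply, LinearMap.comp_apply, sd_real, sdHomotopy_real,
    LinearMap.id_apply]
  refine Eq.trans ?_ (d_real _ _ _).symm
  rw [AffChains.bd_sdHomotopy, map_sub, map_sub]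
  -- The homotopy on the empty sequence is zero, so no boundary term survives in dimension `0`.
  simp only [AffChains.sdHomotopy, LinearMap.zero_apply, map_zero, sub_zero]

lemma sub_sd_succ (n : ℕ) (c : C Intv.unit (n + 1) X) :
    c - sd (n + 1) X c =
      ((Theory.simplicial.chains Intv.unit).obj X).d (n + 2) (n + 1) (sdHomotopy (n + 1) X c) +
      sdHomotopy n X (((Theory.simplicial.chains Intv.unit).obj X).d (n + 1) n c) := by
  refine LinearMap.congr_fun (?_ : LinearMap.id - sd (n + 1) X =
    (((Theory.simplicial.chains Intv.unit).obj X).d (n + 2) (n + 1)).hom ∘ₗ sdHomotopy (n + 1) X +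
      sdHomotopy n X ∘ₗ (((Theory.simplicial.chains Intv.unit).obj X).d (n + 1) n).hom) c
  refine linearMap_ext fun σ => ?_
  rw [← real_iota, LinearMap.sub_apply, LinearMap.add_apply, LinearMap.comp_apply,
    LinearMap.comp_apply, sd_real, sdHomotopy_real, LinearMap.id_apply]
  refine Eq.trans ?_ (congrArg₂ (· + ·) (d_real _ _ _).symm
    (congrArg (sdHomotopy n X) (d_real _ _ _).symm))
  rw [sdHomotopy_real, AffChains.bd_sdHomotopy, map_sub, map_sub]
  abel

lemma sd_map {Y Z : Cl.{u}} (f : Y ⟶ Z) (n : ℕ) (c : C Intv.unit n Y) :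
    sd n Z (((Theory.simplicial.chains Intv.unit).map f).f n c) =
      ((Theory.simplicial.chains Intv.unit).map f).f n (sd n Y c) := by
  refine LinearMap.congr_fun
    (?_ : sd n Z ∘ₗ (((Theory.simplicial.chains Intv.unit).map f).f n).hom =
      (((Theory.simplicial.chains Intv.unit).map f).f n).hom ∘ₗ sd n Y) c
  refine linearMap_ext fun σ => ?_
  rw [← real_iota, LinearMap.comp_apply, LinearMap.comp_apply, sd_real]
  refine (congrArg (sd n Z) (map_real _ _ _ _)).trans (Eq.trans ?_ (map_real _ _ _ _).symm)
  rw [sd_real]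

lemma sdHomotopy_map {Y Z : Cl.{u}} (f : Y ⟶ Z) (n : ℕ) (c : C Intv.unit n Y) :
    sdHomotopy n Z (((Theory.simplicial.chains Intv.unit).map f).f n c) =
      ((Theory.simplicial.chains Intv.unit).map f).f (n + 1) (sdHomotopy n Y c) := by
  refine LinearMap.congr_fun
    (?_ : sdHomotopy n Z ∘ₗ (((Theory.simplicial.chains Intv.unit).map f).f n).hom =
      (((Theory.simplicial.chains Intv.unit).map f).f (n + 1)).hom ∘ₗ sdHomotopy n Y) c
  refine linearMap_ext fun σ => ?_
  rw [← real_iota, LinearMap.comp_apply, LinearMap.comp_apply, sdHomotopy_real]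
  refine (congrArg (sdHomotopy n Z) (map_real _ _ _ _)).trans (Eq.trans ?_ (map_real _ _ _ _).symm)
  rw [sdHomotopy_real]

/-- The iterates remain realizations of affine chains, and each step multiplies the mesh bound by `n
/ (n + 1)`. -/
lemma iterate_sd (σ : Cl.Hom (Intv.unit.simplex n) X) (N : ℕ) :
    ∃ c ∈ AffChains.meshSpan n (n + 1) ((n / (n + 1) : ℝ) ^ N),
      (sd n X)^[N] (mk Intv.unit n X (Finsupp.single σ 1)) = real σ n c := by
  induction N with
  | zero =>
    refine ⟨iota n, Submodule.subset_span ⟨_, fun i j => ?_, rfl⟩, (real_iota σ).symm⟩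
    rw [pow_zero, Subtype.dist_eq]
    -- The initial mesh is at most `1`, the bound on the diameter of the simplex in the sup metric.
    exact (Metric.dist_le_diam_of_mem (bounded_stdSimplex _) (Subtype.prop _)
      (Subtype.prop _)).trans diam_stdSimplex_le
  | succ N ih =>
    obtain ⟨c, hc, h⟩ := ih
    refine ⟨AffChains.sd n (n + 1) c, ?_, ?_⟩
    · rw [pow_succ']
      refine AffChains.sd_mem_meshSpan (fun j hj => ?_) (by positivity) hc
      -- The ratio `j / (j + 1)` increases with `j`, so that of the top dimension bounds those of
      -- all faces.
      rw [div_le_div_iff₀ (by positivity) (by positivity)]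
      have : (j : ℝ) ≤ n := by exact_mod_cast Nat.lt_succ_iff.mp hj
      linarith
    · rw [Function.iterate_succ_apply', h, sd_real]

end Simp

/-- Repeated barycentric subdivision brings the mesh below the Lebesgue number of the pulled back
cover. -/
lemma Theory.isExcisive_simplicial_unit {X : Cl.{u}} {U V : Set X}
    (hUV : ∀ x, x ∈ X.int U ∨ x ∈ X.int V) :
    Theory.simplicial.IsExcisive Intv.unit X U V := by
  refine isExcisive_of_subdivision _ _ (fun n => Simp.sd n X) (fun n => Simp.sdHomotopy n X)
    Simp.sub_sd_zero Simp.sub_sd_succ (fun n c hc => ?_) (fun n c hc => ?_)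
    (fun n (σ : Cl.Hom (Intv.unit.simplex n) X) => ?_)
  · exact Theory.simplicial.map_mem_smallChains Intv.unit (fun Y => Simp.sd n Y)
      (fun f c => Simp.sd_map f n c) hc
  · exact Theory.simplicial.map_mem_smallChains Intv.unit (fun Y => Simp.sdHomotopy n Y)
      (fun f c => Simp.sdHomotopy_map f n c) hc
  · obtain ⟨δ, hδ, h⟩ := exists_lebesgue_number (Z := TopSimplex n) σ.toFun
      (fun z W hW => by
        have h1 := Cl.Hom.preimage_nhd σ hW
        rw [← mem_interior_iff_mem_nhds, ← Cl.int_ofTop]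
        exact h1) hUV
    obtain ⟨N, hN⟩ := exists_pow_lt_of_lt_one hδ (y := (n / (n + 1) : ℝ))
      ((div_lt_one (by positivity)).mpr (by linarith))
    refine ⟨N, ?_⟩
    obtain ⟨c, hc, e⟩ := Simp.iterate_sd σ N
    suffices h : Simp.real σ n c ∈ Theory.simplicial.smallChains Intv.unit X U V n from e ▸ h
    refine Submodule.span_le (p := (Theory.simplicial.smallChains Intv.unit X U V n).comap
      (Simp.real σ n)) |>.mpr ?_ hc
    rintro _ ⟨w, hw, rfl⟩
    change Simp.real σ n (Finsupp.single w 1) ∈ Theory.simplicial.smallChains Intv.unit X U V n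
    rw [Simp.real_single]
    -- An affine simplex of small mesh lies in a small ball about its first vertex.
    have hw' : ∀ x, dist (TopSimplex.aff w x) (w 0) < δ := fun x => by
      rw [dist_comm]
      exact lt_of_le_of_lt (TopSimplex.dist_aff_le (hw 0) x) hN
    rcases h (w 0) with h | h
    · exact Submodule.mem_sup_left (mk_single_mem_chainsIn Theory.simplicial Intv.unit
        (Cl.Hom.comp (TopSimplex.affHom w) σ) (fun x => h _ (hw' x)) 1)
    · exact Submodule.mem_sup_right (mk_single_mem_chainsIn Theory.simplicial Intv.unit
        (Cl.Hom.comp (TopSimplex.affHom w) σ) (fun x => h _ (hw' x)) 1)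

namespace Theory

variable (T : Theory)

/-- Excision for a neighborhood of `A` and the complement of `A`. -/
lemma isExcisive_of_isNhd (J : Intv) {X : Cl.{u}} {A B : Set X} (hAB : X.IsNhd B A)
    (hA : J ≠ Intv.one → X.Closed A) : T.IsExcisive J X B Aᶜ := by
  cases J with
  | unit =>
    have h : ∀ x, x ∈ X.int B ∨ x ∈ X.int Aᶜ := fun x => by
      by_cases hx : x ∈ A
      · exact Or.inl (hAB hx)
      · refine Or.inr ?_
        -- Closedness makes `Aᶜ` its own interior, so the two interiors cover `X`.
        rw [Cl.int, compl_compl, hA (by simp)]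
        exact hx
    cases T
    exacts [isExcisive_simplicial_unit h, isExcisive_cubical_unit h]
  | plus => exact T.isExcisive_plus hAB (hA (by simp))
  | one => exact T.isExcisive_one hAB

end Theory

/-! ## Subspaces and quotients of closure spaces -/

namespace Cl

lemma int_mono (X : Cl.{u}) {S T : Set X} (h : S ⊆ T) : X.int S ⊆ X.int T :=
  Set.compl_subset_compl.mpr (X.cl_mono (Set.compl_subset_compl.mpr h))

lemma isIso_of_bijective {X Y : Cl.{u}} (f : X ⟶ Y) (hf : Function.Bijective (Hom.toFun f))
    (h : ∀ S, Y.cl (Hom.toFun f '' S) ⊆ Hom.toFun f '' X.cl S) : IsIso f := by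
  obtain ⟨g, hg, hg'⟩ := Function.bijective_iff_has_inverse.mp hf
  refine ⟨⟨⟨g, fun S => ?_⟩, Hom.ext (funext hg), Hom.ext (funext hg')⟩⟩
  rintro _ ⟨y, hy, rfl⟩
  rw [← hg'.image_image S] at hy
  obtain ⟨x, hx, rfl⟩ := h _ hy
  rwa [hg x]

lemma isIso_restr {X Y : Cl.{u}} (f : X ⟶ Y) [IsIso f] {A : Set X} {B : Set Y}
    (h : Set.MapsTo (Hom.toFun f) A B) (h' : ∀ x, Hom.toFun f x ∈ B → x ∈ A) :
    IsIso (restr f h) := by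
  have e₁ : ∀ x, Hom.toFun (inv f) (Hom.toFun f x) = x := fun x =>
    congrArg (fun g : X ⟶ X => Hom.toFun g x) (IsIso.hom_inv_id f)
  have e₂ : ∀ y, Hom.toFun f (Hom.toFun (inv f) y) = y := fun y =>
    congrArg (fun g : Y ⟶ Y => Hom.toFun g y) (IsIso.inv_hom_id f)
  have hg : Set.MapsTo (Hom.toFun (inv f)) B A := fun y hy => h' _ (by rwa [e₂])
  exact ⟨⟨restr (inv f) hg, Hom.ext (funext fun x => Subtype.ext (e₁ x.1)),
    Hom.ext (funext fun y => Subtype.ext (e₂ y.1))⟩⟩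

/-- The subspace `A` of the subspace `B` is the subspace `A`. -/
lemma isIso_restr_incl (X : Cl.{u}) {A B : Set X} (hAB : A ⊆ B)
    (h : Set.MapsTo (Hom.toFun (X.incl B)) (Subtype.val ⁻¹' A) A) :
    IsIso (restr (X.incl B) h) := by
  refine isIso_of_bijective _ ⟨fun a b e => ?_, fun a => ⟨⟨⟨a.1, hAB a.2⟩, a.2⟩, rfl⟩⟩ fun S => ?_
  · exact Subtype.ext (Subtype.ext (congrArg (fun c : X.sub A => c.1) e))
  · intro a ha
    refine ⟨⟨⟨a.1, hAB a.2⟩, a.2⟩, X.cl_mono ?_ ha, rfl⟩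
    rintro _ ⟨_, ⟨b, hb, rfl⟩, rfl⟩
    exact ⟨_, ⟨b, hb, rfl⟩, rfl⟩

section Quotient

variable {X : Cl.{u}} {A : Set X}

lemma quotMap_surjective (X : Cl.{u}) (A : Set X) :
    Function.Surjective (Hom.toFun (X.quotMap A)) := Quotient.exists_rep

lemma quotMap_eq_iff {x y : X} : Hom.toFun (X.quotMap A) x = Hom.toFun (X.quotMap A) y ↔
    x = y ∨ x ∈ A ∧ y ∈ A := Quotient.eq

lemma quotMap_mem_quotImage {x : X} : Hom.toFun (X.quotMap A) x ∈ X.quotImage A ↔ x ∈ A := by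
  refine ⟨?_, fun h => ⟨x, h, rfl⟩⟩
  rintro ⟨a, ha, e⟩
  rcases quotMap_eq_iff.mp e with rfl | h
  exacts [ha, h.2]

lemma mem_quotMap_image_iff {B : Set X} (hAB : A ⊆ B) {x : X} :
    Hom.toFun (X.quotMap A) x ∈ Hom.toFun (X.quotMap A) '' B ↔ x ∈ B := by
  refine ⟨?_, fun h => ⟨x, h, rfl⟩⟩
  rintro ⟨b, hb, e⟩
  rcases quotMap_eq_iff.mp e with rfl | h
  exacts [hb, hAB h.2]

lemma mem_int_quot {x : X} {V : Set (X.quot A)} : Hom.toFun (X.quotMap A) x ∈ (X.quot A).int V ↔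
    ∀ y, Hom.toFun (X.quotMap A) y = Hom.toFun (X.quotMap A) x →
      y ∈ X.int (Hom.toFun (X.quotMap A) ⁻¹' V) :=
  ⟨fun h y e hy => h ⟨y, hy, e⟩, fun h ⟨y, hy, e⟩ => h y e hy⟩

lemma quotImage_subsingleton (X : Cl.{u}) (A : Set X) : (X.quotImage A).Subsingleton := by
  rintro _ ⟨a, ha, rfl⟩ _ ⟨b, hb, rfl⟩
  exact quotMap_eq_iff.mpr (Or.inr ⟨ha, hb⟩)

lemma Closed.quotImage (h : X.Closed A) : (X.quot A).Closed (X.quotImage A) := by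
  refine Set.Subset.antisymm ?_ ((X.quot A).subset_cl _)
  have e : Hom.toFun (X.quotMap A) ⁻¹' X.quotImage A = A :=
    Set.ext fun x => quotMap_mem_quotImage
  change Hom.toFun (X.quotMap A) '' X.cl (Hom.toFun (X.quotMap A) ⁻¹' X.quotImage A) ⊆ _
  rw [e, h]
  exact subset_rfl

/-- The fibre over the collapsed point is `A`, and `B` is a neighborhood of all its points. -/
lemma IsNhd.quotImage {B : Set X} (h : X.IsNhd B A) :
    (X.quot A).IsNhd (Hom.toFun (X.quotMap A) '' B) (X.quotImage A) := by
  rintro _ ⟨a, ha, rfl⟩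
  refine mem_int_quot.mpr fun y hy => X.int_mono (Set.subset_preimage_image _ B) (h ?_)
  rcases quotMap_eq_iff.mp hy with rfl | h'
  exacts [ha, h'.1]

/-- A continuous map that is constant on `A` descends to `X / A`. -/
def quotDesc {Z : Cl.{u}} (f : X ⟶ Z) (h : ∀ a ∈ A, ∀ b ∈ A, Hom.toFun f a = Hom.toFun f b) :
    X.quot A ⟶ Z where
  toFun := Quotient.lift (Hom.toFun f) (by
    rintro a b (rfl | ⟨ha, hb⟩)
    exacts [rfl, h a ha b hb])
  cont S := by
    rintro _ ⟨_, ⟨x, hx, rfl⟩, rfl⟩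
    refine Z.cl_mono ?_ (Hom.cont f _ ⟨x, hx, rfl⟩)
    rintro _ ⟨y, hy, rfl⟩
    exact ⟨_, hy, rfl⟩

/-- Away from `A` the quotient map is an isomorphism. -/
lemma isIso_restr_quotMap_compl
    (h : Set.MapsTo (Hom.toFun (X.quotMap A)) Aᶜ (X.quotImage A)ᶜ) :
    IsIso (restr (X.quotMap A) h) := by
  refine isIso_of_bijective _ ⟨fun a b e => ?_, ?_⟩ fun S => ?_
  · refine Subtype.ext ((quotMap_eq_iff.mp (congrArg Subtype.val e)).resolve_right ?_)
    exact fun h => a.2 h.1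
  · rintro ⟨y, hy⟩
    obtain ⟨x, rfl⟩ := X.quotMap_surjective A y
    exact ⟨⟨x, fun hx => hy ⟨x, hx, rfl⟩⟩, rfl⟩
  · rintro ⟨_, hy'⟩ ⟨x, hx, rfl⟩
    refine ⟨⟨x, fun h => hy' ⟨x, h, rfl⟩⟩, X.cl_mono ?_ hx, rfl⟩
    rintro z ⟨_, ⟨s, hs, rfl⟩, e⟩
    rcases quotMap_eq_iff.mp e with e | e
    exacts [⟨s, hs, e⟩, absurd e.1 s.2]

/-- The map from the quotient of a subspace to the image of the subspace in the quotient. -/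
def quotSub (X : Cl.{u}) (A B : Set X) : (X.sub B).quot (Subtype.val ⁻¹' A) ⟶
    (X.quot A).sub (Hom.toFun (X.quotMap A) '' B) :=
  quotDesc (restr (X.quotMap A) (Set.mapsTo_image _ B)) fun _ ha _ hb =>
    Subtype.ext (quotMap_eq_iff.mpr (Or.inr ⟨ha, hb⟩))

/-- `B` contains the only class that can have more than one point, so it is saturated. A subset of
the image of `B` then has the same preimage in `X` as in `B`, and both closures come from the
closure of this preimage in `X`. -/
lemma isIso_quotSub (X : Cl.{u}) {A B : Set X} (hAB : A ⊆ B) : IsIso (X.quotSub A B) := by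
  refine isIso_of_bijective _ ⟨fun a b e => ?_, ?_⟩ fun S => ?_
  · obtain ⟨a, rfl⟩ := (X.sub B).quotMap_surjective _ a
    obtain ⟨b, rfl⟩ := (X.sub B).quotMap_surjective _ b
    exact quotMap_eq_iff.mpr
      ((quotMap_eq_iff.mp (congrArg Subtype.val e)).imp Subtype.ext id)
  · rintro ⟨_, b, hb, rfl⟩
    exact ⟨Hom.toFun ((X.sub B).quotMap (Subtype.val ⁻¹' A)) ⟨b, hb⟩, rfl⟩
  · rintro ⟨_, hy⟩ ⟨x, hx, rfl⟩
    have hxB : x ∈ B := (mem_quotMap_image_iff hAB).mp hy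
    refine ⟨Hom.toFun ((X.sub B).quotMap (Subtype.val ⁻¹' A)) ⟨x, hxB⟩,
      ⟨_, X.cl_mono ?_ hx, rfl⟩, rfl⟩
    rintro z ⟨_, ⟨s, hs, rfl⟩, e⟩
    obtain ⟨s, rfl⟩ := (X.sub B).quotMap_surjective _ s
    have hz : z ∈ B := by
      rcases quotMap_eq_iff.mp e with e | e
      exacts [e ▸ s.2, hAB e.2]
    refine ⟨⟨z, hz⟩, ?_, rfl⟩
    have e' : Hom.toFun ((X.sub B).quotMap (Subtype.val ⁻¹' A)) s =
        Hom.toFun ((X.sub B).quotMap (Subtype.val ⁻¹' A)) ⟨z, hz⟩ :=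
      quotMap_eq_iff.mpr ((quotMap_eq_iff.mp e).imp (fun h => Subtype.ext h) id)
    exact (e' ▸ hs : _ ∈ S)

end Quotient

/-! ### Homotopies and quotients -/

lemma mem_int_prod {X : Cl.{u}} {Y : Cl.{v}} {x : X} {y : Y} {W : Set (X.prod Y)} :
    ((x, y) : X × Y) ∈ (X.prod Y).int W ↔ ∃ (U : Set X) (V : Set Y), x ∈ X.int U ∧ y ∈ Y.int V ∧
      ∀ a ∈ U, ∀ b ∈ V, ((a, b) : X × Y) ∈ W := by
  refine not_iff_comm.mp ⟨fun h U V hU hV => ?_, fun h => ?_⟩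
  · by_contra hn
    refine h ⟨U, V, hU, hV, fun a ha b hb => ?_⟩
    by_contra hW
    exact hn ⟨_, hW, ha, hb⟩
  · rintro ⟨U, V, hU, hV, h'⟩
    obtain ⟨⟨a, b⟩, hW, ha, hb⟩ := h U V hU hV
    exact hW (h' a ha b hb)

/-- A map that pulls neighborhoods back to neighborhoods is continuous. -/
def Hom.ofNhd {X : Cl.{u}} {Y : Cl.{v}} (f : X → Y)
    (h : ∀ x V, f x ∈ Y.int V → x ∈ X.int (f ⁻¹' V)) : Hom X Y where
  toFun := f
  cont S := by
    rintro _ ⟨x, hx, rfl⟩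
    by_contra hn
    refine h x (f '' S)ᶜ (by rwa [int, compl_compl]) (X.cl_mono ?_ hx)
    exact fun y hy hy' => hy' ⟨y, hy, rfl⟩

end Cl

/-- Compactness of the interval, stated for neighborhoods. It is topological for `[0,1]` and
finiteness for the other two. -/
lemma Intv.exists_finite_subcover (J : Intv) (N : J.space → Set J.space)
    (hN : ∀ s, s ∈ J.space.int (N s)) : ∃ F : Finset J.space, ∀ t, ∃ s ∈ F, t ∈ N s := by
  have hfin : ∀ F : Finset J.space, (∀ t, t ∈ F) → ∃ F : Finset J.space, ∀ t, ∃ s ∈ F, t ∈ N s :=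
    fun F hF => ⟨F, fun t => ⟨t, hF t, J.space.int_subset _ (hN t)⟩⟩
  cases J with
  | unit =>
    obtain ⟨F, hF⟩ := CompactSpace.elim_nhds_subcover (X := unitInterval) N (fun s =>
      mem_interior_iff_mem_nhds.mp ((Cl.int_ofTop (Z := unitInterval) (N s)).subset (hN s)))
    refine ⟨F, fun t => ?_⟩
    obtain ⟨s, hs, ht⟩ := Set.mem_iUnion₂.mp (hF.symm ▸ Set.mem_univ t : t ∈ ⋃ s ∈ F, N s)
    exact ⟨s, hs, ht⟩
  | plus => exact hfin (Finset.univ : Finset (Fin 2)) (Finset.mem_univ (α := Fin 2))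
  | one => exact hfin (Finset.univ : Finset (Fin 2)) (Finset.mem_univ (α := Fin 2))

/-- The tube lemma. -/
lemma Intv.exists_tube (J : Intv) {X : Cl.{u}} {x : X} {W : Set (X.prod J.space)}
    (h : ∀ s : J.space, ((x, s) : X × J.space) ∈ (X.prod J.space).int W) :
    ∃ U, x ∈ X.int U ∧ ∀ y ∈ U, ∀ s : J.space, ((y, s) : X × J.space) ∈ W := by
  simp only [Cl.mem_int_prod] at h
  choose U N hU hN hW using h
  obtain ⟨F, hF⟩ := J.exists_finite_subcover N hN
  refine ⟨{y | ∀ s ∈ F, y ∈ U s}, X.int_biInter F U x fun s _ => hU s, fun y hy t => ?_⟩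
  obtain ⟨s, hs, ht⟩ := hF t
  exact hW s y (hy s hs) t ht

/-- Only continuity of the descended homotopy needs an argument. It is checked on neighborhoods,
separately at the collapsed point and away from it. -/
lemma OneStepHomotopicRel.quot {J : Intv} {Y : Cl.{u}} {A : Set Y} {f g : Y ⟶ Y}
    (h : OneStepHomotopicRel J A f g) (hf : ∀ a ∈ A, Cl.Hom.toFun f a = a)
    {f' g' : Y.quot A ⟶ Y.quot A} (hf' : f ≫ Y.quotMap A = Y.quotMap A ≫ f')
    (hg' : g ≫ Y.quotMap A = Y.quotMap A ≫ g') :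
    OneStepHomotopicRel J (Y.quotImage A) f' g' := by
  obtain ⟨H, h0, h1, hA⟩ := h
  let q := Cl.Hom.toFun (Y.quotMap A)
  let K : Y.quot A → J.space → Y.quot A := Quotient.lift (fun y t => q (H (y, t))) (by
    rintro a b (rfl | ⟨ha, hb⟩)
    · rfl
    · funext t
      rw [hA a ha, hA b hb, hf a ha, hf b hb]
      exact Cl.quotMap_eq_iff.mpr (Or.inr ⟨ha, hb⟩))
  have hK : ∀ y t, K (q y) t = q (H (y, t)) := fun _ _ => rfl
  refine ⟨Cl.Hom.ofNhd (fun p : Y.quot A × J.space => K p.1 p.2) ?_, fun y => ?_, fun y => ?_, ?_⟩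
  · rintro ⟨y, t⟩ V hV
    obtain ⟨y, rfl⟩ := Y.quotMap_surjective A y
    have hV' := Cl.mem_int_quot.mp hV
    refine Cl.mem_int_prod.mpr ?_
    by_cases hy : y ∈ A
    -- The homotopy rests at `a`, so the preimage of `V` is a neighborhood of every point of `{a} ×
    -- J`, and the tube lemma gives one neighborhood of `a` valid for all times.
    · have hU : ∀ a ∈ A, ∃ U, a ∈ Y.int U ∧ ∀ y ∈ U, ∀ s : J.space,
          ((y, s) : Y × J.space) ∈ H.toFun ⁻¹' (q ⁻¹' V) := fun a ha =>
        J.exists_tube fun s => H.preimage_nhd (by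
          rw [hA a ha, hf a ha]
          refine hV' a ?_
          rw [hA y hy, hf y hy]
          exact Cl.quotMap_eq_iff.mpr (Or.inr ⟨ha, hy⟩))
      choose! U hU hUV using hU
      -- The union of the tubes' bases is a neighborhood of every point of `A`, hence its image is
      -- one of the collapsed point. An arbitrary union is allowed because all times are covered at
      -- once.
      refine ⟨q '' ⋃ a ∈ A, U a, Set.univ, Cl.mem_int_quot.mpr fun a e => ?_, ?_, ?_⟩
      · have ha : a ∈ A := by
          rcases Cl.quotMap_eq_iff.mp e with rfl | e
          exacts [hy, e.1]
        refine Y.int_mono ?_ (hU a ha)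
        exact fun z hz => ⟨z, Set.mem_iUnion₂.mpr ⟨a, ha, hz⟩, rfl⟩
      · rw [Cl.int_univ]
        exact Set.mem_univ _
      · rintro _ ⟨z, hz, rfl⟩ s -
        obtain ⟨a, ha, hz⟩ := Set.mem_iUnion₂.mp hz
        exact hUV a ha z hz s
    -- Away from `A` the fibre is one point, so any box around `(y, t)` descends.
    · obtain ⟨U, N, hU, hN, hUN⟩ := Cl.mem_int_prod.mp (H.preimage_nhd (hV' _ rfl))
      refine ⟨q '' U, N, Cl.mem_int_quot.mpr fun z e => ?_, hN, ?_⟩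
      · obtain rfl : z = y := (Cl.quotMap_eq_iff.mp e).resolve_right fun h => hy h.2
        exact Y.int_mono (Set.subset_preimage_image _ _) hU
      · rintro _ ⟨z, hz, rfl⟩ s hs
        exact hUN z hz s hs
  · obtain ⟨y, rfl⟩ := Y.quotMap_surjective A y
    exact (congrArg q (h0 y)).trans (congrArg (fun k => Cl.Hom.toFun k y) hf')
  · obtain ⟨y, rfl⟩ := Y.quotMap_surjective A y
    exact (congrArg q (h1 y)).trans (congrArg (fun k => Cl.Hom.toFun k y) hg')
  · rintro _ ⟨a, ha, rfl⟩ t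
    exact (congrArg q (hA a ha t)).trans (congrArg (fun k => Cl.Hom.toFun k a) hf')

/-- The first conjunct passes pointwise fixing of `A` along the zigzag of one-step homotopies, so
that every intermediate map descends and the second conjunct can be proved by induction. -/
lemma HomotopicRel.quot {J : Intv} {Y : Cl.{u}} {A : Set Y} {f g : Y ⟶ Y}
    (h : HomotopicRel J A f g) : (∀ a ∈ A, Cl.Hom.toFun f a = Cl.Hom.toFun g a) ∧
      ((∀ a ∈ A, Cl.Hom.toFun f a = a) → ∀ f' g' : Y.quot A ⟶ Y.quot A,
        f ≫ Y.quotMap A = Y.quotMap A ≫ f' → g ≫ Y.quotMap A = Y.quotMap A ≫ g' →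
        HomotopicRel J (Y.quotImage A) f' g') := by
  induction h with
  | rel f g h =>
    refine ⟨fun a ha => ?_, fun hf f' g' hf' hg' => .rel _ _ (h.quot hf hf' hg')⟩
    obtain ⟨H, -, h1, hA⟩ := h
    exact (hA a ha _).symm.trans (h1 a)
  | refl f =>
    refine ⟨fun _ _ => rfl, fun _ f' g' hf' hg' => ?_⟩
    obtain rfl : f' = g' := by
      refine Cl.Hom.ext (funext fun y => ?_)
      obtain ⟨y, rfl⟩ := Y.quotMap_surjective A y
      exact congrArg (fun k => Cl.Hom.toFun k y) (hf'.symm.trans hg')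
    exact .refl _
  | symm f g _ ih =>
    exact ⟨fun a ha => (ih.1 a ha).symm, fun hg f' g' hf' hg' =>
      .symm _ _ (ih.2 (fun a ha => (ih.1 a ha).trans (hg a ha)) g' f' hg' hf')⟩
  | trans f g k _ _ ih₁ ih₂ =>
    refine ⟨fun a ha => (ih₁.1 a ha).trans (ih₂.1 a ha), fun hf f' k' hf' hk' => ?_⟩
    have hg : ∀ a ∈ A, Cl.Hom.toFun g a = a := fun a ha => (ih₁.1 a ha).symm.trans (hf a ha)
    -- The intermediate map fixes `A` pointwise, hence induces a map of the quotient.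
    let g' : Y.quot A ⟶ Y.quot A := Cl.quotDesc (g ≫ Y.quotMap A) fun a ha b hb =>
      Cl.quotMap_eq_iff.mpr (Or.inr ⟨(hg a ha).symm ▸ ha, (hg b hb).symm ▸ hb⟩)
    exact .trans _ g' _ (ih₁.2 hf f' g' hf' rfl) (ih₂.2 hg g' k' rfl hk')

/-- A deformation retraction onto `A` descends to the quotient by `A`. -/
lemma DeformationRetracts.quot {J : Intv} {Y : Cl.{u}} {A : Set Y}
    (h : DeformationRetracts J Y A) :
    DeformationRetracts J (Y.quot A) (Y.quotImage A) := by
  obtain ⟨r, hr, hrA, h⟩ := h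
  refine ⟨Cl.quotDesc (r ≫ Y.quotMap A) fun a _ b _ =>
    Cl.quotMap_eq_iff.mpr (Or.inr ⟨hr a, hr b⟩), fun y => ?_, ?_, ?_⟩
  · obtain ⟨y, rfl⟩ := Y.quotMap_surjective A y
    exact ⟨_, hr y, rfl⟩
  · rintro _ ⟨a, ha, rfl⟩
    exact congrArg (Cl.Hom.toFun (Y.quotMap A)) (hrA a ha)
  · exact h.quot.2 (fun _ _ => rfl) _ _ rfl rfl

/-! ### Comparison of a good pair with its quotient pair -/

namespace Theory

variable (T : Theory) {J : Intv}

/-- If `B` deformation retracts onto `A`, the inclusion of `A` into `B` is a quasi-isomorphism. -/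
lemma quasiIso_restr_id {X : Cl.{u}} {A B : Set X} (hAB : A ⊆ B)
    (h : QuasiIso ((T.chains J).map ((X.sub B).incl (Subtype.val ⁻¹' A))))
    (hm : Set.MapsTo (Cl.Hom.toFun (𝟙 X)) A B) :
    QuasiIso ((T.chains J).map (Cl.restr (𝟙 X) hm)) := by
  have hi : Set.MapsTo (Cl.Hom.toFun (X.incl B)) (Subtype.val ⁻¹' A) A := fun _ h => h
  have := X.isIso_restr_incl hAB hi
  have e : (T.chains J).map (Cl.restr (X.incl B) hi) ≫ (T.chains J).map (Cl.restr (𝟙 X) hm) =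
      (T.chains J).map ((X.sub B).incl (Subtype.val ⁻¹' A)) := by
    rw [← Functor.map_comp]
    rfl
  rw [← e] at h
  exact quasiIso_of_comp_left ((T.chains J).map (Cl.restr (X.incl B) hi)) _

/-- The descended retraction lives on `B / A`; the isomorphism of `B / A` with the image of `B` in
`X / A` carries it over. -/
lemma quasiIso_incl_quot {X : Cl.{u}} {A B : Set X} (hAB : A ⊆ B)
    (h : DeformationRetracts J (X.sub B) (Subtype.val ⁻¹' A)) :
    QuasiIso ((T.chains J).map (((X.quot A).sub (Cl.Hom.toFun (X.quotMap A) '' B)).incl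
      (Subtype.val ⁻¹' X.quotImage A))) := by
  have h' := T.quasiIso_of_deformationRetracts J h.quot
  have := X.isIso_quotSub hAB
  have hm : Set.MapsTo (Cl.Hom.toFun (X.quotSub A B))
      ((X.sub B).quotImage (Subtype.val ⁻¹' A)) (Subtype.val ⁻¹' X.quotImage A) := by
    rintro _ ⟨a, ha, rfl⟩
    exact ⟨a.1, ha, rfl⟩
  have := Cl.isIso_restr (X.quotSub A B) hm fun y hy => by
    obtain ⟨y, rfl⟩ := (X.sub B).quotMap_surjective _ y
    exact ⟨y, Cl.quotMap_mem_quotImage (X := X).mp hy, rfl⟩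
  have e : (T.chains J).map (Cl.restr (X.quotSub A B) hm) ≫
      (T.chains J).map (((X.quot A).sub (Cl.Hom.toFun (X.quotMap A) '' B)).incl
        (Subtype.val ⁻¹' X.quotImage A)) =
      (T.chains J).map (((X.sub B).quot (Subtype.val ⁻¹' A)).incl
        ((X.sub B).quotImage (Subtype.val ⁻¹' A))) ≫ (T.chains J).map (X.quotSub A B) := by
    rw [← Functor.map_comp, ← Functor.map_comp]
    rfl
  have h2 : QuasiIso ((T.chains J).map (((X.sub B).quot (Subtype.val ⁻¹' A)).incl
        ((X.sub B).quotImage (Subtype.val ⁻¹' A))) ≫ (T.chains J).map (X.quotSub A B)) :=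
    inferInstance
  rw [← e] at h2
  exact quasiIso_of_comp_left ((T.chains J).map (Cl.restr (X.quotSub A B) hm)) _

/-- The projection of a good pair onto the quotient pair is a quasi-isomorphism. -/
lemma quasiIso_relMap_quotMap {X : Cl.{u}} {A : Set X} (hgood : IsGoodPair J X A)
    (hA : J ≠ Intv.one → X.Closed A)
    (hm : Set.MapsTo (Cl.Hom.toFun (X.quotMap A)) A (X.quotImage A)) :
    QuasiIso (T.relMap J (X.quotMap A) hm) := by
  obtain ⟨B, hB, hr⟩ := hgood
  have hAB : A ⊆ B := hB.trans (X.int_subset _)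
  let Y := X.quot A
  let q := X.quotMap A
  let P := X.quotImage A
  let B' : Set Y := Cl.Hom.toFun q '' B
  have hPB : P ⊆ B' := Set.image_mono hAB
  have hAc : Set.MapsTo (Cl.Hom.toFun q) Aᶜ Pᶜ := fun x hx h =>
    hx (Cl.quotMap_mem_quotImage.mp h)
  have hqB : Set.MapsTo (Cl.Hom.toFun q) B B' := Set.mapsTo_image _ B
  have hex : Set.MapsTo (Cl.Hom.toFun (X.incl Aᶜ)) (Subtype.val ⁻¹' B) B := fun _ h => h
  have hexY : Set.MapsTo (Cl.Hom.toFun (Y.incl Pᶜ)) (Subtype.val ⁻¹' B') B' := fun _ h => h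
  have hc : Set.MapsTo (Cl.Hom.toFun (Cl.restr q hAc)) (Subtype.val ⁻¹' B)
      (Subtype.val ⁻¹' B') := fun x hx => hqB hx
  have hX : Set.MapsTo (Cl.Hom.toFun (𝟙 X)) A B := fun x hx => hAB hx
  have hY : Set.MapsTo (Cl.Hom.toFun (𝟙 Y)) P B' := fun x hx => hPB hx
  -- Enlarging `A` to `B`, and the collapsed point to the image of `B`, does not change relative
  -- homology.
  have i₁ : QuasiIso (T.relMap J (𝟙 X) hX) := T.quasiIso_relMap J _ _
    (T.quasiIso_restr_id hAB (T.quasiIso_of_deformationRetracts J hr) hX)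
    inferInstance
  have i₂ : QuasiIso (T.relMap J (𝟙 Y) hY) := T.quasiIso_relMap J _ _
    (T.quasiIso_restr_id hPB (T.quasiIso_incl_quot hAB hr) hY)
    inferInstance
  -- Excision of `A` from `(X, B)`, and of the collapsed point from the image pair.
  have i₃ : QuasiIso (T.relMap J (X.incl Aᶜ) hex) :=
    (T.isExcisive_of_isNhd J hB hA).quasiIso_relMap T J hex
  have i₄ : QuasiIso (T.relMap J (Y.incl Pᶜ) hexY) :=
    (T.isExcisive_of_isNhd J hB.quotImage fun h => (hA h).quotImage).quasiIso_relMap T J hexY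
  have j₁ : IsIso (Cl.restr q hAc) := Cl.isIso_restr_quotMap_compl hAc
  have j₂ : IsIso (Cl.restr (Cl.restr q hAc) hc) := Cl.isIso_restr _ hc fun x hx =>
    (Cl.mem_quotMap_image_iff hAB).mp hx
  have i₅ : QuasiIso (T.relMap J (Cl.restr q hAc) hc) := T.quasiIso_relMap J _ _
    inferInstance inferInstance
  -- First square: excision reduces `q` on `(X, B)` to its restriction off `A`, an isomorphism of
  -- pairs.
  have e₁ : T.relMap J (X.incl Aᶜ) hex ≫ T.relMap J q hqB =
      T.relMap J (Cl.restr q hAc) hc ≫ T.relMap J (Y.incl Pᶜ) hexY :=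
    (T.relMap_comp J _ _ hex hqB fun x hx => hqB hx).trans
      (T.relMap_comp J _ _ hc hexY fun x hx => hqB hx).symm
  have i₆ : QuasiIso (T.relMap J q hqB) := by
    have : QuasiIso (T.relMap J (X.incl Aᶜ) hex ≫ T.relMap J q hqB) := by
      rw [e₁]
      infer_instance
    exact quasiIso_of_comp_left (T.relMap J (X.incl Aᶜ) hex) _
  -- Second square: the enlargements carry the result back from `(X, B)` to `(X, A)`.
  have e₂ : T.relMap J q hm ≫ T.relMap J (𝟙 Y) hY = T.relMap J (𝟙 X) hX ≫ T.relMap J q hqB :=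
    (T.relMap_comp J _ _ hm hY fun x hx => hPB (hm hx)).trans
      (T.relMap_comp J _ _ hX hqB fun x hx => hPB (hm hx)).symm
  have : QuasiIso (T.relMap J q hm ≫ T.relMap J (𝟙 Y) hY) := by
    rw [e₂]
    infer_instance
  exact quasiIso_of_comp_right _ (T.relMap J (𝟙 Y) hY)

end Theory

/-! ## Reduced homology of the quotient -/

lemma CategoryTheory.ShortComplex.ShortExact.quasiIso_g
    {S : ShortComplex (ChainComplex (ModuleCat.{u} ℤ) ℕ)} (hS : S.ShortExact)
    (h : S.X₁.Acyclic) : _root_.QuasiIso S.g := by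
  have hz := fun i => (S.X₁.exactAt_iff_isZero_homology i).mp (h i)
  have := hS.epi_g
  rw [_root_.quasiIso_iff]
  intro n
  rw [_root_.quasiIsoAt_iff_isIso_homologyMap]
  have h1 : Mono (HomologicalComplex.homologyMap S.g n) :=
    (hS.homology_exact₂ n).mono_g ((hz n).eq_of_src _ _)
  have h2 : Epi (HomologicalComplex.homologyMap S.g n) := by
    cases n with
    -- No connecting homomorphism leaves degree `0`; surjectivity there comes from that of the chain
    -- map.
    | zero => exact HomologicalComplex.epi_homologyMap_of_epi_of_not_rel _ _ (by simp)
    | succ n => exact (hS.homology_exact₃ (n + 1) n rfl).epi_f ((hz n).eq_of_tgt _ _)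
  exact isIso_of_mono_of_epi _

namespace Theory

variable (T : Theory) (J : Intv)

lemma aug_mk_single (X : Cl.{u}) (σ : Cl.Hom (T.model J 0) X) (z : ℤ) :
    (T.aug J X).f 0 (T.mk J 0 X (Finsupp.single σ z)) = ULift.up.{u} z := by
  cases T
  · change (simpAug J X).f 0 _ = _
    rw [simpAug, ChainComplex.toSingle₀Equiv_symm_apply_f_zero (C := (simpChains J).obj X)
      (ModuleCat.ofHom (augZ _)) (simpAug_aux J X)]
    exact augZ_single _ (ULift.up.{u} z)
  · change (cubeAug J X).f 0 _ = _
    rw [cubeAug, ChainComplex.toSingle₀Equiv_symm_apply_f_zero (C := (cubeChains J).obj X)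
      _ (cubeAug_aux J X)]
    exact augZ_single _ (ULift.up.{u} z)

lemma aug_eq_zero (X : Cl.{u}) {n : ℕ} (c : ((T.chains J).obj X).X (n + 1)) :
    (T.aug J X).f (n + 1) c = 0 := by
  have := ModuleCat.subsingleton_of_isZero
    (HomologicalComplex.isZero_single_obj_X (ComplexShape.down ℕ) 0
      (ModuleCat.of ℤ (ULift.{u} ℤ)) (n + 1) (by simp))
  exact @Subsingleton.elim _ this _ _

/-- In a one-point space, every chain is a multiple of the constant generator. -/
lemma exists_mk_single (X : Cl.{u}) [Subsingleton X] (x : X) {n : ℕ}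
    (c : ((T.chains J).obj X).X n) :
    ∃ z : ℤ, c = T.mk J n X (Finsupp.single (Cl.Hom.const _ x) z) := by
  obtain ⟨c, rfl⟩ := T.mk_surjective J n X c
  refine ⟨c (Cl.Hom.const _ x), congrArg _ (Finsupp.ext fun σ => ?_)⟩
  obtain rfl : σ = Cl.Hom.const _ x := Cl.Hom.ext (funext fun _ => Subsingleton.elim _ _)
  rw [Finsupp.single_eq_same]

/-- All `n + 2` faces of a constant simplex are the same constant simplex, and their alternating
signs sum to `0` or `1`. -/
lemma simplicial_d_const (X : Cl.{u}) (x : X) (n : ℕ) (z : ℤ) :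
    ((simplicial.chains J).obj X).d (n + 1) n
        (simplicial.mk J (n + 1) X (Finsupp.single (Cl.Hom.const _ x) z)) =
      (if Even n then (0 : ℤ) else 1) •
        simplicial.mk J n X (Finsupp.single (Cl.Hom.const _ x) z) := by
  refine (Simp.d_mk_single J n _ z).trans ?_
  refine (Finset.sum_smul (f := fun i : Fin (n + 2) => (-1 : ℤ) ^ (i : ℕ))
    (x := Simp.mk J n X (Finsupp.single (Cl.Hom.const _ x) z)) ..).symm.trans ?_
  rw [Fin.sum_neg_one_pow]
  simp only [Nat.even_add_one, not_not]
  rfl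

lemma exists_d_eq_of_subsingleton (X : Cl.{u}) [Subsingleton X] (x : X) {n : ℕ}
    (c : ((T.chains J).obj X).X n) (hc : ∀ m, ((T.chains J).obj X).d n m c = 0)
    (ha : (T.aug J X).f n c = 0) : ∃ y, ((T.chains J).obj X).d (n + 1) n y = c := by
  obtain ⟨z, rfl⟩ := T.exists_mk_single J X x c
  cases n with
  | zero =>
    rw [aug_mk_single] at ha
    obtain rfl : z = 0 := congrArg ULift.down ha
    refine ⟨0, ?_⟩
    rw [map_zero, Finsupp.single_zero, map_zero]
  | succ n =>
    cases T with
    | simplicial =>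
      -- The degree is `n + 1`. For even `n` the differential into this degree is the identity on
      -- constant generators; for odd `n` the one out of it is, so a cycle vanishes.
      by_cases hn : Even n
      · refine ⟨simplicial.mk J (n + 2) X (Finsupp.single (Cl.Hom.const _ x) z), ?_⟩
        rw [simplicial_d_const, if_neg (by rwa [Nat.even_add_one, not_not]), one_smul]
      · have h := hc n
        rw [simplicial_d_const, if_neg hn, one_smul, mk_eq_zero_iff] at h
        have hz : z = 0 := by
          by_contra hz
          refine h (Cl.Hom.const _ x) ?_
          rwa [Finsupp.single_eq_same]
        refine ⟨0, ?_⟩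
        rw [hz, map_zero, Finsupp.single_zero, map_zero]
    | cubical =>
      refine ⟨0, (map_zero _).trans (Eq.symm ?_)⟩
      rw [mk_eq_zero_iff]
      -- In positive degree every cube of a point is degenerate in its first coordinate.
      exact fun σ _ => ⟨0, fun _ _ => Subsingleton.elim _ _⟩

/-- The reduced chains of a one-point space are acyclic. -/
lemma acyclic_redChains (X : Cl.{u}) [Subsingleton X] (x : X) : (T.redChains J X).Acyclic := by
  intro n
  rw [ChainComplex.exactAt_iff_elements]
  intro a ha
  obtain ⟨y, hy⟩ := T.exists_d_eq_of_subsingleton J X x ((T.redIncl J X).f n a)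
    (fun m => by rw [← ChainComplex.map_d, ha, map_zero]) (T.aug_redIncl J X a)
  obtain ⟨b, rfl⟩ := T.exists_redIncl_eq J X y (T.aug_eq_zero J X y)
  exact ⟨b, ChainComplex.injective_of_mono (T.redIncl J X) n
    ((ChainComplex.map_d _ _ _ _).trans hy)⟩

/-- The reduced homology of a quotient `X / A` is the homology of the pair `(X / A, A / A)`. -/
lemma quasiIso_redToRel_quot (X : Cl.{u}) {A : Set X} (hA : A.Nonempty) :
    QuasiIso (T.redToRel J (X.quot A) (X.quotImage A)) := by
  obtain ⟨a, ha⟩ := hA.image (Cl.Hom.toFun (X.quotMap A))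
  have : Subsingleton ((X.quot A).sub (X.quotImage A)) :=
    (X.quotImage_subsingleton A).coe_sort
  exact (T.redSeq_shortExact J (X.quot A) (X.quotImage A) ⟨a, ha⟩).quasiIso_g
    (T.acyclic_redChains J _ ⟨a, ha⟩)

lemma redMap_redToRel {X Y : Cl.{u}} (f : X ⟶ Y) {A : Set X} {B : Set Y}
    (h : Set.MapsTo (Cl.Hom.toFun f) A B) :
    T.redMap J f ≫ T.redToRel J Y B = T.redToRel J X A ≫ T.relMap J f h := by
  rw [redToRel, redToRel, ← Category.assoc, redMap_redIncl, Category.assoc, Category.assoc,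
    relProj_relMap]

end Theory

/-! ### The long exact sequence of the quotient -/

theorem mainTheorem10 (T : Theory) (J : Intv) (X : Cl.{u}) (A : Set X) (hgood : IsGoodPair J X A)
    (hclosed : J ≠ Intv.one → X.Closed A) :
    (∀ n : ℕ, IsIso (HomologicalComplex.homologyMap
      (T.relMap J (X.quotMap A) (Set.mapsTo_image _ A : Set.MapsTo _ A (X.quotImage A))) n)) ∧
    (A.Nonempty →
      (∀ n : ℕ, IsIso (HomologicalComplex.homologyMap
        (T.redToRel J (X.quot A) (X.quotImage A)) n)) ∧
      ∃ δ : ∀ n : ℕ, (T.redChains J (X.quot A)).homology (n + 1) ⟶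
          (T.redChains J (X.sub A)).homology n,
        (∀ (n : ℕ) (x : (T.relChains J X A).homology (n + 1))
          (y : (T.redChains J (X.quot A)).homology (n + 1)),
          HomologicalComplex.homologyMap (T.relMap J (X.quotMap A)
              (Set.mapsTo_image _ A : Set.MapsTo _ A (X.quotImage A))) (n + 1) x =
            HomologicalComplex.homologyMap (T.redToRel J (X.quot A) (X.quotImage A)) (n + 1) y →
          HomologicalComplex.homologyMap (T.redIncl J (X.sub A)) n (δ n y) =
            T.connecting J X A n x) ∧
        (∀ n : ℕ, Function.Exact
          (HomologicalComplex.homologyMap (T.redMap J (X.incl A)) n)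
          (HomologicalComplex.homologyMap (T.redMap J (X.quotMap A)) n)) ∧
        (∀ n : ℕ, Function.Exact
          (HomologicalComplex.homologyMap (T.redMap J (X.quotMap A)) (n + 1)) (δ n)) ∧
        (∀ n : ℕ, Function.Exact
          (δ n) (HomologicalComplex.homologyMap (T.redMap J (X.incl A)) n)) ∧
        Function.Surjective (HomologicalComplex.homologyMap (T.redMap J (X.quotMap A)) 0)) := by
  have hm : Set.MapsTo (Cl.Hom.toFun (X.quotMap A)) A (X.quotImage A) := Set.mapsTo_image _ A
  have i₁ := T.quasiIso_relMap_quotMap hgood hclosed hm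
  have hQ : ∀ n, IsIso (HomologicalComplex.homologyMap (T.relMap J (X.quotMap A) hm) n) :=
    fun n => inferInstance
  refine ⟨hQ, fun hA => ?_⟩
  have i₂ := T.quasiIso_redToRel_quot J X hA
  have hK : ∀ n, IsIso (HomologicalComplex.homologyMap
      (T.redToRel J (X.quot A) (X.quotImage A)) n) := fun n => inferInstance
  refine ⟨hK, ?_⟩
  have hS := T.redSeq_shortExact J X A hA
  have := hS.epi_g
  -- The isomorphism from the reduced homology of `X / A` to the homology of `(X, A)`, through the
  -- homology of `(X/A, A/A)`. It turns the map induced by `q` into the map from reduced to relative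
  -- homology.
  let k := fun n => HomologicalComplex.homologyMap
      (T.redToRel J (X.quot A) (X.quotImage A)) n ≫
    inv (HomologicalComplex.homologyMap (T.relMap J (X.quotMap A) hm) n)
  have hkQ : ∀ n y, HomologicalComplex.homologyMap (T.relMap J (X.quotMap A) hm) n (k n y) =
      HomologicalComplex.homologyMap (T.redToRel J (X.quot A) (X.quotImage A)) n y := fun n y =>
    ConcreteCategory.congr_hom (by simp [k] : k n ≫ _ = _) y
  have hk : ∀ n x, k n (HomologicalComplex.homologyMap (T.redMap J (X.quotMap A)) n x) =
      HomologicalComplex.homologyMap (T.redToRel J X A) n x := fun n x =>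
    ConcreteCategory.congr_hom (by
      simp only [k]
      rw [← Category.assoc, IsIso.comp_inv_eq, ← HomologicalComplex.homologyMap_comp,
        ← HomologicalComplex.homologyMap_comp, T.redMap_redToRel J _ hm] :
      HomologicalComplex.homologyMap (T.redMap J (X.quotMap A)) n ≫ k n = _) x
  have hbij : ∀ n, Function.Bijective (k n) := fun n =>
    ConcreteCategory.bijective_of_isIso (k n)
  have hex₁ : ∀ n, Function.Exact (hS.δ (n + 1) n rfl)
      (HomologicalComplex.homologyMap (T.redMap J (X.incl A)) n) := fun n =>
    (ShortComplex.ShortExact.moduleCat_exact_iff_function_exact _).mp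
      (hS.homology_exact₁ (n + 1) n rfl)
  have hex₂ : ∀ n, Function.Exact (HomologicalComplex.homologyMap (T.redMap J (X.incl A)) n)
      (HomologicalComplex.homologyMap (T.redToRel J X A) n) := fun n =>
    (ShortComplex.ShortExact.moduleCat_exact_iff_function_exact _).mp (hS.homology_exact₂ n)
  have hex₃ : ∀ n, Function.Exact (HomologicalComplex.homologyMap (T.redToRel J X A) (n + 1))
      (hS.δ (n + 1) n rfl) := fun n =>
    (ShortComplex.ShortExact.moduleCat_exact_iff_function_exact _).mp
      (hS.homology_exact₃ (n + 1) n rfl)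
  have hsurj : Function.Surjective (HomologicalComplex.homologyMap (T.redToRel J X A) 0) :=
    (ModuleCat.epi_iff_surjective _).mp
      (HomologicalComplex.epi_homologyMap_of_epi_of_not_rel (T.redSeq J X A).g 0 (by simp))
  -- The connecting map is that of the reduced sequence of `(X, A)`, transported along `k`;
  -- exactness is transported in the same way.
  refine ⟨fun n => k (n + 1) ≫ hS.δ (n + 1) n rfl, fun n x y hxy => ?_, fun n y => ?_,
    fun n y => ?_, fun n z => ?_, fun y => ?_⟩
  · have e : k (n + 1) y = x :=
      (ConcreteCategory.bijective_of_isIso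
        (HomologicalComplex.homologyMap (T.relMap J (X.quotMap A) hm) (n + 1))).1
        ((hkQ _ y).trans hxy.symm)
    change HomologicalComplex.homologyMap (T.redIncl J (X.sub A)) n
      (hS.δ (n + 1) n rfl (k (n + 1) y)) = _
    rw [e]
    -- The map from the reduced sequence to the sequence of the pair is the identity on relative
    -- chains, so naturality matches the two connecting homomorphisms.
    refine (ConcreteCategory.congr_hom (HomologicalComplex.HomologySequence.δ_naturality
      (T.redSeqToPairSeq J X A) hS (T.pairSeq_shortExact J X A) (n + 1) n rfl) x).trans ?_
    refine congrArg (T.connecting J X A n) ?_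
    exact ConcreteCategory.congr_hom (HomologicalComplex.homologyMap_id _ _) x
  · rw [← hex₂ n y, ← hk, map_eq_zero_iff _ (hbij n).1]
  · refine (hex₃ n (k (n + 1) y)).trans (exists_congr fun x => ?_)
    rw [← hk, (hbij _).1.eq_iff]
  · refine (hex₁ n z).trans ⟨?_, ?_⟩
    · rintro ⟨w, rfl⟩
      obtain ⟨y, rfl⟩ := (hbij (n + 1)).2 w
      exact ⟨y, rfl⟩
    · rintro ⟨y, rfl⟩
      exact ⟨k (n + 1) y, rfl⟩
  · obtain ⟨x, hx⟩ := hsurj (k 0 y)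
    exact ⟨x, (hbij 0).1 ((hk 0 x).trans hx)⟩
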